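/- **Proposition 2.5.** Let $\mathbb H^2$ be the hyperbolic plane (Poincaré disk model, with ideal boundary $\partial_\infty\mathbb H^2$ the unit circle) and equip $\mathbb H^2\times\mathbb R$ with the product metric. The asymptotic boundary of $M\subset\mathbb H^2\times\mathbb R$ is $\partial_\infty M=\overline M\cap(\partial_\infty\mathbb H^2\times\mathbb R)$, the closure being taken in $\mathbb C\times\mathbb R$; similarly for subsets of $\mathbb H^2$. Let $q_1\neq q_2$ be points of $\partial_\infty\mathbb H^2$, let $\gamma\subset\mathbb H^2$ be the complete geodesic with asymptotic boundary $\{q_1,q_2\}$, and let $c_1$ (resp. $c_2$) be the closed arc of $\partial_\infty\mathbb H^2$ going counterclockwise from $q_1$ to $q_2$ (resp. from $q_2$ to $q_1$). For $d>1$ and for $0<d<1$ respectively, put $$H(d)=\int_{\cosh^{-1}(d)}^{+\infty}\frac{d}{\sqrt{\cosh^2u-d^2}}\,du\quad(d>1),\qquad G(d)=\int_0^{+\infty}\frac{d}{\sqrt{\cosh^2u-d^2}}\,du\quad(0<d<1).$$ These integrals converge. There is a one-parameter family $M_d$, $d>0$, of (connected, smooth) complete properly embedded minimal surfaces in $\mathbb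 H^2\times\mathbb R$, each invariant under all maps $(z,t)\mapsto(T(z),t)$ with $T$ a hyperbolic translation along $\gamma$, such that the following holds. 1. Let $d>1$, and let $\gamma_d$ be the equidistant line at distance $\cosh^{-1}(d)$ from $\gamma$ in the component of $\mathbb H^2\setminus\gamma$ with asymptotic boundary $c_1$. Then $M_d$ contains $\gamma_d\times\{0\}$, is symmetric with respect to the slice $\mathbb H^2\times\{0\}$, and $$\partial_\infty M_d=(c_1\times\{-H(d)\})\cup(c_1\times\{H(d)\})\cup(\{q_2\}\times[-H(d),H(d)])\cup(\{q_1\}\times[-H(d),H(d)]);$$ this is a Jordan curve homologous to zero in $\partial_\infty\mathbb H^2\times\mathbb R$. Let $\Omega_d$ be the component of $\mathbb H^2\setminus\gamma_d$ with asymptotic boundary $c_1$. Then $M_d\cap(\mathbb H^2\times[0,H(d)])$ is the graph of a continuous function on $\Omega_d\cup\gamma_d$ that is smooth on $\Omega_d$. The function $H$ is nonincreasing on $(1,\infty)$, with $\lim_{d\to1^+}H(d)=+\infty$ and $\lim_{d\to+\infty}H(d)=\pi/2$. 2. For $d=1$, $M_1$ is congruent to the surface $S$ given in the half-plane model $\{y>0\}$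 by $$t=\ln\left(\frac{\sqrt{x^2+y^2}+y}{x}\right),\qquad x>0,\ y>0.$$ More precisely, $M_1$ is the image of $S$ under $(w,t)\mapsto(\Phi(w),-t)$, where $\Phi$ is an orientation preserving isometry from the half-plane model onto the disk model whose extension to the ideal boundary takes $0$ to $q_1$ and $\infty$ to $q_2$. Moreover $$\partial_\infty M_1=(\{q_1\}\times(-\infty,0])\cup(c_1\times\{0\})\cup(\{q_2\}\times(-\infty,0]).$$ 3. Let $0<d<1$. Then $M_d$ is an entire vertical graph, that is, the graph of a smooth function $\mathbb H^2\to\mathbb R$; it contains $\gamma\times\{0\}$, and $$\partial_\infty M_d=(c_2\times\{-G(d)\})\cup(c_1\times\{G(d)\})\cup(\{q_1\}\times[-G(d),G(d)])\cup(\{q_2\}\times[-G(d),G(d)]);$$ this is a Jordan curve not homologous to zero in $\partial_\infty\mathbb H^2\times\mathbb R$. The function $G$ is nondecreasing on $(0,1)$, with $\lim_{d\to0^+}G(d)=0$ and $\lim_{d\to1^-}G(d)=+\infty$. -/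

import Mathlib

open Set Filter Topology MeasureTheory
open scoped ContDiff ENNReal

noncomputable section

namespace H2R

/-! ### The hyperbolic plane (Poincaré disk) and its ideal boundary -/

/-- The Poincaré disk model of the hyperbolic plane, as a subset of `ℂ`. -/
def hypPlane : Set ℂ := Metric.ball 0 1

/-- The ideal boundary of the hyperbolic plane: the unit circle. -/
def idealBoundary : Set ℂ := Metric.sphere 0 1

/-- The hyperbolic distance of the Poincaré disk, for the metric `(2 / (1 - |z|²))² |dz|²`. -/
def hypDist (z w : ℂ) : ℝ :=
  2 * Real.arsinh (‖z - w‖ / √((1 - ‖z‖ ^ 2) * (1 - ‖w‖ ^ 2)))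

/-- The hyperbolic distance from the point `z` to the nonempty set `S`. -/
def hypDistTo (S : Set ℂ) (z : ℂ) : ℝ := sInf ((fun w => hypDist z w) '' S)

/-- The Möbius map `z ↦ (α z + β) / (β̄ z + ᾱ)`. For `|β| < |α|` these are exactly the
orientation preserving isometries of the Poincaré disk, together with their extension to the
ideal boundary. -/
def moebius (α β z : ℂ) : ℂ :=
  (α * z + β) / ((starRingEnd ℂ) β * z + (starRingEnd ℂ) α)

/-- The complete geodesic with ideal end points `p ≠ q`: the image of the diameter `(-1, 1)`
under an orientation preserving isometry that takes `-1` to `p` and `1` to `q`. (The image is the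
same for all such isometries.) -/
def geodesicLine (p q : ℂ) : Set ℂ :=
  {z | ∃ α β : ℂ, ‖β‖ < ‖α‖ ∧ moebius α β (-1) = p ∧ moebius α β 1 = q ∧
    ∃ x : ℝ, -1 < x ∧ x < 1 ∧ z = moebius α β x}

/-- `T` is a hyperbolic translation along the geodesic with ideal end points `p ≠ q` (the identity
being admitted): an orientation preserving isometry whose extension fixes both `p` and `q`. -/
def IsHypTranslation (p q : ℂ) (T : ℂ → ℂ) : Prop :=
  ∃ α β : ℂ, ‖β‖ < ‖α‖ ∧ T = moebius α β ∧ T p = p ∧ T q = q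

/-- The closed arc of the ideal boundary going from `p` to `q ≠ p` counterclockwise. -/
def ccwArc (p q : ℂ) : Set ℂ :=
  {z | ∃ θ φ : ℝ, 0 ≤ θ ∧ θ ≤ φ ∧ φ < 2 * Real.pi ∧
    q = Complex.exp (φ * Complex.I) * p ∧ z = Complex.exp (θ * Complex.I) * p}

/-- The asymptotic boundary of a subset of the hyperbolic plane. -/
def planeAsympBoundary (S : Set ℂ) : Set ℂ := closure S ∩ idealBoundary

/-- The connected component of `ℍ² \ S` whose asymptotic boundary is `A`
(the union of these components, should there be several). -/
def componentWith (S A : Set ℂ) : Set ℂ :=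
  {z ∈ hypPlane \ S | planeAsympBoundary (connectedComponentIn (hypPlane \ S) z) = A}

/-! ### The product `ℍ² × ℝ` and its asymptotic boundary -/

/-- The space `ℍ² × ℝ`. -/
def space : Set (ℂ × ℝ) := hypPlane ×ˢ univ

/-- The cylinder `∂_∞ ℍ² × ℝ`. -/
def cylinder : Set (ℂ × ℝ) := idealBoundary ×ˢ univ

/-- The asymptotic boundary in `∂_∞ ℍ² × ℝ` of a subset of `ℍ² × ℝ`. -/
def asympBoundary (M : Set (ℂ × ℝ)) : Set (ℂ × ℝ) := closure M ∩ cylinder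

/-- The product metric `(2 / (1 - |z|²))² |dz|² + dt²` at `p = (z, t)`. -/
def metric (p a b : ℂ × ℝ) : ℝ :=
  (2 / (1 - ‖p.1‖ ^ 2)) ^ 2 * inner ℝ a.1 b.1 + a.2 * b.2

/-- The Christoffel symbols `Γ_p(a, b)` of the product metric. For a conformal metric
`e^{2σ} |dz|²` they are `dσ(a) b + dσ(b) a - ⟨a, b⟩ ∇σ` (Euclidean gradient), and here
`∇σ = 2 z / (1 - |z|²)`; the vertical factor is flat. -/
def christoffel (p a b : ℂ × ℝ) : ℂ × ℝ :=
  ((2 / (1 - ‖p.1‖ ^ 2)) •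
    (inner ℝ p.1 a.1 • b.1 + inner ℝ p.1 b.1 • a.1 - inner ℝ a.1 b.1 • p.1), 0)

/-! ### Minimal surfaces -/

/-- The partial derivative of a map of two real variables in the direction `e`. -/
def partialD (X : ℝ × ℝ → ℂ × ℝ) (e v : ℝ × ℝ) : ℂ × ℝ := fderiv ℝ X v e

/-- The covariant derivative, along the map `X`, of `∂X/∂f` in the direction `e`, for the
Levi-Civita connection of `ℍ² × ℝ`. -/
def covD (X : ℝ × ℝ → ℂ × ℝ) (e f v : ℝ × ℝ) : ℂ × ℝ :=
  fderiv ℝ (partialD X f) v e + christoffel (X v) (partialD X e v) (partialD X f v)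

/-- The parametrized surface `X` has zero mean curvature at the parameter `v`: for every normal
vector `N` the second fundamental form `h_{ij} = ⟨∇_i ∂_j X, N⟩` has zero trace with respect to the
first fundamental form `E, F, G`, that is `G h₁₁ - 2 F h₁₂ + E h₂₂ = 0`. -/
def ZeroMeanCurvatureAt (X : ℝ × ℝ → ℂ × ℝ) (v : ℝ × ℝ) : Prop :=
  let e₁ : ℝ × ℝ := (1, 0)
  let e₂ : ℝ × ℝ := (0, 1)
  let g := metric (X v)
  ∀ N : ℂ × ℝ, g N (partialD X e₁ v) = 0 → g N (partialD X e₂ v) = 0 →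
    g (partialD X e₂ v) (partialD X e₂ v) * g (covD X e₁ e₁ v) N
      - 2 * g (partialD X e₁ v) (partialD X e₂ v) * g (covD X e₁ e₂ v) N
      + g (partialD X e₁ v) (partialD X e₁ v) * g (covD X e₂ e₂ v) N = 0

/-- `M` is an embedded minimal surface (smooth, without boundary) in `ℍ² × ℝ`: near each of its
points it is parametrized by a smooth immersion with zero mean curvature which is a homeomorphism
from an open subset of `ℝ²` onto a relatively open subset of `M`. -/
def IsEmbeddedMinimal (M : Set (ℂ × ℝ)) : Prop :=
  M ⊆ space ∧
  ∀ p ∈ M, ∃ (X : ℝ × ℝ → ℂ × ℝ) (U : Set (ℝ × ℝ)) (V : Set (ℂ × ℝ)),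
    IsOpen U ∧ IsOpen V ∧ p ∈ V ∧ X '' U = M ∩ V ∧
    ContDiffOn ℝ ∞ X U ∧ IsEmbedding (U.domRestrict X) ∧
    ∀ v ∈ U, Function.Injective (fderiv ℝ X v) ∧ ZeroMeanCurvatureAt X v

/-- `M` is proper in `ℍ² × ℝ`: it meets the compact subsets of `ℍ² × ℝ` in compact sets. -/
def IsProperIn (M : Set (ℂ × ℝ)) : Prop :=
  ∀ K ⊆ space, IsCompact K → IsCompact (M ∩ K)

/-- The Riemannian length of a path `c : [0, 1] → ℍ² × ℝ`. -/
def pathLength (c : ℝ → ℂ × ℝ) : ℝ≥0∞ :=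
  ∫⁻ s in Icc (0 : ℝ) 1, ENNReal.ofReal
    √(metric (c s) (derivWithin c (Icc 0 1) s) (derivWithin c (Icc 0 1) s))

/-- The intrinsic distance of `M`: the infimum of the lengths of the `C¹` paths in `M`. -/
def intrinsicDist (M : Set (ℂ × ℝ)) (p q : ℂ × ℝ) : ℝ≥0∞ :=
  ⨅ (c : ℝ → ℂ × ℝ) (_ : ContDiffOn ℝ 1 c (Icc 0 1) ∧ MapsTo c (Icc 0 1) M ∧ c 0 = p ∧ c 1 = q),
    pathLength c

/-- `M` is complete for its intrinsic distance. -/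
def IsIntrinsicallyComplete (M : Set (ℂ × ℝ)) : Prop :=
  ∀ x : ℕ → ℂ × ℝ, (∀ n, x n ∈ M) →
    (∀ ε > 0, ∃ N, ∀ m ≥ N, ∀ n ≥ N, intrinsicDist M (x m) (x n) < ε) →
    ∃ p ∈ M, Tendsto (fun n => intrinsicDist M (x n) p) atTop (𝓝 0)

/-- `M` is a (connected) complete properly embedded minimal surface of `ℍ² × ℝ`. -/
structure IsCompleteProperlyEmbeddedMinimal (M : Set (ℂ × ℝ)) : Prop where
  connected : IsConnected M
  embedded_minimal : IsEmbeddedMinimal M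
  proper : IsProperIn M
  complete : IsIntrinsicallyComplete M

/-! ### Jordan curves of the cylinder and homology -/

/-- The singular `n`-chains of `Y` with integer coefficients. -/
abbrev SingularChain (n : ℕ) (Y : Type*) [TopologicalSpace Y] : Type _ :=
  C(stdSimplex ℝ (Fin (n + 1)), Y) →₀ ℤ

/-- The `i`-th face of a singular simplex. -/
def face {n : ℕ} {Y : Type*} [TopologicalSpace Y] (i : Fin (n + 2))
    (σ : C(stdSimplex ℝ (Fin (n + 2)), Y)) : C(stdSimplex ℝ (Fin (n + 1)), Y) :=
  σ.comp ⟨stdSimplex.map i.succAbove, stdSimplex.continuous_map i.succAbove⟩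

/-- The boundary of a singular chain, the alternating sum of the faces. -/
def singularBoundary {n : ℕ} {Y : Type*} [TopologicalSpace Y] (c : SingularChain (n + 1) Y) :
    SingularChain n Y :=
  c.sum fun σ k => ∑ i : Fin (n + 2), Finsupp.single (face i σ) (k * (-1) ^ (i : ℕ))

/-- The singular `1`-simplex given by a path. -/
def pathSimplex {Y : Type*} [TopologicalSpace Y] (γ : C(unitInterval, Y)) :
    C(stdSimplex ℝ (Fin (1 + 1)), Y) :=
  γ.comp ⟨stdSimplexHomeomorphUnitInterval, stdSimplexHomeomorphUnitInterval.continuous⟩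

/-- `γ` is a parametrization of the Jordan curve `Γ` of the cylinder: a closed path, injective
but for its end points, with image `Γ`. -/
def IsJordanParam (γ : C(unitInterval, cylinder)) (Γ : Set (ℂ × ℝ)) : Prop :=
  γ 0 = γ 1 ∧ (∀ s t : unitInterval, γ s = γ t → s = t ∨ (s = 0 ∧ t = 1) ∨ (s = 1 ∧ t = 0)) ∧
    range (fun s => (γ s : ℂ × ℝ)) = Γ

/-- `Γ` is a Jordan curve of the cylinder `∂_∞ ℍ² × ℝ`. -/
def IsJordanCurve (Γ : Set (ℂ × ℝ)) : Prop := ∃ γ, IsJordanParam γ Γ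

/-- The Jordan curve `Γ` is homologous to zero in the cylinder: the singular `1`-cycle of a
parametrization bounds a singular `2`-chain of the cylinder. (All parametrizations of `Γ` define
the same homology class up to sign.) -/
def IsHomologousToZero (Γ : Set (ℂ × ℝ)) : Prop :=
  ∀ γ, IsJordanParam γ Γ →
    ∃ c : SingularChain 2 cylinder, singularBoundary c = Finsupp.single (pathSimplex γ) 1

/-! ### The data of the family -/

/-- The integrand `d / √(cosh² u - d²)`. -/
def heightIntegrand (d u : ℝ) : ℝ := d / √(Real.cosh u ^ 2 - d ^ 2)

/-- The function `H`, for `d > 1`. -/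
def H (d : ℝ) : ℝ := ∫ u in Ioi (Real.arcosh d), heightIntegrand d u

/-- The function `G`, for `0 < d < 1`. -/
def G (d : ℝ) : ℝ := ∫ u in Ioi (0 : ℝ), heightIntegrand d u

/-- The line at distance `arcosh d` from the geodesic with end points `p ≠ q`, on the side of that
geodesic whose asymptotic boundary is the arc from `p` to `q`. -/
def equidistantLine (p q : ℂ) (d : ℝ) : Set ℂ :=
  {z ∈ componentWith (geodesicLine p q) (ccwArc p q) |
    hypDistTo (geodesicLine p q) z = Real.arcosh d}

/-- The graph `t = log ((√(x² + y²) + y) / x)`, `x > 0`, `y > 0`, in the half-plane model. -/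
def halfPlaneGraph : Set (ℂ × ℝ) :=
  {p | 0 < p.1.re ∧ 0 < p.1.im ∧
    p.2 = Real.log ((√(p.1.re ^ 2 + p.1.im ^ 2) + p.1.im) / p.1.re)}

/-- For `|q| = 1` and `Im a > 0`, the orientation preserving isometry `w ↦ q (w - a) / (w - ā)`
from the upper half-plane model to the Poincaré disk that takes the ideal point `∞` to `q` and the
point `a` to the centre. -/
def halfPlaneToDisk (q a w : ℂ) : ℂ := q * (w - a) / (w - (starRingEnd ℂ) a)

end H2R

end

open H2R

/-! Use the upper half-plane, through an isometry taking `0` to `q₁` and `∞` to `q₂`. Translations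
along `γ` become homotheties (`exists_homothety`), so an invariant surface is swept out by a profile
curve `(v, t)` with `v` on the unit half-circle. Write `v = dirOf g`, where `g ∈ (-π/2, π/2)` is the
angle from the imaginary axis; the distance to `γ` is then `arcosh (1 / cos g)`
(`hypDistTo_geodesicLine`). Minimality reduces to the equation `g'' = sin g cos g` in the height
variable (`zeroMeanCurvatureAt`). Its first integral `(g')² + cos² g = 1 / d²` gives the family.

For `d < 1` the derivative `g'` never vanishes and `g` runs over the whole interval: an entire
graph. For `d = 1` one has `g' = sin g`, and the profile leaves the equilibrium `g = 0` at height
`-∞`. For `d > 1` the profile comes from `g = π/2`, turns where `cos g = 1/d`, that is along the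
equidistant line, and returns to `π/2`; the parameter `p` with `cos g = d⁻¹ cos p` is smooth across
the turning point. If `d ≠ 1`, the height is an elliptic integral (`ellipticInt`). The substitution
`cos g = 1 / cosh u` identifies the limiting heights with `H` and `G` (`H_eq`, `G_eq`), and their
monotonicity and limits follow from bounds on the integrand.

Boundary and closedness: the polar coordinate compactified by `closedPolar` is continuous on a
closed rectangle, so the closure of a swept set is the image of that rectangle (`closure_swept`).
Two of its edges collapse to `q₁` and `q₂` and give the vertical pieces; the edges where `v = ±1`
give the ideal arcs. All other points of the rectangle lie on the surface, which is therefore closed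
in `ℍ² × ℝ`. Properness is immediate. Completeness holds because the intrinsic distance dominates
both the coordinate distance and the variation of `log (1 - |z|²)` (`isIntrinsicallyComplete`).

Homology: both boundary curves are images of polygons in the universal cover of the cylinder. For `d
> 1` the curve misses a vertical line, so it lifts to a closed path and bounds a cone. For `d < 1`
its angle grows by `2π`, whereas the winding cochain vanishes on boundaries
(`windingCochain_singularBoundary`). -/

namespace H2R

open ComplexConjugate

section

/-! ### The half-plane model adapted to a pair of ideal points -/

/-- The point `a` of the upper half-plane lies on the unit circle, and the isometry
`halfPlaneToDisk q₂ a` takes `0` to `q₁` and `∞` to `q₂`. -/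
structure IsFrame (q₁ q₂ a : ℂ) : Prop where
  norm_right : ‖q₂‖ = 1
  norm_base : ‖a‖ = 1
  im_pos : 0 < a.im
  left_eq : q₁ = q₂ * a ^ 2

/-- The inverse of `halfPlaneToDisk q₂ a`. -/
noncomputable def diskToHalfPlane (q₁ q₂ a z : ℂ) : ℂ := conj a * (z - q₁) / (z - q₂)

/-- `a` is the square root of `q₁ / q₂` in the upper half-plane. The two roots are opposite, and
neither is real because `q₁ ≠ q₂`. -/
theorem exists_isFrame {q₁ q₂ : ℂ} (h₁ : q₁ ∈ idealBoundary) (h₂ : q₂ ∈ idealBoundary)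
    (hne : q₁ ≠ q₂) : ∃ a, IsFrame q₁ q₂ a := by
  simp only [idealBoundary, mem_sphere_iff_norm, sub_zero] at h₁ h₂
  have h20 : q₂ ≠ 0 := by rintro rfl; simp at h₂
  set u := q₁ / q₂ with hu
  have hun : ‖u‖ = 1 := by simp [hu, h₁, h₂]
  have hexp : Complex.exp (u.arg * Complex.I) = u := by
    have := Complex.norm_mul_exp_arg_mul_I u
    rwa [hun, Complex.ofReal_one, one_mul] at this
  have harg : u.arg ≠ 0 := by
    intro h
    rw [h] at hexp
    simp only [Complex.ofReal_zero, zero_mul, Complex.exp_zero] at hexp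
    rw [hu, eq_comm, div_eq_one_iff_eq h20] at hexp
    exact hne hexp
  have hq : q₁ = q₂ * u := by rw [hu]; field_simp
  set b := Complex.exp ((u.arg / 2 : ℝ) * Complex.I) with hb
  have hb2 : b ^ 2 = u := by
    rw [hb, ← Complex.exp_nat_mul, ← hexp]
    congr 1
    rw [hexp]
    push_cast
    ring
  have hbn : ‖b‖ = 1 := Complex.norm_exp_ofReal_mul_I _
  have hbim : b.im = Real.sin (u.arg / 2) := by rw [hb, Complex.exp_ofReal_mul_I_im]
  have hle := Complex.arg_le_pi u
  have hge := Complex.neg_pi_lt_arg u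
  rcases lt_or_gt_of_ne harg with hlt | hgt
  · refine ⟨-b, h₂, by simpa using hbn, ?_, by rw [hq, neg_sq, hb2]⟩
    have := Real.sin_neg_of_neg_of_neg_pi_lt (x := u.arg / 2) (by linarith) (by linarith)
    simp only [Complex.neg_im]
    linarith
  · refine ⟨b, h₂, hbn, ?_, by rw [hq, hb2]⟩
    rw [hbim]
    exact Real.sin_pos_of_pos_of_lt_pi (by linarith) (by linarith)

namespace IsFrame

variable {q₁ q₂ a : ℂ}

theorem right_ne_zero (h : IsFrame q₁ q₂ a) : q₂ ≠ 0 := by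
  rintro rfl; simpa using h.norm_right

theorem base_mul_conj (h : IsFrame q₁ q₂ a) : a * conj a = 1 := by
  rw [Complex.mul_conj, Complex.normSq_eq_norm_sq, h.norm_base]; simp

theorem right_mul_conj (h : IsFrame q₁ q₂ a) : q₂ * conj q₂ = 1 := by
  rw [Complex.mul_conj, Complex.normSq_eq_norm_sq, h.norm_right]; simp

theorem base_ne_zero (h : IsFrame q₁ q₂ a) : a ≠ 0 := left_ne_zero_of_mul_eq_one h.base_mul_conj

theorem norm_left (h : IsFrame q₁ q₂ a) : ‖q₁‖ = 1 := by
  rw [h.left_eq]; simp [h.norm_right, h.norm_base]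

theorem sub_conj (a : ℂ) : a - conj a = 2 * a.im * Complex.I := by
  apply Complex.ext <;> simp; ring

theorem sub_conj_ne_zero (h : IsFrame q₁ q₂ a) : a - conj a ≠ 0 := by
  rw [sub_conj]
  have := h.im_pos.ne'
  simp [this]

theorem left_ne_right (h : IsFrame q₁ q₂ a) : q₁ ≠ q₂ := by
  intro he
  have h1 := h.left_eq
  rw [he] at h1
  have h2 : a ^ 2 = 1 := mul_left_cancel₀ h.right_ne_zero (by rw [← h1, mul_one])
  have h3 := h.im_pos
  rcases sq_eq_sq_iff_eq_or_eq_neg.mp (h2.trans (one_pow 2).symm) with h4 | h4 <;> simp [h4] at h3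

theorem halfPlaneToDisk_zero (h : IsFrame q₁ q₂ a) : halfPlaneToDisk q₂ a 0 = q₁ := by
  have := h.base_mul_conj
  have h0 : conj a ≠ 0 := right_ne_zero_of_mul_eq_one this
  rw [halfPlaneToDisk, h.left_eq]
  field_simp
  linear_combination (a * q₂) * this

theorem sub_conj_base_ne_zero (h : IsFrame q₁ q₂ a) {w : ℂ} (hw : 0 ≤ w.im) :
    w - conj a ≠ 0 := by
  intro h0
  have := congrArg Complex.im h0
  simp at this
  linarith [h.im_pos]

theorem diskToHalfPlane_halfPlaneToDisk (h : IsFrame q₁ q₂ a) {w : ℂ} (hw : w - conj a ≠ 0) :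
    diskToHalfPlane q₁ q₂ a (halfPlaneToDisk q₂ a w) = w := by
  have hs := h.sub_conj_ne_zero
  have hd : halfPlaneToDisk q₂ a w - q₂ = - q₂ * (a - conj a) / (w - conj a) := by
    rw [halfPlaneToDisk]; field_simp; ring
  have hn : halfPlaneToDisk q₂ a w - q₁ = - q₂ * a ^ 2 * (a - conj a) * w / (a * (w - conj a)) := by
    rw [halfPlaneToDisk, h.left_eq]
    have := h.base_ne_zero
    field_simp
    have := h.base_mul_conj
    linear_combination (q₂ * a - q₂ * w) * this
  rw [diskToHalfPlane, hd, hn]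
  have := h.right_ne_zero
  have := h.base_ne_zero
  field_simp
  linear_combination w * h.base_mul_conj

theorem halfPlaneToDisk_diskToHalfPlane (h : IsFrame q₁ q₂ a) {z : ℂ} (hz : z ≠ q₂) :
    halfPlaneToDisk q₂ a (diskToHalfPlane q₁ q₂ a z) = z := by
  have hz' : z - q₂ ≠ 0 := sub_ne_zero.mpr hz
  have hb := h.base_mul_conj
  have hc : conj a ≠ 0 := right_ne_zero_of_mul_eq_one hb
  have hne : q₂ - q₁ ≠ 0 := sub_ne_zero.mpr h.left_ne_right.symm
  have hd : diskToHalfPlane q₁ q₂ a z - conj a = conj a * (q₂ - q₁) / (z - q₂) := by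
    rw [diskToHalfPlane]; field_simp; ring
  rw [halfPlaneToDisk, hd, diskToHalfPlane]
  field_simp
  rw [h.left_eq]
  linear_combination (a * q₂ * z - a * q₂ ^ 2) * hb

/-- The sign of `w.im` decides whether the image is in the disk or on the circle. The same identity
later yields the conformal factor and the distance formula. -/
theorem normSq_halfPlaneToDisk (h : IsFrame q₁ q₂ a) {w : ℂ} (hw : w - conj a ≠ 0) :
    1 - ‖halfPlaneToDisk q₂ a w‖ ^ 2 = 4 * a.im * w.im / ‖w - conj a‖ ^ 2 := by
  have hn : ‖w - conj a‖ ≠ 0 := norm_ne_zero_iff.mpr hw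
  rw [halfPlaneToDisk, norm_div, norm_mul, h.norm_right]
  field_simp
  rw [← Complex.normSq_eq_norm_sq, ← Complex.normSq_eq_norm_sq, Complex.normSq_apply,
    Complex.normSq_apply]
  simp
  ring

theorem halfPlaneToDisk_mem (h : IsFrame q₁ q₂ a) {w : ℂ} (hw : 0 < w.im) :
    halfPlaneToDisk q₂ a w ∈ hypPlane := by
  have h0 := h.sub_conj_base_ne_zero hw.le
  have h1 := h.normSq_halfPlaneToDisk h0
  have h2 : 0 < 4 * a.im * w.im / ‖w - conj a‖ ^ 2 := by
    have := h.im_pos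
    have := norm_pos_iff.mpr h0
    positivity
  rw [hypPlane, mem_ball_zero_iff]
  nlinarith [norm_nonneg (halfPlaneToDisk q₂ a w)]

theorem norm_halfPlaneToDisk_of_im_eq_zero (h : IsFrame q₁ q₂ a) {w : ℂ} (hw : w.im = 0) :
    ‖halfPlaneToDisk q₂ a w‖ = 1 := by
  have h0 := h.sub_conj_base_ne_zero hw.ge
  have h1 := h.normSq_halfPlaneToDisk h0
  rw [hw] at h1
  simp only [mul_zero, zero_div] at h1
  nlinarith [norm_nonneg (halfPlaneToDisk q₂ a w)]

theorem ne_right_of_mem (h : IsFrame q₁ q₂ a) {z : ℂ} (hz : z ∈ hypPlane) : z ≠ q₂ := by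
  rintro rfl
  rw [hypPlane, mem_ball_zero_iff, h.norm_right] at hz
  exact lt_irrefl _ hz

theorem diskToHalfPlane_im_pos (h : IsFrame q₁ q₂ a) {z : ℂ} (hz : z ∈ hypPlane) :
    0 < (diskToHalfPlane q₁ q₂ a z).im := by
  have h2 := h.ne_right_of_mem hz
  have h2' : z - q₂ ≠ 0 := sub_ne_zero.mpr h2
  have hc : conj a ≠ 0 := right_ne_zero_of_mul_eq_one h.base_mul_conj
  have hw : diskToHalfPlane q₁ q₂ a z - conj a ≠ 0 := by
    have : diskToHalfPlane q₁ q₂ a z - conj a = conj a * (q₂ - q₁) / (z - q₂) := by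
      rw [diskToHalfPlane]; field_simp; ring
    rw [this]
    exact div_ne_zero (mul_ne_zero hc (sub_ne_zero.mpr h.left_ne_right.symm)) h2'
  have h3 := h.normSq_halfPlaneToDisk hw
  rw [h.halfPlaneToDisk_diskToHalfPlane h2] at h3
  rw [hypPlane, mem_ball_zero_iff] at hz
  have h4 : 0 < 1 - ‖z‖ ^ 2 := by nlinarith [norm_nonneg z]
  have h5 : 0 < ‖diskToHalfPlane q₁ q₂ a z - conj a‖ ^ 2 := by
    have := norm_pos_iff.mpr hw
    positivity
  rw [h3] at h4
  have h6 := (div_pos_iff_of_pos_right h5).mp h4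
  have := h.im_pos
  by_contra hcon
  push Not at hcon
  nlinarith

theorem diskToHalfPlane_ne_zero (h : IsFrame q₁ q₂ a) {z : ℂ} (hz : z ∈ hypPlane) :
    diskToHalfPlane q₁ q₂ a z ≠ 0 := by
  intro h0
  have := h.diskToHalfPlane_im_pos hz
  simp [h0] at this

theorem contDiffOn_diskToHalfPlane (h : IsFrame q₁ q₂ a) :
    ContDiffOn ℝ ∞ (diskToHalfPlane q₁ q₂ a) hypPlane := by
  have : ContDiffOn ℂ ∞ (diskToHalfPlane q₁ q₂ a) hypPlane := by
    unfold diskToHalfPlane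
    refine ContDiffOn.div (by fun_prop) (by fun_prop) fun z hz => ?_
    exact sub_ne_zero.mpr (h.ne_right_of_mem hz)
  exact this.restrict_scalars ℝ

theorem continuousOn_diskToHalfPlane (h : IsFrame q₁ q₂ a) :
    ContinuousOn (diskToHalfPlane q₁ q₂ a) hypPlane := h.contDiffOn_diskToHalfPlane.continuousOn

theorem contDiffOn_halfPlaneToDisk (h : IsFrame q₁ q₂ a) :
    ContDiffOn ℝ ∞ (halfPlaneToDisk q₂ a) {w | 0 < w.im} := by
  have : ContDiffOn ℂ ∞ (halfPlaneToDisk q₂ a) {w | 0 < w.im} := by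
    unfold halfPlaneToDisk
    refine ContDiffOn.div (by fun_prop) (by fun_prop) fun z hz => ?_
    exact h.sub_conj_base_ne_zero (le_of_lt hz)
  exact this.restrict_scalars ℝ

/-- Hyperbolic translations along the geodesic from `q₁` to `q₂` are homotheties of the half-plane. -/
theorem exists_homothety (h : IsFrame q₁ q₂ a) {T : ℂ → ℂ} (hT : IsHypTranslation q₁ q₂ T) :
    ∃ c : ℝ, 0 < c ∧ ∀ w : ℂ, 0 < w.im →
      T (halfPlaneToDisk q₂ a w) = halfPlaneToDisk q₂ a (c * w) := by
  obtain ⟨α, β, hαβ, rfl, hf1, hf2⟩ := hT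
  have hden : ∀ z : ℂ, ‖z‖ ≤ 1 → conj β * z + conj α ≠ 0 := by
    intro z hz h0
    have h1 : ‖conj α‖ = ‖conj β * z‖ := by
      rw [eq_neg_of_add_eq_zero_right h0, norm_neg]
    rw [norm_mul, Complex.norm_conj, Complex.norm_conj] at h1
    nlinarith [norm_nonneg β]
  -- At a fixed point on the circle the denominator equals its own conjugate, so it is a real number
  -- `r`. Then `|r - conj α| = |β| < |α|` gives `r² < 2 * r * α.re`, so `r` has the sign of `α.re`,
  -- the same at both fixed points.
  have key : ∀ q : ℂ, ‖q‖ = 1 → moebius α β q = q →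
      ∃ r : ℝ, conj β * q + conj α = r ∧ 0 < r * α.re := by
    intro q hq hf
    have h0 := hden q hq.le
    have hqq : q * conj q = 1 := by
      rw [Complex.mul_conj, Complex.normSq_eq_norm_sq, hq]; simp
    rw [moebius, div_eq_iff h0] at hf
    have hconj : conj (conj β * q + conj α) = conj β * q + conj α := by
      have hq0 : q ≠ 0 := by rintro rfl; simp at hq
      apply mul_left_cancel₀ hq0
      rw [← hf]
      simp only [map_add, map_mul, Complex.conj_conj]
      linear_combination β * hqq
    obtain ⟨r, hr⟩ := Complex.conj_eq_iff_real.mp hconj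
    refine ⟨r, hr, ?_⟩
    have hr0 : r ≠ 0 := by rintro rfl; simp [hr] at h0
    have hn : ‖(r : ℂ) - conj α‖ = ‖β‖ := by
      rw [← hr]
      simp [hq]
    have hn2 : (r - α.re) ^ 2 + α.im ^ 2 = ‖β‖ ^ 2 := by
      rw [← hn, ← Complex.normSq_eq_norm_sq, Complex.normSq_apply]
      simp
      ring
    have hα : α.re ^ 2 + α.im ^ 2 = ‖α‖ ^ 2 := by
      rw [← Complex.normSq_eq_norm_sq, Complex.normSq_apply]
      ring
    nlinarith [norm_nonneg β, sq_nonneg r]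
  obtain ⟨r₁, hr₁, hp₁⟩ := key q₁ h.norm_left hf1
  obtain ⟨r₂, hr₂, hp₂⟩ := key q₂ h.norm_right hf2
  have hpos : 0 < r₂ / r₁ := by
    rcases lt_trichotomy α.re 0 with hα | hα | hα
    · exact div_pos_of_neg_of_neg (by nlinarith) (by nlinarith)
    · simp [hα] at hp₁
    · exact div_pos (by nlinarith) (by nlinarith)
  refine ⟨r₂ / r₁, hpos, fun w hw => ?_⟩
  set z := halfPlaneToDisk q₂ a w with hz
  have hzm := h.halfPlaneToDisk_mem hw
  rw [← hz] at hzm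
  have hzw : diskToHalfPlane q₁ q₂ a z = w :=
    h.diskToHalfPlane_halfPlaneToDisk (h.sub_conj_base_ne_zero hw.le)
  have hzn : ‖z‖ < 1 := by rwa [hypPlane, mem_ball_zero_iff] at hzm
  have hdz := hden z hzn.le
  have hd1 := hden q₁ h.norm_left.le
  have hd2 := hden q₂ h.norm_right.le
  have hdet : α * conj α - β * conj β ≠ 0 := by
    rw [Complex.mul_conj, Complex.mul_conj, Complex.normSq_eq_norm_sq, Complex.normSq_eq_norm_sq]
    have : ‖β‖ ^ 2 < ‖α‖ ^ 2 := by nlinarith [norm_nonneg β]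
    norm_cast
    linarith
  -- In the quotient of these differences for `q₁` and `q₂` everything cancels except `r₂ / r₁`,
  -- which is the homothety ratio.
  have hsub : ∀ q, moebius α β q = q → conj β * q + conj α ≠ 0 → moebius α β z - q =
      (α * conj α - β * conj β) * (z - q) / ((conj β * z + conj α) * (conj β * q + conj α)) := by
    intro q hq hq0
    nth_rewrite 1 [← hq]
    rw [moebius, moebius, div_sub_div _ _ hdz hq0]
    ring
  have hz2 : z - q₂ ≠ 0 := sub_ne_zero.mpr (h.ne_right_of_mem hzm)
  have hTz : moebius α β z ≠ q₂ := by
    rw [← sub_ne_zero, hsub q₂ hf2 hd2]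
    exact div_ne_zero (mul_ne_zero hdet hz2) (mul_ne_zero hdz hd2)
  rw [← h.halfPlaneToDisk_diskToHalfPlane hTz]
  congr 1
  rw [← hzw, diskToHalfPlane, diskToHalfPlane, hsub q₁ hf1 hd1, hsub q₂ hf2 hd2, hr₁, hr₂]
  rw [hr₁] at hd1
  rw [hr₂] at hd2
  push_cast
  field_simp

end IsFrame

/-! ### The compactified polar coordinates -/

/-- The point of the closed disk with polar coordinates `((1 + x) / (1 - x), v)` in the half-plane;
this makes sense for `x = ± 1` as well. -/
noncomputable def closedPolar (q₂ a : ℂ) (x : ℝ) (v : ℂ) : ℂ :=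
  q₂ * ((1 + x) * v - (1 - x) * a) / ((1 + x) * v - (1 - x) * conj a)

namespace IsFrame

variable {q₁ q₂ a : ℂ}

/-- The imaginary part `(1 + x) * v.im + (1 - x) * a.im` is a sum of nonnegative terms. It can
vanish only at `x = 1`, where the denominator is `2 * v`. -/
theorem closedPolar_den_ne_zero (h : IsFrame q₁ q₂ a) {x : ℝ} (hx : x ∈ Icc (-1 : ℝ) 1) {v : ℂ}
    (hv : ‖v‖ = 1) (hi : 0 ≤ v.im) : (1 + x : ℂ) * v - (1 - x) * conj a ≠ 0 := by
  intro h0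
  have him := congrArg Complex.im h0
  have ha := h.im_pos
  obtain ⟨hx1, hx2⟩ := hx
  simp at him
  have h1 : (1 - x) * a.im = 0 := by nlinarith [mul_nonneg (by linarith : 0 ≤ 1 + x) hi, mul_nonneg (by linarith : 0 ≤ 1 - x) ha.le]
  have h2 : x = 1 := by
    rcases mul_eq_zero.mp h1 with h3 | h3 <;> linarith
  subst h2
  have : v ≠ 0 := by rintro rfl; simp at hv
  norm_num [this] at h0

theorem closedPolar_one {v : ℂ} (hv : ‖v‖ = 1) :
    closedPolar q₂ a 1 v = q₂ := by
  have : v ≠ 0 := by rintro rfl; simp at hv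
  simp [closedPolar]
  field_simp

theorem closedPolar_neg_one (h : IsFrame q₁ q₂ a) (v : ℂ) : closedPolar q₂ a (-1) v = q₁ := by
  have := h.base_mul_conj
  have h0 : conj a ≠ 0 := right_ne_zero_of_mul_eq_one this
  rw [closedPolar, h.left_eq]
  norm_num
  field_simp
  linear_combination (-(a * q₂)) * this

theorem closedPolar_eq {x : ℝ} (hx : x < 1) (v : ℂ) :
    closedPolar q₂ a x v = halfPlaneToDisk q₂ a (((1 + x) / (1 - x) : ℝ) * v) := by
  have h1 : (1 - x : ℂ) ≠ 0 := by norm_cast; linarith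
  rw [closedPolar, halfPlaneToDisk]
  push_cast
  rw [show (1 + x : ℂ) * v - (1 - x) * a = (1 - x) * ((1 + x) / (1 - x) * v - a) by field_simp,
    show (1 + x : ℂ) * v - (1 - x) * conj a = (1 - x) * ((1 + x) / (1 - x) * v - conj a) by
      field_simp, mul_left_comm, mul_div_mul_left _ _ h1]

theorem exists_closedPolar {r : ℝ} (hr : 0 < r) (v : ℂ) :
    ∃ x ∈ Ioo (-1 : ℝ) 1, halfPlaneToDisk q₂ a (r * v) = closedPolar q₂ a x v := by
  refine ⟨(r - 1) / (r + 1), ⟨?_, ?_⟩, ?_⟩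
  · rw [lt_div_iff₀ (by linarith)]; linarith
  · rw [div_lt_iff₀ (by linarith)]; linarith
  · rw [closedPolar_eq (by rw [div_lt_iff₀ (by linarith)]; linarith)]
    congr 3
    field_simp
    ring

theorem continuousOn_closedPolar (h : IsFrame q₁ q₂ a) :
    ContinuousOn (fun p : ℝ × ℂ => closedPolar q₂ a p.1 p.2)
      (Icc (-1) 1 ×ˢ {v | ‖v‖ = 1 ∧ 0 ≤ v.im}) := by
  unfold closedPolar
  refine ContinuousOn.div (by fun_prop) (by fun_prop) ?_
  rintro ⟨x, v⟩ ⟨hx, hv, hi⟩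
  exact h.closedPolar_den_ne_zero hx hv hi

theorem closedPolar_mem_hypPlane (h : IsFrame q₁ q₂ a) {x : ℝ} (hx : x ∈ Ioo (-1 : ℝ) 1) {v : ℂ}
    (hi : 0 < v.im) : closedPolar q₂ a x v ∈ hypPlane := by
  rw [closedPolar_eq hx.2]
  apply h.halfPlaneToDisk_mem
  rw [Complex.im_ofReal_mul]
  exact mul_pos (div_pos (by linarith [hx.1]) (by linarith [hx.2])) hi

theorem closedPolar_mem_idealBoundary (h : IsFrame q₁ q₂ a) {x : ℝ} (hx : x < 1)
    {v : ℂ} (hi : v.im = 0) : closedPolar q₂ a x v ∈ idealBoundary := by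
  rw [closedPolar_eq hx, idealBoundary, mem_sphere_zero_iff_norm]
  apply h.norm_halfPlaneToDisk_of_im_eq_zero
  rw [Complex.im_ofReal_mul, hi, mul_zero]

theorem left_mem (h : IsFrame q₁ q₂ a) : q₁ ∈ idealBoundary := by
  rw [idealBoundary, mem_sphere_zero_iff_norm, h.norm_left]

theorem right_mem (h : IsFrame q₁ q₂ a) : q₂ ∈ idealBoundary := by
  rw [idealBoundary, mem_sphere_zero_iff_norm, h.norm_right]

end IsFrame

theorem not_mem_hypPlane_of_mem_idealBoundary {z : ℂ} (hz : z ∈ idealBoundary) : z ∉ hypPlane := by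
  rw [idealBoundary, mem_sphere_zero_iff_norm] at hz
  rw [hypPlane, mem_ball_zero_iff, hz]
  exact lt_irrefl _

end

section

/-! ### The ideal arcs -/

theorem exp_mul_I_injOn {s t : ℝ} (hs : s ∈ Ico 0 (2 * Real.pi)) (ht : t ∈ Ico 0 (2 * Real.pi))
    (h : Complex.exp (s * Complex.I) = Complex.exp (t * Complex.I)) : s = t := by
  rw [Complex.exp_eq_exp_iff_exists_int] at h
  obtain ⟨n, hn⟩ := h
  have h1 : s = t + n * (2 * Real.pi) := by
    have : (s : ℂ) = t + n * (2 * Real.pi) := by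
      apply mul_right_cancel₀ Complex.I_ne_zero
      rw [hn]; ring
    exact_mod_cast this
  have hpi := Real.pi_pos
  obtain ⟨hs0, hs1⟩ := hs
  obtain ⟨ht0, ht1⟩ := ht
  have h2 : (n : ℝ) < 1 := by nlinarith
  have h3 : (-1 : ℝ) < n := by nlinarith
  have h4 : n < 1 := by exact_mod_cast h2
  have h5 : -1 < n := by exact_mod_cast h3
  have h6 : n = 0 := by omega
  simpa [h6] using h1

theorem conj_exp_mul_I (t : ℝ) :
    conj (Complex.exp (t * Complex.I)) = Complex.exp (-(t * Complex.I)) := by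
  rw [← Complex.exp_conj]; simp

/-- Put `m = B + A * exp (β * I)`, twice a point of the chord from `1` to `exp (β * I)`. The
fraction is `p * m / conj m = p * exp (2 * arg m * I)`, and `arg m` sweeps `[0, β]` along the chord.
The normalization `A + B = 2` matches the weights `1 + x` and `1 - x` of `closedPolar`. -/
theorem mem_ccwArc_iff {p : ℂ} (hp : p ≠ 0) {β : ℝ} (hβ : β ∈ Ioo 0 Real.pi) (z : ℂ) :
    z ∈ ccwArc p (p * Complex.exp (β * Complex.I) ^ 2) ↔
      ∃ A B : ℝ, 0 ≤ A ∧ 0 ≤ B ∧ A + B = 2 ∧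
        z = p * (B + A * Complex.exp (β * Complex.I)) /
          (B + A * conj (Complex.exp (β * Complex.I))) := by
  obtain ⟨hβ0, hβ1⟩ := hβ
  have hsin := Real.sin_pos_of_pos_of_lt_pi hβ0 hβ1
  have hsq : ∀ t : ℝ, Complex.exp (t * Complex.I) ^ 2 =
      Complex.exp (t * Complex.I) / conj (Complex.exp (t * Complex.I)) := by
    intro t
    rw [conj_exp_mul_I, Complex.exp_neg, div_inv_eq_mul, sq]
  constructor
  · rintro ⟨θ, φ, hθ, hθφ, hφ, hq, rfl⟩
    have h1 : φ = 2 * β := by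
      apply exp_mul_I_injOn ⟨by linarith, hφ⟩ ⟨by linarith, by linarith⟩
      have : p * Complex.exp (φ * Complex.I) = p * Complex.exp (β * Complex.I) ^ 2 := by
        rw [hq]; ring
      rw [mul_left_cancel₀ hp this, ← Complex.exp_nat_mul]
      congr 1
      push_cast
      ring
    set ψ := θ / 2 with hψ
    have hs1 : 0 ≤ Real.sin ψ :=
      Real.sin_nonneg_of_nonneg_of_le_pi (by linarith) (by linarith)
    have hs2 : 0 ≤ Real.sin (β - ψ) :=
      Real.sin_nonneg_of_nonneg_of_le_pi (by linarith) (by linarith)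
    have hsum : 0 < Real.sin ψ + Real.sin (β - ψ) := by
      rcases hs1.eq_or_lt with h0 | h0
      · have : ψ = 0 := by
          by_contra hne
          have : 0 < ψ := lt_of_le_of_ne (by linarith) (Ne.symm hne)
          linarith [Real.sin_pos_of_pos_of_lt_pi this (by linarith)]
        rw [this]
        simpa using hsin
      · linarith
    set S := Real.sin ψ + Real.sin (β - ψ) with hS
    -- The weights come from `sin (β - ψ) + sin ψ * exp (β * I) = sin β * exp (ψ * I)`, rescaled to
    -- have sum `2`.
    refine ⟨2 * Real.sin ψ / S, 2 * Real.sin (β - ψ) / S, by positivity, by positivity, ?_, ?_⟩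
    · rw [← add_div, div_eq_iff hsum.ne', hS]; ring
    · have hm : ((2 * Real.sin (β - ψ) / S : ℝ) : ℂ) +
          (2 * Real.sin ψ / S : ℝ) * Complex.exp (β * Complex.I) =
          (2 * Real.sin β / S : ℝ) * Complex.exp (ψ * Complex.I) := by
        have h2 := Real.sin_sub β ψ
        apply Complex.ext
        · simp only [Complex.add_re, Complex.re_ofReal_mul, Complex.ofReal_re,
            Complex.exp_ofReal_mul_I_re]
          rw [h2]; ring
        · simp only [Complex.add_im, Complex.im_ofReal_mul, Complex.ofReal_im,
            Complex.exp_ofReal_mul_I_im]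
          ring
      have hm' := congrArg conj hm
      simp only [map_add, map_mul, Complex.conj_ofReal] at hm'
      rw [hm, hm']
      have hc : ((2 * Real.sin β / S : ℝ) : ℂ) ≠ 0 := by
        norm_cast; positivity
      rw [mul_left_comm, mul_div_mul_left _ _ hc, mul_div_assoc, ← hsq, ← Complex.exp_nat_mul,
        mul_comm]
      congr 2
      rw [hψ]
      push_cast
      ring
  · rintro ⟨A, B, hA, hB, hAB, rfl⟩
    set m : ℂ := B + A * Complex.exp (β * Complex.I) with hm
    have hmre : m.re = B + A * Real.cos β := by
      simp [hm, Complex.exp_ofReal_mul_I_re]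
    have hmim : m.im = A * Real.sin β := by
      simp [hm, Complex.exp_ofReal_mul_I_im]
    have hm0 : m ≠ 0 := by
      intro h0
      rw [h0] at hmre hmim
      have : A = 0 := by
        rcases mul_eq_zero.mp hmim.symm with h | h
        · exact h
        · exact absurd h hsin.ne'
      rw [this] at hmre hAB
      simp at hmre
      linarith
    have harg0 : 0 ≤ m.arg := Complex.arg_nonneg_iff.mpr (by rw [hmim]; positivity)
    have hpolar := Complex.norm_mul_exp_arg_mul_I m
    have hnpos := norm_pos_iff.mpr hm0
    have hre : m.re = ‖m‖ * Real.cos m.arg := by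
      rw [Complex.norm_mul_cos_arg]
    have him : m.im = ‖m‖ * Real.sin m.arg := by
      rw [Complex.norm_mul_sin_arg]
    -- The identity `‖m‖ * sin (arg m - β) = -(B * sin β)` has a nonpositive right side, which
    -- excludes angles beyond `β`.
    have hle : m.arg ≤ β := by
      by_contra hcon
      push Not at hcon
      have h3 := Real.sin_pos_of_pos_of_lt_pi (x := m.arg - β) (by linarith)
        (by linarith [Complex.arg_le_pi m])
      have h4 : ‖m‖ * Real.sin (m.arg - β) = - (B * Real.sin β) := by
        rw [Real.sin_sub]
        linear_combination (-Real.cos β) * him + Real.sin β * hre + Real.cos β * hmim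
          - Real.sin β * hmre
      nlinarith [mul_pos hnpos h3, mul_nonneg hB hsin.le]
    refine ⟨2 * m.arg, 2 * β, by linarith, by linarith, by linarith, ?_, ?_⟩
    · rw [← Complex.exp_nat_mul, mul_comm]
      congr 2
      push_cast
      ring
    · have hmc : (B : ℂ) + A * conj (Complex.exp (β * Complex.I)) = conj m := by
        simp [hm]
      have h5 : Complex.exp ((2 * m.arg : ℝ) * Complex.I) =
          Complex.exp (m.arg * Complex.I) ^ 2 := by
        rw [← Complex.exp_nat_mul]
        congr 1
        push_cast
        ring
      have hmc2 : conj m = ‖m‖ * conj (Complex.exp (m.arg * Complex.I)) := by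
        have := congrArg conj hpolar
        rw [map_mul, Complex.conj_ofReal] at this
        exact this.symm
      rw [hmc, h5, hsq, hmc2]
      nth_rewrite 1 [← hpolar]
      have : (‖m‖ : ℂ) ≠ 0 := by exact_mod_cast hnpos.ne'
      rw [mul_left_comm, mul_div_mul_left _ _ this]
      ring

namespace IsFrame

variable {q₁ q₂ a : ℂ}

theorem exists_arg (h : IsFrame q₁ q₂ a) :
    ∃ α ∈ Ioo 0 Real.pi, a = Complex.exp (α * Complex.I) := by
  refine ⟨a.arg, ⟨?_, ?_⟩, ?_⟩
  · refine lt_of_le_of_ne (Complex.arg_nonneg_iff.mpr h.im_pos.le) fun h0 => ?_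
    have := Complex.arg_eq_zero_iff.mp h0.symm
    exact h.im_pos.ne' this.2
  · exact Complex.arg_lt_pi_iff.mpr (Or.inr h.im_pos.ne')
  · have := Complex.norm_mul_exp_arg_mul_I a
    rw [h.norm_base] at this
    simpa using this.symm

/-- With `a = exp (α * I)` this arc has angle `2 * (π - α)`, so `mem_ccwArc_iff` applies with `β = π
- α` and `exp (β * I) = -conj a`. Cancelling the common factor `-a` turns its fraction into
`closedPolar` at `v = 1`. -/
theorem ccwArc_left_right (h : IsFrame q₁ q₂ a) :
    ccwArc q₁ q₂ = (fun x : ℝ => closedPolar q₂ a x 1) '' Icc (-1) 1 := by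
  obtain ⟨α, ⟨hα0, hα1⟩, ha⟩ := h.exists_arg
  have hb := h.base_mul_conj
  have hbeta : Complex.exp ((Real.pi - α : ℝ) * Complex.I) = - conj a := by
    rw [ha, conj_exp_mul_I]
    push_cast
    rw [sub_mul, Complex.exp_sub, Complex.exp_pi_mul_I, Complex.exp_neg]
    ring
  have hq1 : q₁ ≠ 0 := by intro h0; simpa [h0] using h.norm_left
  have hq2 : q₂ = q₁ * Complex.exp ((Real.pi - α : ℝ) * Complex.I) ^ 2 := by
    rw [hbeta, h.left_eq]
    linear_combination (-q₂ * (1 + a * conj a)) * hb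
  have key : ∀ A B : ℝ, q₁ * (B + A * (- conj a)) / (B + A * conj (- conj a)) =
      q₂ * (A * 1 - B * a) / (A * 1 - B * conj a) := by
    intro A B
    rw [h.left_eq, map_neg, Complex.conj_conj]
    have h1 : q₂ * a ^ 2 * (B + A * (- conj a)) = (-a) * (q₂ * (A * 1 - B * a)) := by
      linear_combination (- q₂ * a * A) * hb
    have h2 : (B + A * (- a) : ℂ) = (-a) * (A * 1 - B * conj a) := by
      linear_combination (- (B : ℂ)) * hb
    rw [h1, h2, mul_div_mul_left _ _ (neg_ne_zero.mpr h.base_ne_zero)]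
  ext z
  have := mem_ccwArc_iff hq1 (β := Real.pi - α) ⟨by linarith, by linarith⟩ z
  rw [← hq2, hbeta] at this
  rw [this]
  constructor
  · rintro ⟨A, B, hA, hB, hAB, rfl⟩
    refine ⟨A - 1, ⟨by linarith, by linarith⟩, ?_⟩
    have hB' : B = 2 - A := by linarith
    rw [key]
    simp only [closedPolar, hB']
    push_cast
    congr 1 <;> ring
  · rintro ⟨x, ⟨hx1, hx2⟩, rfl⟩
    refine ⟨1 + x, 1 - x, by linarith, by linarith, by ring, ?_⟩
    rw [key]
    simp [closedPolar]

theorem ccwArc_right_left (h : IsFrame q₁ q₂ a) :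
    ccwArc q₂ q₁ = (fun x : ℝ => closedPolar q₂ a x (-1)) '' Icc (-1) 1 := by
  obtain ⟨α, hα, ha⟩ := h.exists_arg
  ext z
  have := mem_ccwArc_iff h.right_ne_zero hα z
  rw [← ha, ← h.left_eq] at this
  rw [this]
  constructor
  · rintro ⟨A, B, hA, hB, hAB, rfl⟩
    refine ⟨B - 1, ⟨by linarith, by linarith⟩, ?_⟩
    have hB' : B = 2 - A := by linarith
    simp only [closedPolar, hB']
    push_cast
    rw [← neg_div_neg_eq]
    congr 1 <;> ring
  · rintro ⟨x, ⟨hx1, hx2⟩, rfl⟩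
    refine ⟨1 - x, 1 + x, by linarith, by linarith, by ring, ?_⟩
    simp only [closedPolar]
    push_cast
    rw [← neg_div_neg_eq]
    congr 1 <;> ring

/-- In the half-plane this is the point `-1`, while the arc is `[0, ∞]`. It serves twice: to tell
the two sides of an equidistant line apart, and to find a vertical line that the contractible
boundary curve misses. -/
theorem closedPolar_zero_neg_one_notMem (h : IsFrame q₁ q₂ a) :
    closedPolar q₂ a 0 (-1) ∉ ccwArc q₁ q₂ := by
  rw [h.ccwArc_left_right]
  rintro ⟨x, ⟨hx1, hx2⟩, he⟩
  have hz : diskToHalfPlane q₁ q₂ a (closedPolar q₂ a 0 (-1)) = -1 := by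
    rw [closedPolar_eq zero_lt_one]
    have : ((1 + 0 : ℝ) / (1 - 0) : ℝ) * (-1 : ℂ) = -1 := by norm_num
    rw [this]
    exact h.diskToHalfPlane_halfPlaneToDisk (h.sub_conj_base_ne_zero (by simp))
  simp only at he
  rw [← he] at hz
  rcases hx2.eq_or_lt with rfl | hx
  · rw [closedPolar_one (by simp)] at hz
    simp [diskToHalfPlane] at hz
  · rw [closedPolar_eq hx, h.diskToHalfPlane_halfPlaneToDisk
      (h.sub_conj_base_ne_zero (by rw [Complex.im_ofReal_mul]; simp))] at hz
    have h1 := congrArg Complex.re hz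
    have h2 : 0 ≤ (1 + x) / (1 - x) := div_nonneg (by linarith) (by linarith)
    rw [Complex.re_ofReal_mul] at h1
    simp at h1
    linarith

end IsFrame

/-! ### Sets invariant under the homotheties -/

/-- The subset of `ℍ² × ℝ` swept out by the profile curve `s ↦ (v s, t s)`, `s ∈ I`, under the
homotheties of the half-plane, where `v` is a curve in the upper unit half-circle. -/
def swept (q₂ a : ℂ) (v : ℝ → ℂ) (t : ℝ → ℝ) (I : Set ℝ) : Set (ℂ × ℝ) :=
  {p | ∃ r : ℝ, 0 < r ∧ ∃ s ∈ I, p = (halfPlaneToDisk q₂ a (r * v s), t s)}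

/-- The closure of a swept set, in compactified coordinates. -/
def sweptClosed (q₂ a : ℂ) (v : ℝ → ℂ) (t : ℝ → ℝ) (I : Set ℝ) : Set (ℂ × ℝ) :=
  {p | ∃ x ∈ Icc (-1 : ℝ) 1, ∃ s ∈ I, p = (closedPolar q₂ a x (v s), t s)}

theorem swept_eq_image (q₂ a : ℂ) (v : ℝ → ℂ) (t : ℝ → ℝ) (I : Set ℝ) :
    swept q₂ a v t I =
      (fun p : ℝ × ℝ => (closedPolar q₂ a p.1 (v p.2), t p.2)) '' (Ioo (-1) 1 ×ˢ I) := by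
  ext p
  constructor
  · rintro ⟨r, hr, s, hs, rfl⟩
    obtain ⟨x, hx, he⟩ := IsFrame.exists_closedPolar (q₂ := q₂) (a := a) hr (v s)
    exact ⟨(x, s), ⟨hx, hs⟩, by simp [he]⟩
  · rintro ⟨⟨x, s⟩, ⟨hx, hs⟩, rfl⟩
    refine ⟨(1 + x) / (1 - x), div_pos (by linarith [hx.1]) (by linarith [hx.2]), s, hs, ?_⟩
    simp only
    rw [IsFrame.closedPolar_eq hx.2]

theorem swept_mono {q₂ a : ℂ} {v : ℝ → ℂ} {t : ℝ → ℝ} {I J : Set ℝ} (hIJ : I ⊆ J) :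
    swept q₂ a v t I ⊆ swept q₂ a v t J := by
  rintro p ⟨r, hr, s, hs, rfl⟩
  exact ⟨r, hr, s, hIJ hs, rfl⟩

namespace IsFrame

variable {q₁ q₂ a : ℂ} {v : ℝ → ℂ} {t : ℝ → ℝ} {I : Set ℝ}

/-- An open rectangle is dense in the closed one, and a continuous map on the compact closed
rectangle commutes with closure. -/
theorem closure_swept (h : IsFrame q₁ q₂ a) {α β : ℝ} (hαβ : α < β)
    (hv : ContinuousOn v (Icc α β)) (ht : ContinuousOn t (Icc α β))
    (hn : ∀ s ∈ Icc α β, ‖v s‖ = 1) (hi : ∀ s ∈ Icc α β, 0 ≤ (v s).im) :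
    closure (swept q₂ a v t (Ioo α β)) = sweptClosed q₂ a v t (Icc α β) := by
  have hcl : closure (Ioo (-1 : ℝ) 1 ×ˢ Ioo α β) = Icc (-1) 1 ×ˢ Icc α β := by
    rw [closure_prod_eq, closure_Ioo (by norm_num), closure_Ioo hαβ.ne]
  rw [swept_eq_image, ← image_closure_of_isCompact, hcl]
  · ext p
    constructor
    · rintro ⟨⟨x, s⟩, ⟨hx, hs⟩, rfl⟩
      exact ⟨x, hx, s, hs, rfl⟩
    · rintro ⟨x, hx, s, hs, rfl⟩
      exact ⟨(x, s), ⟨hx, hs⟩, rfl⟩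
  · rw [hcl]
    exact isCompact_Icc.prod isCompact_Icc
  · rw [hcl]
    have h2 : ContinuousOn (fun p : ℝ × ℝ => p.2) (Icc (-1 : ℝ) 1 ×ˢ Icc α β) :=
      continuous_snd.continuousOn
    have h2m : MapsTo (fun p : ℝ × ℝ => p.2) (Icc (-1 : ℝ) 1 ×ˢ Icc α β) (Icc α β) :=
      fun p hp => hp.2
    refine ContinuousOn.prodMk ?_ (ht.comp h2 h2m)
    refine h.continuousOn_closedPolar.comp
      (f := fun p : ℝ × ℝ => (p.1, v p.2)) (continuous_fst.continuousOn.prodMk (hv.comp h2 h2m)) ?_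
    exact fun p hp => ⟨hp.1, hn _ hp.2, hi _ hp.2⟩

theorem swept_subset_space (h : IsFrame q₁ q₂ a) (hi : ∀ s ∈ I, 0 < (v s).im) :
    swept q₂ a v t I ⊆ space := by
  rintro p ⟨r, hr, s, hs, rfl⟩
  refine ⟨h.halfPlaneToDisk_mem ?_, mem_univ _⟩
  rw [Complex.im_ofReal_mul]
  exact mul_pos hr (hi s hs)

theorem image_swept (h : IsFrame q₁ q₂ a) (hi : ∀ s ∈ I, 0 < (v s).im) {T : ℂ → ℂ}
    (hT : IsHypTranslation q₁ q₂ T) :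
    (fun p : ℂ × ℝ => (T p.1, p.2)) '' swept q₂ a v t I = swept q₂ a v t I := by
  obtain ⟨c, hc, hTc⟩ := h.exists_homothety hT
  have him : ∀ r : ℝ, 0 < r → ∀ s ∈ I, 0 < ((r : ℂ) * v s).im := by
    intro r hr s hs
    rw [Complex.im_ofReal_mul]
    exact mul_pos hr (hi s hs)
  ext p
  constructor
  · rintro ⟨_, ⟨r, hr, s, hs, rfl⟩, rfl⟩
    refine ⟨c * r, mul_pos hc hr, s, hs, ?_⟩
    simp only
    rw [hTc _ (him r hr s hs)]
    push_cast
    rw [mul_assoc]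
  · rintro ⟨r, hr, s, hs, rfl⟩
    refine ⟨_, ⟨r / c, div_pos hr hc, s, hs, rfl⟩, ?_⟩
    simp only
    rw [hTc _ (him _ (div_pos hr hc) s hs)]
    have : (c : ℂ) ≠ 0 := by exact_mod_cast hc.ne'
    push_cast
    congr 2
    field_simp

theorem isConnected_swept (h : IsFrame q₁ q₂ a) (hI : IsConnected I)
    (hv : ContinuousOn v I) (ht : ContinuousOn t I) (hn : ∀ s ∈ I, ‖v s‖ = 1)
    (hi : ∀ s ∈ I, 0 ≤ (v s).im) :
    IsConnected (swept q₂ a v t I) := by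
  rw [swept_eq_image]
  refine ((isConnected_Ioo (by norm_num)).prod hI).image _ ?_
  have h2 : ContinuousOn (fun p : ℝ × ℝ => p.2) (Ioo (-1 : ℝ) 1 ×ˢ I) :=
    continuous_snd.continuousOn
  have h2m : MapsTo (fun p : ℝ × ℝ => p.2) (Ioo (-1 : ℝ) 1 ×ˢ I) I := fun p hp => hp.2
  refine ContinuousOn.prodMk ?_ (ht.comp h2 h2m)
  refine h.continuousOn_closedPolar.comp
    (f := fun p : ℝ × ℝ => (p.1, v p.2)) (continuous_fst.continuousOn.prodMk (hv.comp h2 h2m)) ?_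
  exact fun p hp => ⟨Ioo_subset_Icc_self hp.1, hn _ hp.2, hi _ hp.2⟩

end IsFrame

end

section

/-! ### Completeness of closed embedded surfaces -/

theorem norm_sq_lt_one {p : ℂ × ℝ} (hp : p ∈ space) : ‖p.1‖ ^ 2 < 1 := by
  have h : ‖p.1‖ < 1 := by simpa [hypPlane] using hp.1
  nlinarith [norm_nonneg p.1]

theorem metric_self (p b : ℂ × ℝ) :
    metric p b b = (2 / (1 - ‖p.1‖ ^ 2)) ^ 2 * ‖b.1‖ ^ 2 + b.2 ^ 2 := by
  rw [metric, real_inner_self_eq_norm_sq, sq b.2]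

theorem mul_norm_fst_le_sqrt_metric {p : ℂ × ℝ} (hp : p ∈ space) (b : ℂ × ℝ) :
    2 / (1 - ‖p.1‖ ^ 2) * ‖b.1‖ ≤ √(metric p b b) := by
  have := norm_sq_lt_one hp
  apply Real.le_sqrt_of_sq_le
  rw [metric_self, mul_pow]
  nlinarith [sq_nonneg b.2]

theorem norm_le_sqrt_metric {p : ℂ × ℝ} (hp : p ∈ space) (b : ℂ × ℝ) :
    ‖b‖ ≤ √(metric p b b) := by
  have h1 := norm_sq_lt_one hp
  rw [Prod.norm_def]
  apply max_le
  · refine le_trans ?_ (mul_norm_fst_le_sqrt_metric hp b)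
    have : 1 ≤ 2 / (1 - ‖p.1‖ ^ 2) := by
      rw [le_div_iff₀ (by linarith)]
      nlinarith [sq_nonneg ‖p.1‖]
    nlinarith [norm_nonneg b.1]
  · apply Real.le_sqrt_of_sq_le
    rw [metric_self, Real.norm_eq_abs, sq_abs]
    nlinarith [mul_nonneg (sq_nonneg (2 / (1 - ‖p.1‖ ^ 2))) (sq_nonneg ‖b.1‖)]

theorem sqrt_metric_le {p : ℂ × ℝ} (hp : p ∈ space) (b : ℂ × ℝ) :
    √(metric p b b) ≤ (2 / (1 - ‖p.1‖ ^ 2) + 1) * ‖b‖ := by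
  have h1 := norm_sq_lt_one hp
  have h2 : 0 ≤ 2 / (1 - ‖p.1‖ ^ 2) := div_nonneg (by norm_num) (by linarith)
  apply Real.sqrt_le_iff.mpr ⟨by positivity, ?_⟩
  rw [metric_self]
  have h3 : ‖b.1‖ ≤ ‖b‖ := norm_fst_le b
  have h4 : ‖b.2‖ ≤ ‖b‖ := norm_snd_le b
  have h5 : b.2 ^ 2 ≤ ‖b‖ ^ 2 := by
    rw [← sq_abs, ← Real.norm_eq_abs]
    gcongr
  have h6 : ‖b.1‖ ^ 2 ≤ ‖b‖ ^ 2 := by gcongr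
  nlinarith [mul_nonneg h2 (sq_nonneg ‖b‖), mul_le_mul_of_nonneg_left h6 (sq_nonneg (2 / (1 - ‖p.1‖ ^ 2)))]

/-- A test map `φ` with speed at most the Riemannian speed bounds lengths from below. Two test maps
are used: the position itself, and `log (1 - |z|²)`. -/
theorem edist_le_pathLength {F : Type*} [NormedAddCommGroup F] [NormedSpace ℝ F] [CompleteSpace F]
    {c : ℝ → ℂ × ℝ} {φ : ℝ → F} (hφ : ContDiffOn ℝ 1 φ (Icc 0 1))
    (hle : ∀ s ∈ Icc (0 : ℝ) 1, ‖derivWithin φ (Icc 0 1) s‖ ≤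
      √(metric (c s) (derivWithin c (Icc 0 1) s) (derivWithin c (Icc 0 1) s))) :
    edist (φ 0) (φ 1) ≤ pathLength c := by
  have h1 := intervalIntegral.integral_derivWithin_Icc_of_contDiffOn_Icc hφ zero_le_one
  rw [edist_comm, edist_eq_enorm_sub, ← h1, intervalIntegral.integral_of_le zero_le_one,
    ← integral_Icc_eq_integral_Ioc]
  refine (enorm_integral_le_lintegral_enorm _).trans ?_
  refine setLIntegral_mono' measurableSet_Icc fun s hs => ?_
  rw [← ofReal_norm]
  exact ENNReal.ofReal_le_ofReal (hle s hs)

theorem edist_le_intrinsicDist {M : Set (ℂ × ℝ)} (hM : M ⊆ space) (p q : ℂ × ℝ) :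
    edist p q ≤ intrinsicDist M p q := by
  refine le_iInf fun c => le_iInf fun hc => ?_
  obtain ⟨hc1, hc2, rfl, rfl⟩ := hc
  exact edist_le_pathLength hc1 fun s hs => norm_le_sqrt_metric (hM (hc2 hs)) _

/-- The derivative of `log (1 - |z|²)` is at most `2 * |dz| / (1 - |z|²)` in absolute value. Since
this logarithm tends to `-∞` at the ideal boundary, no intrinsically Cauchy sequence can escape
there. -/
theorem edist_log_le_intrinsicDist {M : Set (ℂ × ℝ)} (hM : M ⊆ space) (p q : ℂ × ℝ) :
    edist (Real.log (1 - ‖p.1‖ ^ 2)) (Real.log (1 - ‖q.1‖ ^ 2)) ≤ intrinsicDist M p q := by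
  refine le_iInf fun c => le_iInf fun hc => ?_
  obtain ⟨hc1, hc2, rfl, rfl⟩ := hc
  have hpos : ∀ s ∈ Icc (0 : ℝ) 1, 0 < 1 - ‖(c s).1‖ ^ 2 := fun s hs => by
    linarith [norm_sq_lt_one (hM (hc2 hs))]
  have hfst : ContDiffOn ℝ 1 (fun s => (c s).1) (Icc 0 1) := hc1.fst
  refine edist_le_pathLength (φ := fun s => Real.log (1 - ‖(c s).1‖ ^ 2)) ?_ fun s hs => ?_
  · exact ContDiffOn.log (contDiffOn_const.sub (hfst.norm_sq ℝ)) fun s hs => (hpos s hs).ne'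
  · have hd : HasDerivWithinAt c (derivWithin c (Icc 0 1) s) (Icc 0 1) s :=
      (hc1.differentiableOn one_ne_zero s hs).hasDerivWithinAt
    have hd1 : HasDerivWithinAt (fun s => (c s).1) (derivWithin c (Icc 0 1) s).1 (Icc 0 1) s :=
      hd.fst
    have hd2 := ((hd1.norm_sq.const_sub 1).log (hpos s hs).ne')
    rw [hd2.derivWithin (uniqueDiffOn_Icc zero_lt_one s hs)]
    refine le_trans ?_ (mul_norm_fst_le_sqrt_metric (hM (hc2 hs)) _)
    rw [norm_div, Real.norm_of_nonneg (hpos s hs).le, div_mul_eq_mul_div]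
    have := hpos s hs
    gcongr
    rw [norm_neg, norm_mul, Real.norm_ofNat]
    have h2 := norm_inner_le_norm (𝕜 := ℝ) (c s).1 (derivWithin c (Icc 0 1) s).1
    have h3 : ‖(c s).1‖ ≤ 1 := by nlinarith [norm_nonneg (c s).1]
    nlinarith [norm_nonneg (derivWithin c (Icc 0 1) s).1]

theorem intrinsicDist_le_of_segment {M : Set (ℂ × ℝ)} (hM : M ⊆ space) {X : ℝ × ℝ → ℂ × ℝ}
    {S : Set (ℝ × ℝ)} (hS : Convex ℝ S) (hSo : IsOpen S) (hX : ContDiffOn ℝ 1 X S)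
    (hXM : MapsTo X S M) {C : ℝ}
    (hC : ∀ w ∈ S, (2 / (1 - ‖(X w).1‖ ^ 2) + 1) * ‖fderiv ℝ X w‖ ≤ C) {u v : ℝ × ℝ}
    (hu : u ∈ S) (hv : v ∈ S) :
    intrinsicDist M (X u) (X v) ≤ ENNReal.ofReal (C * ‖v - u‖) := by
  have hseg : ∀ s ∈ Icc (0 : ℝ) 1, u + s • (v - u) ∈ S := fun s hs =>
    hS.add_smul_sub_mem hu hv hs
  have hline : ContDiff ℝ 1 fun s : ℝ => u + s • (v - u) := by fun_prop
  refine (iInf₂_le (fun s => X (u + s • (v - u)))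
    ⟨hX.comp hline.contDiffOn hseg, fun s hs => hXM (hseg s hs), by simp, by simp⟩).trans ?_
  rw [pathLength]
  have hbound : ∀ s ∈ Icc (0 : ℝ) 1, ENNReal.ofReal
      √(metric (X (u + s • (v - u))) (derivWithin (fun s => X (u + s • (v - u))) (Icc 0 1) s)
        (derivWithin (fun s => X (u + s • (v - u))) (Icc 0 1) s)) ≤
      ENNReal.ofReal (C * ‖v - u‖) := by
    intro s hs
    apply ENNReal.ofReal_le_ofReal
    have hXd : HasFDerivAt X (fderiv ℝ X (u + s • (v - u))) (u + s • (v - u)) :=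
      ((hX.differentiableOn one_ne_zero).differentiableAt (hSo.mem_nhds (hseg s hs))).hasFDerivAt
    have hl : HasDerivAt (fun s : ℝ => u + s • (v - u)) (v - u) s := by
      simpa using ((hasDerivAt_id s).smul_const (v - u)).const_add u
    have hcd : derivWithin (fun s => X (u + s • (v - u))) (Icc 0 1) s =
        fderiv ℝ X (u + s • (v - u)) (v - u) :=
      (hXd.comp_hasDerivAt s hl).hasDerivWithinAt.derivWithin (uniqueDiffOn_Icc zero_lt_one s hs)
    rw [hcd]
    refine (sqrt_metric_le (hM (hXM (hseg s hs))) _).trans ?_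
    have h1 := norm_sq_lt_one (hM (hXM (hseg s hs)))
    have h2 : 0 ≤ 2 / (1 - ‖(X (u + s • (v - u))).1‖ ^ 2) :=
      div_nonneg (by norm_num) (by linarith)
    calc _ ≤ (2 / (1 - ‖(X (u + s • (v - u))).1‖ ^ 2) + 1) *
          (‖fderiv ℝ X (u + s • (v - u))‖ * ‖v - u‖) := by
            gcongr
            exact ContinuousLinearMap.le_opNorm _ _
      _ ≤ C * ‖v - u‖ := by
            rw [← mul_assoc]
            gcongr
            exact hC _ (hseg s hs)
  refine (setLIntegral_mono' measurableSet_Icc hbound).trans ?_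
  simp

/-- The chart is a homeomorphism onto its image, so points of `M` near `p` in the ambient space have
parameters near that of `p`. The image of the segment joining these parameters is a short path in
`M`. -/
theorem IsEmbeddedMinimal.tendsto_intrinsicDist {M : Set (ℂ × ℝ)} (hM : IsEmbeddedMinimal M)
    {p : ℂ × ℝ} (hp : p ∈ M) {x : ℕ → ℂ × ℝ} (hx : ∀ n, x n ∈ M)
    (hlim : Tendsto x atTop (𝓝 p)) :
    Tendsto (fun n => intrinsicDist M (x n) p) atTop (𝓝 0) := by
  obtain ⟨hsp, hch⟩ := hM
  obtain ⟨X, U, V, hU, hV, hpV, hXU, hXs, hemb, -⟩ := hch p hp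
  obtain ⟨v, hvU, rfl⟩ : p ∈ X '' U := by rw [hXU]; exact ⟨hp, hpV⟩
  have hXM : MapsTo X U M := fun w hw => (hXU.subset ⟨w, hw, rfl⟩).1
  have hX1 : ContDiffOn ℝ 1 X U := hXs.of_le (by norm_cast)
  -- `K` bounds the ratio of Riemannian speed to parameter speed. It is continuous, hence below a
  -- constant `C` near `v`, and a segment of length less than `ε' / C` has an image of length at
  -- most `ε'`.
  set K : ℝ × ℝ → ℝ := fun w => (2 / (1 - ‖(X w).1‖ ^ 2) + 1) * ‖fderiv ℝ X w‖ with hK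
  have hXc : ContinuousAt X v := hX1.continuousOn.continuousAt (hU.mem_nhds hvU)
  have hKc : ContinuousAt K v := by
    have h1 : ContinuousAt (fun w => fderiv ℝ X w) v :=
      (hX1.continuousOn_fderiv_of_isOpen hU le_rfl).continuousAt (hU.mem_nhds hvU)
    have h2 : (1 - ‖(X v).1‖ ^ 2) ≠ 0 := by linarith [norm_sq_lt_one (hsp hp)]
    have h3 : ContinuousAt (fun w => (X w).1) v := hXc.fst
    exact ((continuousAt_const.div (continuousAt_const.sub (h3.norm.pow 2)) h2).add
      continuousAt_const).mul h1.norm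
  have hev : ∀ᶠ w in 𝓝 v, w ∈ U ∧ K w < K v + 1 :=
    (hU.eventually_mem hvU).and (hKc.eventually_lt_const (lt_add_one _))
  obtain ⟨δ₀, hδ₀, hball⟩ := Metric.eventually_nhds_iff_ball.mp hev
  set C := K v + 1 with hC
  have hKv : 0 ≤ K v := by
    have := norm_sq_lt_one (hsp hp)
    have h2 : 0 ≤ 2 / (1 - ‖(X v).1‖ ^ 2) := div_nonneg (by norm_num) (by linarith)
    positivity
  have hCpos : 0 < C := by linarith
  rw [ENNReal.tendsto_nhds_zero]
  intro ε hε
  obtain ⟨ε', hε'0, hε'⟩ : ∃ ε' : ℝ, 0 < ε' ∧ ENNReal.ofReal ε' ≤ ε := by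
    rcases eq_or_ne ε ⊤ with rfl | htop
    · exact ⟨1, one_pos, le_top⟩
    · exact ⟨ε.toReal, ENNReal.toReal_pos hε.ne' htop, ENNReal.ofReal_toReal_le⟩
  set δ := min δ₀ (ε' / C) with hδ
  have hδpos : 0 < δ := lt_min hδ₀ (by positivity)
  have hnh : (Subtype.val ⁻¹' Metric.ball v δ : Set U) ∈ 𝓝 (⟨v, hvU⟩ : U) :=
    continuous_subtype_val.continuousAt.preimage_mem_nhds (Metric.ball_mem_nhds v hδpos)
  rw [hemb.isInducing.nhds_eq_comap, mem_comap] at hnh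
  obtain ⟨W, hW, hWsub⟩ := hnh
  have hWp : W ∈ 𝓝 (X v) := hW
  have hVW : ∀ᶠ n in atTop, x n ∈ V ∩ W :=
    hlim.eventually (inter_mem (hV.mem_nhds hpV) hWp)
  filter_upwards [hVW] with n hn
  obtain ⟨u, huU, hux⟩ : x n ∈ X '' U := by rw [hXU]; exact ⟨hx n, hn.1⟩
  have hu : u ∈ Metric.ball v δ := by
    have : (⟨u, huU⟩ : U) ∈ (U.domRestrict X) ⁻¹' W := by
      change X u ∈ W
      rw [hux]; exact hn.2
    exact hWsub this
  have hball' : ∀ w ∈ Metric.ball v δ₀, w ∈ U ∧ K w < C := hball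
  rw [← hux]
  have := intrinsicDist_le_of_segment hsp (convex_ball v δ₀) Metric.isOpen_ball
    (hX1.mono fun w hw => (hball' w hw).1) (fun w hw => hXM (hball' w hw).1) (C := C)
    (fun w hw => (hball' w hw).2.le) (Metric.ball_subset_ball (min_le_left _ _) hu)
    (Metric.mem_ball_self hδ₀)
  refine this.trans (le_trans (ENNReal.ofReal_le_ofReal ?_) hε')
  rw [Metric.mem_ball, dist_comm, dist_eq_norm] at hu
  calc C * ‖v - u‖ ≤ C * (ε' / C) := by
        gcongr
        exact hu.le.trans (min_le_right _ _)
    _ = ε' := by field_simp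

/-- A relatively closed embedded minimal surface is complete. -/
theorem IsEmbeddedMinimal.isIntrinsicallyComplete {M : Set (ℂ × ℝ)} (hM : IsEmbeddedMinimal M)
    (hcl : closure M ∩ space ⊆ M) : IsIntrinsicallyComplete M := by
  intro x hx hcau
  have h1 : CauchySeq x := by
    rw [EMetric.cauchySeq_iff]
    intro ε hε
    obtain ⟨N, hN⟩ := hcau ε hε
    exact ⟨N, fun m hm n hn => (edist_le_intrinsicDist hM.1 _ _).trans_lt (hN m hm n hn)⟩
  have h2 : CauchySeq fun n => Real.log (1 - ‖(x n).1‖ ^ 2) := by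
    rw [EMetric.cauchySeq_iff]
    intro ε hε
    obtain ⟨N, hN⟩ := hcau ε hε
    exact ⟨N, fun m hm n hn => (edist_log_le_intrinsicDist hM.1 _ _).trans_lt (hN m hm n hn)⟩
  obtain ⟨p, hp⟩ := cauchySeq_tendsto_of_complete h1
  obtain ⟨l, hl⟩ := cauchySeq_tendsto_of_complete h2
  -- The limit of `1 - |z|²` is an exponential, hence positive, which places the limit point inside
  -- `ℍ² × ℝ`.
  have h3 : Tendsto (fun n => 1 - ‖(x n).1‖ ^ 2) atTop (𝓝 (Real.exp l)) := by
    refine ((Real.continuous_exp.tendsto l).comp hl).congr fun n => ?_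
    rw [Function.comp_apply, Real.exp_log]
    linarith [norm_sq_lt_one (hM.1 (hx n))]
  have h4 : Tendsto (fun n => 1 - ‖(x n).1‖ ^ 2) atTop (𝓝 (1 - ‖p.1‖ ^ 2)) :=
    tendsto_const_nhds.sub ((((continuous_fst.tendsto p).comp hp).norm).pow 2)
  have h5 := tendsto_nhds_unique h3 h4
  have h6 : p ∈ space := by
    refine ⟨?_, mem_univ _⟩
    rw [hypPlane, mem_ball_zero_iff]
    nlinarith [Real.exp_pos l, norm_nonneg p.1]
  have h7 : p ∈ M :=
    hcl ⟨mem_closure_of_tendsto hp (Eventually.of_forall hx), h6⟩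
  exact ⟨p, h7, hM.tendsto_intrinsicDist h7 hx hp⟩

theorem isProperIn_of_closure_inter_subset {M : Set (ℂ × ℝ)} (hcl : closure M ∩ space ⊆ M) :
    IsProperIn M := by
  intro K hK hKc
  have : M ∩ K = closure M ∩ K :=
    Subset.antisymm (inter_subset_inter_left _ subset_closure)
      fun p hp => ⟨hcl ⟨hp.1, hK hp.2⟩, hp.2⟩
  rw [this]
  exact hKc.inter_left isClosed_closure

end

section

/-! ### Minimal surfaces invariant under hyperbolic translations -/

/-- The profile curve `s ↦ (v s, t s)` satisfies the differential equation of the minimal surfaces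
invariant under the homotheties of the half-plane. Here `-h` is the derivative of the argument
of `v` with respect to the height `t`. -/
structure IsMinimalProfile (v : ℝ → ℂ) (t t₁ h : ℝ → ℝ) (J : Set ℝ) : Prop where
  isOpen : IsOpen J
  ordConnected : J.OrdConnected
  norm_eq : ∀ s ∈ J, ‖v s‖ = 1
  im_pos : ∀ s ∈ J, 0 < (v s).im
  contDiffOn_curve : ContDiffOn ℝ ∞ v J
  contDiffOn_speed : ContDiffOn ℝ ∞ t₁ J
  hasDerivAt_height : ∀ s ∈ J, HasDerivAt t (t₁ s) s
  speed_pos : ∀ s ∈ J, 0 < t₁ s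
  hasDerivAt_curve : ∀ s ∈ J, HasDerivAt v (-(Complex.I * (h s * t₁ s)) * v s) s
  hasDerivAt_slope : ∀ s ∈ J, HasDerivAt h (t₁ s * ((v s).re * (v s).im)) s

/-- The parametrization of a swept surface. -/
noncomputable def sweepParam (q₂ a : ℂ) (v : ℝ → ℂ) (t : ℝ → ℝ) (p : ℝ × ℝ) : ℂ × ℝ :=
  (halfPlaneToDisk q₂ a (Real.exp p.1 * v p.2), t p.2)

/-- The image of the Euler vector field under `halfPlaneToDisk q₂ a`, at the point `w`. -/
noncomputable def eulerField (q₂ a w : ℂ) : ℂ := q₂ * (a - conj a) * w / (w - conj a) ^ 2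

/-- In complex notation the Christoffel symbols of a conformal metric on a plane domain are complex
bilinear. As `halfPlaneToDisk` is holomorphic, the horizontal part of every derivative of a sweep is
then a complex multiple of `eulerField`. -/
theorem christoffel_eq (p b c : ℂ × ℝ) :
    christoffel p b c = (2 * conj p.1 * b.1 * c.1 / (1 - ‖p.1‖ ^ 2 : ℝ), 0) := by
  rw [christoffel]
  congr 1
  have : inner ℝ p.1 b.1 • c.1 + inner ℝ p.1 c.1 • b.1 - inner ℝ b.1 c.1 • p.1 =
      conj p.1 * b.1 * c.1 := by
    apply Complex.ext <;> simp [Complex.inner] <;> ring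
  rw [this, Complex.real_smul]
  push_cast
  ring

theorem inner_mul_mul (e m n : ℂ) :
    inner ℝ (e * m) (e * n) = ‖e‖ ^ 2 * (m.re * n.re + m.im * n.im) := by
  rw [← Complex.normSq_eq_norm_sq, Complex.normSq_apply]
  simp [Complex.inner]
  ring

theorem fderiv_fst_eq {F : Type*} [NormedAddCommGroup F] [NormedSpace ℝ F] {f : ℝ × ℝ → F}
    {p : ℝ × ℝ} {f' : F} (hf : DifferentiableAt ℝ f p)
    (h : HasDerivAt (fun x => f (x, p.2)) f' p.1) : fderiv ℝ f p (1, 0) = f' := by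
  have h1 : HasDerivAt (fun x : ℝ => (x, p.2)) ((1 : ℝ), (0 : ℝ)) p.1 :=
    (hasDerivAt_id p.1).prodMk (hasDerivAt_const _ _)
  exact (HasFDerivAt.comp_hasDerivAt (f := fun x : ℝ => (x, p.2)) p.1 hf.hasFDerivAt h1).unique h

theorem fderiv_snd_eq {F : Type*} [NormedAddCommGroup F] [NormedSpace ℝ F] {f : ℝ × ℝ → F}
    {p : ℝ × ℝ} {f' : F} (hf : DifferentiableAt ℝ f p)
    (h : HasDerivAt (fun x => f (p.1, x)) f' p.2) : fderiv ℝ f p (0, 1) = f' := by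
  have h1 : HasDerivAt (fun x : ℝ => (p.1, x)) ((0 : ℝ), (1 : ℝ)) p.2 :=
    (hasDerivAt_const _ _).prodMk (hasDerivAt_id p.2)
  exact (HasFDerivAt.comp_hasDerivAt (f := fun x : ℝ => (p.1, x)) p.2 hf.hasFDerivAt h1).unique h

namespace IsFrame

variable {q₁ q₂ a : ℂ}

theorem hasDerivAt_halfPlaneToDisk {w : ℂ} (hw : w - conj a ≠ 0) :
    HasDerivAt (halfPlaneToDisk q₂ a) (q₂ * (a - conj a) / (w - conj a) ^ 2) w := by
  have h1 : HasDerivAt (fun w : ℂ => q₂ * (w - a)) (q₂ * 1) w :=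
    ((hasDerivAt_id w).sub_const a).const_mul q₂
  have h2 : HasDerivAt (fun w : ℂ => w - conj a) 1 w := (hasDerivAt_id w).sub_const _
  refine HasDerivAt.congr_deriv (h1.div h2 hw) ?_
  field_simp
  ring

theorem hasDerivAt_eulerField {w : ℂ} (hw : w - conj a ≠ 0) :
    HasDerivAt (eulerField q₂ a) (- (q₂ * (a - conj a) * (w + conj a)) / (w - conj a) ^ 3) w := by
  have h1 : HasDerivAt (fun w : ℂ => q₂ * (a - conj a) * w) (q₂ * (a - conj a) * 1) w :=
    (hasDerivAt_id w).const_mul _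
  have h2 : HasDerivAt (fun w : ℂ => (w - conj a) ^ 2) (2 * (w - conj a)) w := by
    simpa using ((hasDerivAt_id w).sub_const (conj a)).fun_pow 2
  refine HasDerivAt.congr_deriv (h1.div h2 (pow_ne_zero 2 hw)) ?_
  field_simp
  ring

theorem eulerField_ne_zero (h : IsFrame q₁ q₂ a) {w : ℂ} (hw : 0 < w.im) :
    eulerField q₂ a w ≠ 0 := by
  have hw0 : w ≠ 0 := by rintro rfl; simp at hw
  exact div_ne_zero (mul_ne_zero (mul_ne_zero h.right_ne_zero h.sub_conj_ne_zero) hw0)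
    (pow_ne_zero 2 (h.sub_conj_base_ne_zero hw.le))

/-- The right side is the squared length of the radial vector `w` in the half-plane metric `|dw|² /
(Im w)²`. -/
theorem conformal_factor (h : IsFrame q₁ q₂ a) {w : ℂ} (hw : 0 < w.im) :
    (2 / (1 - ‖halfPlaneToDisk q₂ a w‖ ^ 2)) ^ 2 * ‖eulerField q₂ a w‖ ^ 2 =
      ‖w‖ ^ 2 / w.im ^ 2 := by
  have h0 := h.sub_conj_base_ne_zero hw.le
  have hn := norm_pos_iff.mpr h0
  have ha := h.im_pos
  rw [h.normSq_halfPlaneToDisk h0, eulerField, sub_conj, norm_div, norm_mul, norm_mul, norm_mul,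
    h.norm_right, norm_mul, norm_pow, Complex.norm_I, Complex.norm_real, Complex.norm_two,
    Real.norm_of_nonneg ha.le]
  field_simp
  norm_num

/-- This is the covariant derivative of the Euler field `E` along itself: in the half-plane, `w + I
* w² / w.im = I * (w.re / w.im) * w`. It vanishes on the imaginary axis, which is the geodesic `γ`.
Complex bilinearity gives the derivatives along multiples of `E` as well. -/
theorem covariant_eulerField (h : IsFrame q₁ q₂ a) {w : ℂ} (hw : 0 < w.im) :
    - (q₂ * (a - conj a) * (w + conj a)) / (w - conj a) ^ 3 * w +
      2 * conj (halfPlaneToDisk q₂ a w) * eulerField q₂ a w * eulerField q₂ a w /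
        (1 - ‖halfPlaneToDisk q₂ a w‖ ^ 2 : ℝ) =
      eulerField q₂ a w * (Complex.I * (w.re / w.im : ℝ)) := by
  have h0 := h.sub_conj_base_ne_zero hw.le
  have h0' : conj w - a ≠ 0 := by
    intro h1
    apply h0
    have := congrArg conj h1
    simpa using this
  have hn : ((‖w - conj a‖ : ℝ) : ℂ) ^ 2 = (w - conj a) * (conj w - a) := by
    have : conj (w - conj a) = conj w - a := by simp
    rw [← this, Complex.mul_conj, Complex.normSq_eq_norm_sq]
    push_cast
    rfl
  have hq := h.right_mul_conj
  have ha : (a.im : ℂ) ≠ 0 := by exact_mod_cast h.im_pos.ne'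
  have hwi : (w.im : ℂ) ≠ 0 := by exact_mod_cast hw.ne'
  have hqc : conj q₂ ≠ 0 := right_ne_zero_of_mul_eq_one hq
  rw [h.normSq_halfPlaneToDisk h0]
  push_cast
  rw [hn, halfPlaneToDisk, eulerField, sub_conj]
  have hcw : conj w = w - 2 * w.im * Complex.I := by
    apply Complex.ext <;> simp; ring
  have hre : (w.re : ℂ) = w - w.im * Complex.I := by
    apply Complex.ext <;> simp
  simp only [map_div₀, map_mul, map_sub, Complex.conj_conj]
  have hI := Complex.I_sq
  field_simp
  rw [hcw] at h0' ⊢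
  rw [hre]
  linear_combination (4 * q₂ * w * (Complex.I * w * (w - 2 * w.im * Complex.I - conj a))) * hq -
    4 * q₂ * w * (w + conj a) * w.im * hI

end IsFrame

/-! ### Fundamental forms, minimality and embeddedness of a swept surface -/

namespace IsMinimalProfile

variable {q₁ q₂ a : ℂ} {v : ℝ → ℂ} {t t₁ h : ℝ → ℝ} {J : Set ℝ}

theorem contDiffOn_height (hp : IsMinimalProfile v t t₁ h J) : ContDiffOn ℝ ∞ t J := by
  rw [contDiffOn_infty_iff_deriv_of_isOpen hp.isOpen]
  exact ⟨fun s hs => (hp.hasDerivAt_height s hs).differentiableAt.differentiableWithinAt,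
    hp.contDiffOn_speed.congr fun s hs => (hp.hasDerivAt_height s hs).deriv⟩

theorem im_pos_exp_mul (hp : IsMinimalProfile v t t₁ h J) {p : ℝ × ℝ} (hs : p.2 ∈ J) :
    0 < ((Real.exp p.1 : ℂ) * v p.2).im := by
  rw [Complex.im_ofReal_mul]
  exact mul_pos (Real.exp_pos _) (hp.im_pos _ hs)

theorem swept_eq_image_sweepParam :
    swept q₂ a v t J = sweepParam q₂ a v t '' (univ ×ˢ J) := by
  ext p
  constructor
  · rintro ⟨r, hr, s, hs, rfl⟩
    exact ⟨(Real.log r, s), ⟨mem_univ _, hs⟩, by simp [sweepParam, Real.exp_log hr]⟩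
  · rintro ⟨⟨x, s⟩, ⟨-, hs⟩, rfl⟩
    exact ⟨Real.exp x, Real.exp_pos x, s, hs, rfl⟩

theorem contDiffOn_sweepParam (hp : IsMinimalProfile v t t₁ h J) (hf : IsFrame q₁ q₂ a) :
    ContDiffOn ℝ ∞ (sweepParam q₂ a v t) (univ ×ˢ J) := by
  have h2 : ContDiffOn ℝ ∞ (fun p : ℝ × ℝ => p.2) (univ ×ˢ J) := contDiff_snd.contDiffOn
  have h2m : MapsTo (fun p : ℝ × ℝ => p.2) (univ ×ˢ J) J := fun p hp => hp.2
  have h1 : ContDiffOn ℝ ∞ (fun p : ℝ × ℝ => (Real.exp p.1 : ℂ)) (univ ×ˢ J) :=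
    (Complex.ofRealCLM.contDiff.comp (Real.contDiff_exp.comp contDiff_fst)).contDiffOn
  have hw : ContDiffOn ℝ ∞ (fun p : ℝ × ℝ => (Real.exp p.1 : ℂ) * v p.2) (univ ×ˢ J) :=
    h1.mul (hp.contDiffOn_curve.comp h2 h2m)
  exact (hf.contDiffOn_halfPlaneToDisk.comp hw fun p hpm => hp.im_pos_exp_mul hpm.2).prodMk
    (hp.contDiffOn_height.comp h2 h2m)

theorem hasDerivAt_exp_mul (p : ℝ × ℝ) :
    HasDerivAt (fun x : ℝ => (Real.exp x : ℂ) * v p.2) (Real.exp p.1 * v p.2) p.1 :=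
  (Real.hasDerivAt_exp p.1).ofReal_comp.mul_const _

theorem hasDerivAt_exp_mul_curve (hp : IsMinimalProfile v t t₁ h J) {p : ℝ × ℝ} (hs : p.2 ∈ J) :
    HasDerivAt (fun x : ℝ => (Real.exp p.1 : ℂ) * v x)
      (-(Complex.I * (h p.2 * t₁ p.2)) * (Real.exp p.1 * v p.2)) p.2 :=
  ((hp.hasDerivAt_curve _ hs).const_mul _).congr_deriv (by ring)

theorem differentiableAt_exp_mul (hp : IsMinimalProfile v t t₁ h J) {p : ℝ × ℝ} (hs : p.2 ∈ J) :
    DifferentiableAt ℝ (fun p : ℝ × ℝ => (Real.exp p.1 : ℂ) * v p.2) p := by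
  have h1 : DifferentiableAt ℝ (fun p : ℝ × ℝ => (Real.exp p.1 : ℂ)) p :=
    Complex.ofRealCLM.differentiableAt.comp p
      (Real.differentiable_exp.differentiableAt.comp p differentiableAt_fst)
  exact h1.mul ((hp.hasDerivAt_curve _ hs).differentiableAt.comp p differentiableAt_snd)

theorem differentiableAt_sweepParam (hp : IsMinimalProfile v t t₁ h J) (hf : IsFrame q₁ q₂ a)
    {p : ℝ × ℝ} (hs : p.2 ∈ J) : DifferentiableAt ℝ (sweepParam q₂ a v t) p :=
  ((hp.contDiffOn_sweepParam hf).differentiableOn (by norm_num)).differentiableAt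
    ((isOpen_univ.prod hp.isOpen).mem_nhds ⟨mem_univ _, hs⟩)

theorem partialD_fst (hp : IsMinimalProfile v t t₁ h J) (hf : IsFrame q₁ q₂ a)
    {p : ℝ × ℝ} (hs : p.2 ∈ J) :
    partialD (sweepParam q₂ a v t) (1, 0) p =
      (eulerField q₂ a (Real.exp p.1 * v p.2), 0) := by
  have h0 := hf.sub_conj_base_ne_zero (hp.im_pos_exp_mul hs).le
  refine fderiv_fst_eq (hp.differentiableAt_sweepParam hf hs) ?_
  refine HasDerivAt.prodMk ?_ (hasDerivAt_const _ (t p.2))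
  refine ((IsFrame.hasDerivAt_halfPlaneToDisk h0).comp_of_eq p.1
    (hasDerivAt_exp_mul p) rfl).congr_deriv ?_
  rw [eulerField]
  ring

theorem partialD_snd (hp : IsMinimalProfile v t t₁ h J) (hf : IsFrame q₁ q₂ a)
    {p : ℝ × ℝ} (hs : p.2 ∈ J) :
    partialD (sweepParam q₂ a v t) (0, 1) p =
      (-(Complex.I * (h p.2 * t₁ p.2)) * eulerField q₂ a (Real.exp p.1 * v p.2), t₁ p.2) := by
  have h0 := hf.sub_conj_base_ne_zero (hp.im_pos_exp_mul hs).le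
  refine fderiv_snd_eq (hp.differentiableAt_sweepParam hf hs) ?_
  refine HasDerivAt.prodMk ?_ (hp.hasDerivAt_height _ hs)
  refine ((IsFrame.hasDerivAt_halfPlaneToDisk h0).comp_of_eq p.2
    (hp.hasDerivAt_exp_mul_curve hs) rfl).congr_deriv ?_
  rw [eulerField]
  ring

theorem eventually_nhds_mem (hp : IsMinimalProfile v t t₁ h J) {p : ℝ × ℝ} (hs : p.2 ∈ J) :
    ∀ᶠ p' in 𝓝 p, p'.2 ∈ J :=
  (continuous_snd.tendsto p).eventually (hp.isOpen.mem_nhds hs)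

theorem differentiableAt_eulerField (hp : IsMinimalProfile v t t₁ h J) (hf : IsFrame q₁ q₂ a)
    {p : ℝ × ℝ} (hs : p.2 ∈ J) :
    DifferentiableAt ℝ (fun p : ℝ × ℝ => eulerField q₂ a (Real.exp p.1 * v p.2)) p :=
  DifferentiableAt.comp (f := fun p : ℝ × ℝ => (Real.exp p.1 : ℂ) * v p.2) p
    ((IsFrame.hasDerivAt_eulerField (hf.sub_conj_base_ne_zero
      (hp.im_pos_exp_mul hs).le)).differentiableAt.restrictScalars ℝ)
    (hp.differentiableAt_exp_mul hs)

theorem hasDerivAt_speed (hp : IsMinimalProfile v t t₁ h J) {s : ℝ} (hs : s ∈ J) :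
    HasDerivAt t₁ (deriv t₁ s) s :=
  ((hp.contDiffOn_speed.differentiableOn (by norm_num)).differentiableAt
    (hp.isOpen.mem_nhds hs)).hasDerivAt

theorem covD_fst_fst (hp : IsMinimalProfile v t t₁ h J) (hf : IsFrame q₁ q₂ a)
    {p : ℝ × ℝ} (hs : p.2 ∈ J) :
    covD (sweepParam q₂ a v t) (1, 0) (1, 0) p =
      (eulerField q₂ a (Real.exp p.1 * v p.2) *
        (Complex.I * ((v p.2).re / (v p.2).im : ℝ)), 0) := by
  have h0 := hf.sub_conj_base_ne_zero (hp.im_pos_exp_mul hs).le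
  have hev : partialD (sweepParam q₂ a v t) (1, 0) =ᶠ[𝓝 p]
      fun p => (eulerField q₂ a (Real.exp p.1 * v p.2), (0 : ℝ)) :=
    (hp.eventually_nhds_mem hs).mono fun p' hp' => hp.partialD_fst hf hp'
  have hder := (IsFrame.hasDerivAt_eulerField (q₂ := q₂) h0).comp_of_eq p.1
    (hasDerivAt_exp_mul p) rfl
  rw [covD, hev.fderiv_eq, fderiv_fst_eq
    ((hp.differentiableAt_eulerField hf hs).prodMk (differentiableAt_const _))
    (HasDerivAt.prodMk hder (hasDerivAt_const _ (0 : ℝ))), christoffel_eq, hp.partialD_fst hf hs]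
  have := hf.covariant_eulerField (hp.im_pos_exp_mul hs)
  rw [Complex.im_ofReal_mul, Complex.re_ofReal_mul,
    mul_div_mul_left _ _ (Real.exp_pos _).ne'] at this
  simp only [sweepParam, Prod.mk_add_mk, add_zero]
  rw [this]

theorem covD_snd_snd (hp : IsMinimalProfile v t t₁ h J) (hf : IsFrame q₁ q₂ a)
    {p : ℝ × ℝ} (hs : p.2 ∈ J) :
    covD (sweepParam q₂ a v t) (0, 1) (0, 1) p =
      (eulerField q₂ a (Real.exp p.1 * v p.2) *
        (-(Complex.I * ((t₁ p.2 * ((v p.2).re * (v p.2).im) * t₁ p.2 + h p.2 * deriv t₁ p.2 +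
          (v p.2).re / (v p.2).im * (h p.2 * t₁ p.2) ^ 2 : ℝ)))), deriv t₁ p.2) := by
  have h0 := hf.sub_conj_base_ne_zero (hp.im_pos_exp_mul hs).le
  have hev : partialD (sweepParam q₂ a v t) (0, 1) =ᶠ[𝓝 p]
      fun p => (-(Complex.I * (h p.2 * t₁ p.2)) * eulerField q₂ a (Real.exp p.1 * v p.2),
        t₁ p.2) :=
    (hp.eventually_nhds_mem hs).mono fun p' hp' => hp.partialD_snd hf hp'
  have hder := (IsFrame.hasDerivAt_eulerField (q₂ := q₂) h0).comp_of_eq p.2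
    (hp.hasDerivAt_exp_mul_curve hs) rfl
  have hd1 : HasDerivAt (fun x => -(Complex.I * ((h x : ℂ) * t₁ x)))
      (-(Complex.I * ((t₁ p.2 * ((v p.2).re * (v p.2).im) : ℝ) * t₁ p.2 +
        h p.2 * (deriv t₁ p.2 : ℝ)))) p.2 :=
    (((hp.hasDerivAt_slope _ hs).ofReal_comp.mul
      (hp.hasDerivAt_speed hs).ofReal_comp).const_mul Complex.I).neg
  have hdiff : DifferentiableAt ℝ (fun p : ℝ × ℝ =>
      (-(Complex.I * (h p.2 * t₁ p.2)) * eulerField q₂ a (Real.exp p.1 * v p.2), t₁ p.2)) p :=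
    ((hd1.differentiableAt.comp p differentiableAt_snd).mul
      (hp.differentiableAt_eulerField hf hs)).prodMk
      ((hp.hasDerivAt_speed hs).differentiableAt.comp p differentiableAt_snd)
  rw [covD, hev.fderiv_eq, fderiv_snd_eq hdiff
    (HasDerivAt.prodMk (hd1.mul hder) (hp.hasDerivAt_speed hs)), christoffel_eq,
    hp.partialD_snd hf hs]
  have := hf.covariant_eulerField (hp.im_pos_exp_mul hs)
  rw [Complex.im_ofReal_mul, Complex.re_ofReal_mul,
    mul_div_mul_left _ _ (Real.exp_pos _).ne'] at this
  simp only [sweepParam, Prod.mk_add_mk, add_zero]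
  congr 1
  push_cast at this ⊢
  linear_combination (-(Complex.I * (h p.2 * t₁ p.2))) ^ 2 * this +
    (eulerField q₂ a (Complex.exp p.1 * v p.2) * (h p.2 * t₁ p.2) ^ 2 * Complex.I *
      ((v p.2).re / (v p.2).im)) * Complex.I_sq

/-- The coordinate lines are orthogonal, so the mixed second derivative carries the coefficient `0`
and is never computed. Write a normal as `(e * ν, y)`; orthogonality to the second tangent vector
gives `y = L * h * ν.im`, with `L = 1 / v.im²`. The terms in `deriv t₁` then cancel, as they must
under reparametrization. The remaining factor `v.re / v.im - L * (v.re * v.im)`, whose second term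
comes from the slope equation, is zero. -/
theorem zeroMeanCurvatureAt (hp : IsMinimalProfile v t t₁ h J) (hf : IsFrame q₁ q₂ a)
    {p : ℝ × ℝ} (hs : p.2 ∈ J) : ZeroMeanCurvatureAt (sweepParam q₂ a v t) p := by
  have hw := hp.im_pos_exp_mul hs
  have hi := hp.im_pos _ hs
  have hc := hf.conformal_factor hw
  rw [Complex.im_ofReal_mul, norm_mul, hp.norm_eq _ hs, Complex.norm_real,
    Real.norm_of_nonneg (Real.exp_pos _).le] at hc
  have hc' : (2 / (1 - ‖halfPlaneToDisk q₂ a (Real.exp p.1 * v p.2)‖ ^ 2)) ^ 2 *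
      ‖eulerField q₂ a (Real.exp p.1 * v p.2)‖ ^ 2 = ((v p.2).im ^ 2)⁻¹ := by
    rw [hc]
    have := (Real.exp_pos p.1).ne'
    field_simp
  rintro ⟨n, y⟩
  have he0 := hf.eulerField_ne_zero hw
  obtain ⟨ν, rfl⟩ : ∃ ν, n = eulerField q₂ a (Real.exp p.1 * v p.2) * ν :=
    ⟨n / eulerField q₂ a (Real.exp p.1 * v p.2), by field_simp⟩
  rw [hp.partialD_fst hf hs, hp.partialD_snd hf hs, hp.covD_fst_fst hf hs, hp.covD_snd_snd hf hs]
  set e := eulerField q₂ a (Real.exp p.1 * v p.2) with he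
  have hcomm : -(Complex.I * ((h p.2 : ℂ) * t₁ p.2)) * e =
      e * (-(Complex.I * ((h p.2 * t₁ p.2 : ℝ) : ℂ))) := by push_cast; ring
  have hone : ((e, 0) : ℂ × ℝ) = (e * 1, 0) := by rw [mul_one]
  rw [hcomm, hone]
  set lam := (2 / (1 - ‖halfPlaneToDisk q₂ a (Real.exp p.1 * v p.2)‖ ^ 2)) ^ 2 with hlam
  have hI : ∀ x : ℝ, (Complex.I * (x : ℂ)).re = 0 ∧ (Complex.I * (x : ℂ)).im = x := by
    intro x; simp
  simp only [metric, sweepParam, inner_mul_mul, Complex.neg_re, Complex.neg_im, hI,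
    Complex.one_re, Complex.one_im, ← hlam]
  intro hN1 hN2
  have ht := hp.speed_pos _ hs
  have hL : lam * ‖e‖ ^ 2 * (v p.2).im ^ 2 = 1 := by
    rw [hc']; field_simp
  set L := lam * ‖e‖ ^ 2 with hLdef
  have hy : y = L * h p.2 * ν.im := by
    apply mul_right_cancel₀ ht.ne'
    rw [hLdef]
    linear_combination hN2
  rw [hy]
  have hi0 := hi.ne'
  have hexp : ∀ x : ℝ, lam * (‖e‖ ^ 2 * x) = L * x := fun x => by rw [hLdef]; ring
  simp only [hexp]
  have hL' : L = 1 / (v p.2).im ^ 2 := by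
    rw [eq_div_iff (by positivity)]; exact hL
  rw [hL']
  field_simp
  ring

theorem injective_fderiv (hp : IsMinimalProfile v t t₁ h J) (hf : IsFrame q₁ q₂ a)
    {p : ℝ × ℝ} (hs : p.2 ∈ J) :
    Function.Injective (fderiv ℝ (sweepParam q₂ a v t) p) := by
  rw [injective_iff_map_eq_zero]
  rintro ⟨x, y⟩ hxy
  have h1 := hp.partialD_fst hf hs
  have h2 := hp.partialD_snd hf hs
  rw [partialD] at h1 h2
  have hdec : ((x, y) : ℝ × ℝ) = x • ((1 : ℝ), (0 : ℝ)) + y • ((0 : ℝ), (1 : ℝ)) := by simp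
  rw [hdec, map_add, map_smul, map_smul, h1, h2] at hxy
  have hy : y = 0 := by
    have := congrArg Prod.snd hxy
    simpa [(hp.speed_pos _ hs).ne'] using this
  have hx : x = 0 := by
    have := congrArg Prod.fst hxy
    simpa [hy, hf.eulerField_ne_zero (hp.im_pos_exp_mul hs), -Complex.ofReal_exp] using this
  simp [hx, hy]

theorem strictMonoOn_height (hp : IsMinimalProfile v t t₁ h J) : StrictMonoOn t J :=
  strictMonoOn_of_hasDerivWithinAt_pos hp.ordConnected.convex
    hp.contDiffOn_height.continuousOn
    (fun s hs => (hp.hasDerivAt_height s (interior_subset hs)).hasDerivWithinAt)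
    (fun s hs => hp.speed_pos s (interior_subset hs))

theorem isEmbedding_restrict_height (hp : IsMinimalProfile v t t₁ h J) :
    IsEmbedding (J.domRestrict t) := by
  have := hp.ordConnected
  have hmono : StrictMono (J.domRestrict t) := fun x y hxy =>
    hp.strictMonoOn_height x.2 y.2 hxy
  have hrange : range (J.domRestrict t) = t '' J := by
    ext y
    constructor
    · rintro ⟨x, rfl⟩; exact ⟨x, x.2, rfl⟩
    · rintro ⟨x, hx, rfl⟩; exact ⟨⟨x, hx⟩, rfl⟩
  have hoc : OrdConnected (range (J.domRestrict t)) := by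
    rw [hrange]
    exact (hp.ordConnected.isPreconnected.image _ hp.contDiffOn_height.continuousOn).ordConnected
  exact hmono.isEmbedding_of_ordConnected hoc

/-- The map `R` reads off the logarithm of the modulus in the half-plane, which is the sweep
parameter, and the height, which is strictly increasing along the profile. So `R ∘ X` is `id × t`,
an embedding, and `X` inherits this. -/
theorem isEmbedding_sweepParam (hp : IsMinimalProfile v t t₁ h J) (hf : IsFrame q₁ q₂ a) :
    IsEmbedding ((univ ×ˢ J : Set (ℝ × ℝ)).domRestrict (sweepParam q₂ a v t)) := by
  set U : Set (ℝ × ℝ) := univ ×ˢ J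
  have hXU : ∀ u : U, sweepParam q₂ a v t u ∈ space := fun u =>
    ⟨hf.halfPlaneToDisk_mem (hp.im_pos_exp_mul u.2.2), mem_univ _⟩
  have hcont : Continuous (U.domRestrict (sweepParam q₂ a v t)) :=
    (hp.contDiffOn_sweepParam hf).continuousOn.domRestrict
  set X : U → space := fun u => ⟨sweepParam q₂ a v t u, hXU u⟩ with hX
  have hXc : Continuous X := hcont.subtype_mk _
  set R : space → ℝ × ℝ := fun p => (Real.log ‖diskToHalfPlane q₁ q₂ a p.1.1‖, p.1.2) with hR
  have hRc : Continuous R := by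
    refine Continuous.prodMk ?_ (continuous_snd.comp continuous_subtype_val)
    refine Continuous.log ?_ fun p => norm_ne_zero_iff.mpr (hf.diskToHalfPlane_ne_zero p.2.1)
    refine Continuous.norm ?_
    exact hf.continuousOn_diskToHalfPlane.comp_continuous
      (continuous_fst.comp continuous_subtype_val) fun p => p.2.1
  have hRX : IsEmbedding (R ∘ X) := by
    set j : U → ℝ × J := fun u => (u.1.1, ⟨u.1.2, u.2.2⟩) with hj
    have hjc : Continuous j := by fun_prop
    have hje : IsEmbedding j := by
      refine IsEmbedding.of_comp hjc
        (g := Prod.map id Subtype.val) (by fun_prop) ?_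
      exact IsEmbedding.subtypeVal
    have heq : R ∘ X = Prod.map id (J.domRestrict t) ∘ j := by
      funext u
      refine Prod.ext ?_ rfl
      change Real.log ‖diskToHalfPlane q₁ q₂ a (halfPlaneToDisk q₂ a _)‖ = u.1.1
      rw [hf.diskToHalfPlane_halfPlaneToDisk
        (hf.sub_conj_base_ne_zero (hp.im_pos_exp_mul u.2.2).le), norm_mul,
        hp.norm_eq _ u.2.2, Complex.norm_real, Real.norm_of_nonneg (Real.exp_pos _).le, mul_one,
        Real.log_exp]
    rw [heq]
    exact (IsEmbedding.id.prodMap hp.isEmbedding_restrict_height).comp hje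
  exact IsEmbedding.subtypeVal.comp (IsEmbedding.of_comp hXc hRc hRX)

theorem isEmbeddedMinimal_swept (hp : IsMinimalProfile v t t₁ h J) (hf : IsFrame q₁ q₂ a) :
    IsEmbeddedMinimal (swept q₂ a v t J) := by
  refine ⟨hf.swept_subset_space hp.im_pos, fun p _ => ?_⟩
  refine ⟨sweepParam q₂ a v t, univ ×ˢ J, univ, isOpen_univ.prod hp.isOpen, isOpen_univ,
    mem_univ _, ?_, hp.contDiffOn_sweepParam hf, hp.isEmbedding_sweepParam hf,
    fun w hw => ⟨hp.injective_fderiv hf hw.2, hp.zeroMeanCurvatureAt hf hw.2⟩⟩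
  rw [inter_univ, swept_eq_image_sweepParam]

theorem isCompleteProperlyEmbeddedMinimal_swept (hp : IsMinimalProfile v t t₁ h J)
    (hf : IsFrame q₁ q₂ a) (hJ : J.Nonempty)
    (hcl : closure (swept q₂ a v t J) ∩ space ⊆ swept q₂ a v t J) :
    IsCompleteProperlyEmbeddedMinimal (swept q₂ a v t J) where
  connected := hf.isConnected_swept ⟨hJ, hp.ordConnected.isPreconnected⟩
    hp.contDiffOn_curve.continuousOn hp.contDiffOn_height.continuousOn hp.norm_eq
    fun s hs => (hp.im_pos s hs).le
  embedded_minimal := hp.isEmbeddedMinimal_swept hf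
  proper := isProperIn_of_closure_inter_subset hcl
  complete := (hp.isEmbeddedMinimal_swept hf).isIntrinsicallyComplete hcl

end IsMinimalProfile

end

section

/-! ### The height functions as complete elliptic integrals -/

/-- The integral of `1 / √(1 - e² cos² p)` from `0` to `x`. -/
noncomputable def ellipticInt (e x : ℝ) : ℝ :=
  ∫ p in (0 : ℝ)..x, (√(1 - e ^ 2 * Real.cos p ^ 2))⁻¹

variable {e : ℝ}

theorem radicand_pos (he : e ∈ Ico (0 : ℝ) 1) (p : ℝ) : 0 < 1 - e ^ 2 * Real.cos p ^ 2 := by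
  have h1 := Real.cos_sq_le_one p
  have h2 : e ^ 2 < 1 := by nlinarith [he.1, he.2]
  nlinarith [sq_nonneg e, sq_nonneg (Real.cos p)]

theorem contDiff_sqrt_radicand (he : e ∈ Ico (0 : ℝ) 1) :
    ContDiff ℝ ∞ fun p => √(1 - e ^ 2 * Real.cos p ^ 2) :=
  ContDiff.sqrt (by fun_prop) fun p => (radicand_pos he p).ne'

theorem contDiff_integrand (he : e ∈ Ico (0 : ℝ) 1) :
    ContDiff ℝ ∞ fun p => (√(1 - e ^ 2 * Real.cos p ^ 2))⁻¹ :=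
  (contDiff_sqrt_radicand he).inv fun p => (Real.sqrt_pos.mpr (radicand_pos he p)).ne'

theorem hasDerivAt_ellipticInt (he : e ∈ Ico (0 : ℝ) 1) (x : ℝ) :
    HasDerivAt (ellipticInt e) (√(1 - e ^ 2 * Real.cos x ^ 2))⁻¹ x :=
  (contDiff_integrand he).continuous.integral_hasStrictDerivAt 0 x |>.hasDerivAt

theorem contDiff_ellipticInt (he : e ∈ Ico (0 : ℝ) 1) : ContDiff ℝ ∞ (ellipticInt e) := by
  rw [contDiff_infty_iff_deriv]
  refine ⟨fun x => (hasDerivAt_ellipticInt he x).differentiableAt, ?_⟩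
  have : deriv (ellipticInt e) = fun p => (√(1 - e ^ 2 * Real.cos p ^ 2))⁻¹ :=
    funext fun x => (hasDerivAt_ellipticInt he x).deriv
  rw [this]
  exact contDiff_integrand he

theorem ellipticInt_zero (e : ℝ) : ellipticInt e 0 = 0 := by simp [ellipticInt]

theorem ellipticInt_neg (e x : ℝ) : ellipticInt e (-x) = -ellipticInt e x := by
  have := intervalIntegral.integral_comp_neg (a := 0) (b := x)
    fun p => (√(1 - e ^ 2 * Real.cos p ^ 2))⁻¹
  simp only [Real.cos_neg, neg_zero] at this
  rw [ellipticInt, ellipticInt, this, intervalIntegral.integral_symm]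

theorem strictMono_ellipticInt (he : e ∈ Ico (0 : ℝ) 1) : StrictMono (ellipticInt e) :=
  strictMono_of_hasDerivAt_pos (hasDerivAt_ellipticInt he)
    fun x => inv_pos.mpr (Real.sqrt_pos.mpr (radicand_pos he x))

theorem ellipticInt_pos (he : e ∈ Ico (0 : ℝ) 1) {x : ℝ} (hx : 0 < x) : 0 < ellipticInt e x := by
  rw [← ellipticInt_zero e]
  exact strictMono_ellipticInt he hx

theorem ellipticInt_mono {e' : ℝ} (he : 0 ≤ e) (hee : e ≤ e') (he' : e' < 1) {x : ℝ} (hx : 0 ≤ x) :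
    ellipticInt e x ≤ ellipticInt e' x := by
  have h1 : e ∈ Ico (0 : ℝ) 1 := ⟨he, hee.trans_lt he'⟩
  have h2 : e' ∈ Ico (0 : ℝ) 1 := ⟨he.trans hee, he'⟩
  refine intervalIntegral.integral_mono_on hx
    ((contDiff_integrand h1).continuous.intervalIntegrable _ _)
    ((contDiff_integrand h2).continuous.intervalIntegrable _ _) fun p _ => ?_
  have := Real.sqrt_pos.mpr (radicand_pos h2 p)
  gcongr

theorem le_ellipticInt (he : e ∈ Ico (0 : ℝ) 1) {x : ℝ} (hx : 0 ≤ x) : x ≤ ellipticInt e x := by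
  have h := ellipticInt_mono le_rfl he.1 he.2 hx
  have h0 : ellipticInt 0 x = x := by simp [ellipticInt]
  rwa [h0] at h

theorem ellipticInt_le (he : e ∈ Ico (0 : ℝ) 1) {x : ℝ} (hx : 0 ≤ x) :
    ellipticInt e x ≤ x * (√(1 - e ^ 2))⁻¹ := by
  have h : ellipticInt e x ≤ ∫ _ in (0 : ℝ)..x, (√(1 - e ^ 2))⁻¹ := by
    refine intervalIntegral.integral_mono_on hx
      ((contDiff_integrand he).continuous.intervalIntegrable _ _)
      intervalIntegrable_const fun p _ => ?_
    have h2 : 0 < 1 - e ^ 2 := by nlinarith [he.1, he.2]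
    have := Real.sqrt_pos.mpr h2
    gcongr
    nlinarith [Real.cos_sq_le_one p, sq_nonneg e]
  simpa using h

/-- With `δ = √(1 - e²)` one has `1 - e² cos² p = δ² + e² sin² p ≤ (δ + p)²`, so the integrand
dominates `1 / (δ + p)`. The resulting bound diverges as `e → 1`. -/
theorem log_le_ellipticInt (he : e ∈ Ico (0 : ℝ) 1) {x : ℝ} (hx : 0 ≤ x) :
    Real.log ((√(1 - e ^ 2) + x) / √(1 - e ^ 2)) ≤ ellipticInt e x := by
  have h2 : 0 < 1 - e ^ 2 := by nlinarith [he.1, he.2]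
  have hδ := Real.sqrt_pos.mpr h2
  set δ := √(1 - e ^ 2) with hδdef
  have hint : ∫ p in (0 : ℝ)..x, (δ + p)⁻¹ = Real.log ((δ + x) / δ) := by
    rw [intervalIntegral.integral_comp_add_left (fun p => p⁻¹) δ, add_zero,
      integral_inv_of_pos hδ (by linarith)]
  rw [← hint]
  have hpos : ∀ p ∈ Icc 0 x, 0 < δ + p := fun p hp => by linarith [hp.1]
  refine intervalIntegral.integral_mono_on hx ?_
    ((contDiff_integrand he).continuous.intervalIntegrable _ _) fun p hp => ?_
  · apply ContinuousOn.intervalIntegrable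
    rw [uIcc_of_le hx]
    exact ContinuousOn.inv₀ (by fun_prop) fun p hp => (hpos p hp).ne'
  · have h3 := Real.sqrt_pos.mpr (radicand_pos he p)
    apply inv_anti₀ h3
    apply Real.sqrt_le_iff.mpr ⟨(hpos p hp).le, ?_⟩
    have h4 : δ ^ 2 = 1 - e ^ 2 := Real.sq_sqrt h2.le
    have h5 := Real.sin_sq_add_cos_sq p
    have h6 : Real.sin p ^ 2 ≤ p ^ 2 := by
      have := Real.abs_sin_le_abs (x := p)
      exact sq_le_sq.mpr this
    nlinarith [mul_nonneg hδ.le hp.1, mul_nonneg (sq_nonneg e) (sq_nonneg (Real.sin p)),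
      sq_nonneg (Real.sin p), he.1, he.2]

theorem tendsto_sqrt_one_sub_sq : Tendsto (fun e : ℝ => √(1 - e ^ 2)) (𝓝[<] 1) (𝓝[>] 0) := by
  refine tendsto_nhdsWithin_iff.mpr ⟨?_, ?_⟩
  · have : Continuous fun e : ℝ => √(1 - e ^ 2) := by fun_prop
    have h := this.tendsto 1
    norm_num at h
    exact h.mono_left nhdsWithin_le_nhds
  · filter_upwards [Ioo_mem_nhdsLT (zero_lt_one (α := ℝ))] with e he
    exact Real.sqrt_pos.mpr (by nlinarith [he.1, he.2])

theorem tendsto_ellipticInt_atTop :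
    Tendsto (fun e => ellipticInt e (Real.pi / 2)) (𝓝[<] 1) atTop := by
  have hpi : 0 < Real.pi / 2 := by positivity
  have h1 : Tendsto (fun δ : ℝ => Real.log ((δ + Real.pi / 2) / δ)) (𝓝[>] 0) atTop := by
    refine Real.tendsto_log_atTop.comp ?_
    refine tendsto_atTop_mono' _ (f₁ := fun δ : ℝ => Real.pi / 2 * δ⁻¹) ?_
      (Tendsto.const_mul_atTop hpi tendsto_inv_nhdsGT_zero)
    filter_upwards [self_mem_nhdsWithin] with δ hδ
    have : (0 : ℝ) < δ := hδ
    rw [div_eq_mul_inv]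
    exact mul_le_mul_of_nonneg_right (by linarith) (inv_nonneg.mpr this.le)
  refine tendsto_atTop_mono' _ ?_ (h1.comp tendsto_sqrt_one_sub_sq)
  filter_upwards [Ioo_mem_nhdsLT (zero_lt_one (α := ℝ))] with e he
  exact log_le_ellipticInt ⟨he.1.le, he.2⟩ hpi.le

/-! ### The height function for `d > 1` -/

section Large

variable {d : ℝ}

theorem inv_mem_Ico (hd : 1 < d) : d⁻¹ ∈ Ico (0 : ℝ) 1 :=
  ⟨by positivity, inv_lt_one_of_one_lt₀ hd⟩

/-- Substituting `cos p = d / cosh u` gives the elliptic integrand with modulus `d⁻¹`. The singular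
end point `u = arcosh d` becomes `p = 0`, where that integrand is smooth, and `u = ∞` becomes `p =
π/2`. -/
theorem hasDerivAt_height_large (hd : 1 < d) {u : ℝ} (hu : u ∈ Ioi (Real.arcosh d)) :
    HasDerivAt (fun u => ellipticInt d⁻¹ (Real.arccos (d / Real.cosh u)))
      (heightIntegrand d u) u := by
  have hu0 : 0 < u := (Real.arcosh_nonneg hd.le).trans_lt hu
  have hcosh : d < Real.cosh u := by
    have habs : |Real.arcosh d| < |u| := by
      rw [abs_of_nonneg (Real.arcosh_nonneg hd.le), abs_of_pos hu0]; exact hu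
    have := Real.cosh_lt_cosh.mpr habs
    rwa [Real.cosh_arcosh hd.le] at this
  have hc0 := Real.cosh_pos u
  have hs0 := Real.sinh_pos_iff.mpr hu0
  have hy1 : d / Real.cosh u < 1 := (div_lt_one hc0).mpr hcosh
  have hy0 : 0 < d / Real.cosh u := by positivity
  have h1 : HasDerivAt (fun u => d / Real.cosh u) (-(d * Real.sinh u) / Real.cosh u ^ 2) u := by
    refine ((hasDerivAt_const u d).div (Real.hasDerivAt_cosh u) hc0.ne').congr_deriv ?_
    ring
  have h2 := (Real.hasDerivAt_arccos (by linarith : d / Real.cosh u ≠ -1) hy1.ne).comp u h1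
  have h3 := (hasDerivAt_ellipticInt (inv_mem_Ico hd) (Real.arccos (d / Real.cosh u))).comp u h2
  refine h3.congr_deriv ?_
  rw [Real.cos_arccos (by linarith) hy1.le, heightIntegrand]
  have hsq := Real.cosh_sq u
  have e1 : √(1 - d⁻¹ ^ 2 * (d / Real.cosh u) ^ 2) = Real.sinh u / Real.cosh u := by
    rw [Real.sqrt_eq_iff_mul_self_eq (by
      have : d⁻¹ ^ 2 * (d / Real.cosh u) ^ 2 = 1 / Real.cosh u ^ 2 := by field_simp
      rw [this, sub_nonneg, div_le_one (by positivity)]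
      nlinarith [Real.one_le_cosh u]) (by positivity)]
    field_simp
    linarith
  have e2 : √(1 - (d / Real.cosh u) ^ 2) = √(Real.cosh u ^ 2 - d ^ 2) / Real.cosh u := by
    rw [show 1 - (d / Real.cosh u) ^ 2 = (Real.cosh u ^ 2 - d ^ 2) / Real.cosh u ^ 2 by
      field_simp, Real.sqrt_div' _ (by positivity), Real.sqrt_sq hc0.le]
  rw [e1, e2]
  have : √(Real.cosh u ^ 2 - d ^ 2) ≠ 0 := (Real.sqrt_pos.mpr (by nlinarith)).ne'
  field_simp

theorem tendsto_height_large (hd : 1 < d) :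
    Tendsto (fun u => ellipticInt d⁻¹ (Real.arccos (d / Real.cosh u))) atTop
      (𝓝 (ellipticInt d⁻¹ (Real.pi / 2))) := by
  rw [← Real.arccos_zero]
  have hc : Tendsto Real.cosh atTop atTop := by
    refine tendsto_atTop_mono (fun u => ?_) (Real.tendsto_exp_atTop.const_mul_atTop
      (r := (1 / 2 : ℝ)) (by norm_num))
    rw [Real.cosh_eq]
    linarith [Real.exp_pos (-u)]
  have := (contDiff_ellipticInt (inv_mem_Ico hd)).continuous.comp Real.continuous_arccos
  exact (this.tendsto 0).comp (tendsto_const_nhds.div_atTop hc)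

theorem heightIntegrand_nonneg (hd : 0 < d) (u : ℝ) : 0 ≤ heightIntegrand d u :=
  div_nonneg hd.le (Real.sqrt_nonneg _)

theorem continuous_height_large (hd : 1 < d) :
    Continuous fun u => ellipticInt d⁻¹ (Real.arccos (d / Real.cosh u)) := by
  refine (contDiff_ellipticInt (inv_mem_Ico hd)).continuous.comp (Real.continuous_arccos.comp ?_)
  exact continuous_const.div Real.continuous_cosh fun u => (Real.cosh_pos u).ne'

theorem integrableOn_heightIntegrand_large (hd : 1 < d) :
    IntegrableOn (heightIntegrand d) (Ioi (Real.arcosh d)) :=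
  integrableOn_Ioi_deriv_of_nonneg (continuous_height_large hd).continuousWithinAt
    (fun _ hu => hasDerivAt_height_large hd hu) (fun u _ => heightIntegrand_nonneg (by linarith) u)
    (tendsto_height_large hd)

theorem H_eq (hd : 1 < d) : H d = ellipticInt d⁻¹ (Real.pi / 2) := by
  rw [H, integral_Ioi_of_hasDerivAt_of_nonneg (continuous_height_large hd).continuousWithinAt
    (fun _ hu => hasDerivAt_height_large hd hu) (fun u _ => heightIntegrand_nonneg (by linarith) u)
    (tendsto_height_large hd), Real.cosh_arcosh hd.le, div_self (by linarith), Real.arccos_one,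
    ellipticInt_zero, sub_zero]

theorem H_pos (hd : 1 < d) : 0 < H d := by
  rw [H_eq hd]
  exact ellipticInt_pos (inv_mem_Ico hd) (by positivity)

theorem antitoneOn_H : AntitoneOn H (Ioi 1) := by
  intro d hd d' hd' hdd
  rw [H_eq hd, H_eq hd']
  have h0 : (0 : ℝ) < d := lt_trans zero_lt_one hd
  exact ellipticInt_mono (inv_mem_Ico hd').1 (by gcongr) (inv_mem_Ico hd).2 (by positivity)

theorem tendsto_H_nhdsGT_one : Tendsto H (𝓝[>] 1) atTop := by
  have h1 : Tendsto (fun d : ℝ => d⁻¹) (𝓝[>] 1) (𝓝[<] 1) := by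
    refine tendsto_nhdsWithin_iff.mpr ⟨?_, ?_⟩
    · have := (continuousAt_inv₀ (one_ne_zero (α := ℝ))).tendsto
      rw [inv_one] at this
      exact this.mono_left nhdsWithin_le_nhds
    · filter_upwards [self_mem_nhdsWithin] with d hd
      exact (inv_mem_Ico hd).2
  refine (tendsto_ellipticInt_atTop.comp h1).congr' ?_
  filter_upwards [self_mem_nhdsWithin] with d hd
  exact (H_eq hd).symm

/-- Squeeze: for modulus `e = d⁻¹` the integrand lies between `1` and `1 / √(1 - e²)`. -/
theorem tendsto_H_atTop : Tendsto H atTop (𝓝 (Real.pi / 2)) := by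
  have hpi : 0 ≤ Real.pi / 2 := by positivity
  have hup : Tendsto ((fun e : ℝ => Real.pi / 2 * (√(1 - e ^ 2))⁻¹) ∘ fun d => d⁻¹) atTop (𝓝 (Real.pi / 2)) := by
    have h1 : ContinuousAt (fun e : ℝ => Real.pi / 2 * (√(1 - e ^ 2))⁻¹) 0 := by
      refine continuousAt_const.mul (ContinuousAt.inv₀ (by fun_prop) (by norm_num))
    have h2 := h1.tendsto.comp (tendsto_inv_atTop_zero (𝕜 := ℝ))
    norm_num at h2
    exact h2
  refine tendsto_of_tendsto_of_tendsto_of_le_of_le' tendsto_const_nhds hup ?_ ?_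
  · filter_upwards [eventually_gt_atTop 1] with d hd
    rw [H_eq hd]
    exact le_ellipticInt (inv_mem_Ico hd) hpi
  · filter_upwards [eventually_gt_atTop 1] with d hd
    rw [H_eq hd]
    exact ellipticInt_le (inv_mem_Ico hd) hpi

end Large

/-! ### The height function for `0 < d < 1` -/

section Small

variable {d : ℝ}

/-- Here `g = arctan (sinh u)` is the angle at distance `u` from `γ`: it satisfies `cos g = 1 / cosh
u` and `dg = du / cosh u`. -/
theorem hasDerivAt_height_small (hd : d ∈ Ioo (0 : ℝ) 1) (u : ℝ) :
    HasDerivAt (fun u => d * ellipticInt d (Real.arctan (Real.sinh u)))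
      (heightIntegrand d u) u := by
  have he : d ∈ Ico (0 : ℝ) 1 := Ioo_subset_Ico_self hd
  have h1 := (Real.hasDerivAt_arctan (Real.sinh u)).comp u (Real.hasDerivAt_sinh u)
  have h2 := ((hasDerivAt_ellipticInt he (Real.arctan (Real.sinh u))).comp u h1).const_mul d
  refine h2.congr_deriv ?_
  have hc0 := Real.cosh_pos u
  have hsq := Real.cosh_sq u
  have hpos : 0 < Real.cosh u ^ 2 - d ^ 2 := by
    nlinarith [Real.one_le_cosh u, hd.1, hd.2]
  rw [heightIntegrand, Real.cos_sq_arctan, show 1 + Real.sinh u ^ 2 = Real.cosh u ^ 2 by linarith,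
    show 1 - d ^ 2 * (1 / Real.cosh u ^ 2) = (Real.cosh u ^ 2 - d ^ 2) / Real.cosh u ^ 2 by
      field_simp, Real.sqrt_div' _ (by positivity), Real.sqrt_sq hc0.le]
  have := (Real.sqrt_pos.mpr hpos).ne'
  field_simp

theorem tendsto_height_small (hd : d ∈ Ioo (0 : ℝ) 1) :
    Tendsto (fun u => d * ellipticInt d (Real.arctan (Real.sinh u))) atTop
      (𝓝 (d * ellipticInt d (Real.pi / 2))) := by
  have hs : Tendsto Real.sinh atTop atTop := Real.sinhOrderIso.tendsto_atTop
  have h1 := (Real.tendsto_arctan_atTop.mono_right nhdsWithin_le_nhds).comp hs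
  exact (((contDiff_ellipticInt (Ioo_subset_Ico_self hd)).continuous.tendsto _).comp h1).const_mul d

theorem integrableOn_heightIntegrand_small (hd : d ∈ Ioo (0 : ℝ) 1) :
    IntegrableOn (heightIntegrand d) (Ioi 0) :=
  integrableOn_Ioi_deriv_of_nonneg' (fun u _ => hasDerivAt_height_small hd u)
    (fun u _ => heightIntegrand_nonneg hd.1 u) (tendsto_height_small hd)

theorem G_eq (hd : d ∈ Ioo (0 : ℝ) 1) : G d = d * ellipticInt d (Real.pi / 2) := by
  rw [G, integral_Ioi_of_hasDerivAt_of_nonneg' (fun u _ => hasDerivAt_height_small hd u)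
    (fun u _ => heightIntegrand_nonneg hd.1 u) (tendsto_height_small hd)]
  simp [ellipticInt_zero]

theorem G_pos (hd : d ∈ Ioo (0 : ℝ) 1) : 0 < G d := by
  rw [G_eq hd]
  exact mul_pos hd.1 (ellipticInt_pos (Ioo_subset_Ico_self hd) (by positivity))

theorem monotoneOn_G : MonotoneOn G (Ioo 0 1) := by
  intro d hd d' hd' hdd
  rw [G_eq hd, G_eq hd']
  have hpi : 0 < Real.pi / 2 := by positivity
  have := ellipticInt_pos (Ioo_subset_Ico_self hd) hpi
  have := ellipticInt_mono hd.1.le hdd hd'.2 hpi.le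
  have := hd'.1
  gcongr

theorem tendsto_G_nhdsGT_zero : Tendsto G (𝓝[>] 0) (𝓝 0) := by
  have hpi : 0 < Real.pi / 2 := by positivity
  have hup : Tendsto (fun d : ℝ => d * (Real.pi / 2 * (√(1 - d ^ 2))⁻¹)) (𝓝[>] 0) (𝓝 0) := by
    have h1 : ContinuousAt (fun d : ℝ => d * (Real.pi / 2 * (√(1 - d ^ 2))⁻¹)) 0 :=
      continuousAt_id.mul (continuousAt_const.mul (ContinuousAt.inv₀ (by fun_prop) (by norm_num)))
    have h2 := h1.tendsto
    rw [zero_mul] at h2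
    exact h2.mono_left nhdsWithin_le_nhds
  refine tendsto_of_tendsto_of_tendsto_of_le_of_le' tendsto_const_nhds hup ?_ ?_
  · filter_upwards [Ioo_mem_nhdsGT (zero_lt_one (α := ℝ))] with d hd
    exact (G_pos hd).le
  · filter_upwards [Ioo_mem_nhdsGT (zero_lt_one (α := ℝ))] with d hd
    rw [G_eq hd]
    have := hd.1
    gcongr
    exact ellipticInt_le (Ioo_subset_Ico_self hd) hpi.le

theorem tendsto_G_nhdsLT_one : Tendsto G (𝓝[<] 1) atTop := by
  have h1 : Tendsto (fun d : ℝ => d) (𝓝[<] 1) (𝓝 1) := tendsto_id.mono_left nhdsWithin_le_nhds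
  refine (h1.pos_mul_atTop one_pos tendsto_ellipticInt_atTop).congr' ?_
  filter_upwards [Ioo_mem_nhdsLT (zero_lt_one (α := ℝ))] with d hd
  exact (G_eq hd).symm

end Small

end

section

/-! ### Winding numbers of singular chains -/

theorem fst_mem_unitSphere (p : cylinder) : p.1.1 ∈ Submonoid.unitSphere ℂ := p.2.1

/-- The projection of the cylinder to the circle. -/
noncomputable def cylinderToCircle : C(cylinder, Circle) where
  toFun p := ⟨p.1.1, fst_mem_unitSphere p⟩
  continuous_toFun := (continuous_fst.comp continuous_subtype_val).subtype_mk fst_mem_unitSphere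

theorem coe_cylinderToCircle (p : cylinder) : (cylinderToCircle p : ℂ) = p.1.1 := rfl

/-- The convex combination of the first vertex of a simplex and a point of it. -/
noncomputable def simplexContraction (n : ℕ) :
    C(unitInterval × stdSimplex ℝ (Fin (n + 1)), stdSimplex ℝ (Fin (n + 1))) where
  toFun p := ⟨(1 - (p.1 : ℝ)) • (stdSimplex.vertex (S := ℝ) (0 : Fin (n + 1))).1 +
      (p.1 : ℝ) • p.2.1,
    convex_stdSimplex ℝ _ (stdSimplex.vertex (0 : Fin (n + 1))).2 p.2.2
      (by linarith [p.1.2.2]) p.1.2.1 (by ring)⟩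
  continuous_toFun := by
    apply Continuous.subtype_mk
    fun_prop

/-- Contracting the simplex to a vertex and applying `f` gives a homotopy that starts at a constant
map. Its lift through the covering `Circle.exp` is evaluated at time `1`. -/
theorem exists_simplex_lift {n : ℕ} (f : C(stdSimplex ℝ (Fin (n + 1)), Circle)) :
    ∃ L : C(stdSimplex ℝ (Fin (n + 1)), ℝ), ∀ x, Circle.exp (L x) = f x := by
  obtain ⟨l, hl⟩ : ∃ l, Circle.exp l = f (stdSimplex.vertex 0) :=
    ⟨_, Circle.exp_arg _⟩
  have h0 : ∀ x : stdSimplex ℝ (Fin (n + 1)),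
      (f.comp (simplexContraction n)) (0, x) = Circle.exp (ContinuousMap.const _ l x) := by
    intro x
    simp only [ContinuousMap.comp_apply, ContinuousMap.const_apply, hl]
    congr 1
    apply Subtype.ext
    simp [simplexContraction]
  refine ⟨(Circle.isCoveringMap_exp.liftHomotopy (f.comp (simplexContraction n))
    (ContinuousMap.const _ l) h0).comp ((ContinuousMap.const _ 1).prodMk (ContinuousMap.id _)), ?_⟩
  intro x
  have := congrFun (Circle.isCoveringMap_exp.liftHomotopy_lifts
    (f.comp (simplexContraction n)) (ContinuousMap.const _ l) h0) (1, x)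
  refine Eq.trans this ?_
  simp only [ContinuousMap.comp_apply]
  congr 1
  apply Subtype.ext
  simp [simplexContraction]

/-- The variation of the argument along a singular `1`-simplex of the circle. -/
noncomputable def argVariation (f : C(stdSimplex ℝ (Fin 2), Circle)) : ℝ :=
  (exists_simplex_lift f).choose (stdSimplex.vertex 1) -
    (exists_simplex_lift f).choose (stdSimplex.vertex 0)

/-- Two lifts differ by a constant since the simplex is connected, so the variation does not depend
on the lift. -/
theorem argVariation_eq {f : C(stdSimplex ℝ (Fin 2), Circle)} {L : C(stdSimplex ℝ (Fin 2), ℝ)}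
    (hL : ∀ x, Circle.exp (L x) = f x) :
    argVariation f = L (stdSimplex.vertex 1) - L (stdSimplex.vertex 0) := by
  set L' := (exists_simplex_lift f).choose with hL'
  have hspec : ∀ x, Circle.exp (L' x) = f x := (exists_simplex_lift f).choose_spec
  set v₀ : stdSimplex ℝ (Fin 2) := stdSimplex.vertex 0
  set c := L' v₀ - L v₀ with hc
  have hexp : Circle.exp c = 1 := by
    rw [hc, Circle.exp_sub, hspec, hL, div_self']
  have : (L' : stdSimplex ℝ (Fin 2) → ℝ) = fun x => L x + c := by
    refine Circle.isCoveringMap_exp.eq_of_comp_eq L'.continuous (by fun_prop) ?_ v₀ (by simp [hc])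
    funext x
    simp only [Function.comp_apply, Circle.exp_add, hexp, mul_one, hspec, hL]
  have hx : ∀ x, L' x = L x + c := fun x => congrFun this x
  rw [argVariation, ← hL', hx, hx]
  ring

/-- The winding cochain of the cylinder. -/
noncomputable def windingCochain : SingularChain 1 cylinder →+ ℝ :=
  Finsupp.liftAddHom fun σ =>
    (AddMonoidHom.mulRight (argVariation (cylinderToCircle.comp σ))).comp (Int.castAddHom ℝ)

theorem windingCochain_single (σ : C(stdSimplex ℝ (Fin 2), cylinder)) (k : ℤ) :
    windingCochain (Finsupp.single σ k) = k * argVariation (cylinderToCircle.comp σ) := by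
  simp [windingCochain]

/-- One lift over a triangle restricts to lifts over its three faces, and the alternating sum of the
differences at the vertices cancels. -/
theorem windingCochain_singularBoundary (c : SingularChain 2 cylinder) :
    windingCochain (singularBoundary c) = 0 := by
  rw [singularBoundary, map_finsuppSum]
  refine Finset.sum_eq_zero fun σ _ => ?_
  obtain ⟨L, hL⟩ := exists_simplex_lift (cylinderToCircle.comp σ)
  have hface : ∀ i : Fin 3, argVariation (cylinderToCircle.comp (face i σ)) =
      L (stdSimplex.vertex (i.succAbove 1)) - L (stdSimplex.vertex (i.succAbove 0)) := by
    intro i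
    have := argVariation_eq (f := cylinderToCircle.comp (face i σ))
      (L := L.comp ⟨stdSimplex.map i.succAbove, stdSimplex.continuous_map i.succAbove⟩)
      fun x => hL _
    rw [this]
    simp
  simp only [map_sum, windingCochain_single, hface]
  change ∑ x : Fin 3, _ = (0 : ℝ)
  rw [Fin.sum_univ_three]
  have e1 : (0 : Fin 3).succAbove (0 : Fin 2) = 1 := rfl
  have e2 : (0 : Fin 3).succAbove (1 : Fin 2) = 2 := rfl
  have e3 : (1 : Fin 3).succAbove (0 : Fin 2) = 0 := rfl
  have e4 : (1 : Fin 3).succAbove (1 : Fin 2) = 2 := rfl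
  have e5 : (2 : Fin 3).succAbove (0 : Fin 2) = 0 := rfl
  have e6 : (2 : Fin 3).succAbove (1 : Fin 2) = 1 := rfl
  rw [e1, e2, e3, e4, e5, e6]
  push_cast
  simp
  ring

/-- The winding cochain takes the value `θ 1 - θ 0` on `γ`, and `0` on boundaries. -/
theorem singularBoundary_ne_of_lift {γ : C(unitInterval, cylinder)} {θ : C(unitInterval, ℝ)}
    (hθ : ∀ s, ((γ s).1.1 : ℂ) = Circle.exp (θ s)) (hne : θ 0 ≠ θ 1)
    (c : SingularChain 2 cylinder) : singularBoundary c ≠ Finsupp.single (pathSimplex γ) 1 := by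
  intro h
  have h1 := windingCochain_singularBoundary c
  rw [h, windingCochain_single] at h1
  have h2 := argVariation_eq (f := cylinderToCircle.comp (pathSimplex γ))
    (L := θ.comp ⟨stdSimplexHomeomorphUnitInterval, stdSimplexHomeomorphUnitInterval.continuous⟩)
    fun x => Circle.ext (by
      rw [ContinuousMap.comp_apply, ContinuousMap.comp_apply, coe_cylinderToCircle]
      exact (hθ _).symm)
  have e0 : stdSimplexHomeomorphUnitInterval (stdSimplex.vertex 0) = 0 :=
    stdSimplexHomeomorphUnitInterval_zero
  have e1 : stdSimplexHomeomorphUnitInterval (stdSimplex.vertex 1) = 1 :=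
    stdSimplexHomeomorphUnitInterval_one
  rw [h2] at h1
  simp only [ContinuousMap.comp_apply, ContinuousMap.coe_mk, e0, e1] at h1
  apply hne
  push_cast at h1
  linarith

/-! ### Loops that lift to the plane -/

/-- The cone with apex the origin over a path in a normed space. -/
noncomputable def coneSimplex {E : Type*} [NormedAddCommGroup E] [NormedSpace ℝ E]
    (f : C(unitInterval, E)) : C(stdSimplex ℝ (Fin 3), E) where
  toFun x := (1 - x 0) • f (projIcc 0 1 zero_le_one (x 2 / (1 - x 0)))
  continuous_toFun := by
    have hc : ∀ i : Fin 3, Continuous fun x : stdSimplex ℝ (Fin 3) => x i := fun i =>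
      (continuous_apply i).comp continuous_subtype_val
    rw [continuous_iff_continuousAt]
    intro x
    -- At the apex the argument of `f` has no limit, but `f` is bounded and the factor `1 - x 0`
    -- tends to `0`.
    by_cases hx : 1 - x 0 = 0
    · obtain ⟨C, hC⟩ := (isCompact_range f.continuous).isBounded.exists_norm_le
      have hb : ∀ y, ‖f y‖ ≤ C := fun y => hC _ ⟨y, rfl⟩
      rw [ContinuousAt, hx, zero_smul]
      refine squeeze_zero_norm (a := fun y : stdSimplex ℝ (Fin 3) => ‖1 - y 0‖ * C) (fun y => ?_) ?_
      · rw [norm_smul]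
        gcongr
        exact hb _
      · have : Continuous fun y : stdSimplex ℝ (Fin 3) => ‖1 - y 0‖ * C :=
          ((continuous_const.sub (hc 0)).norm).mul continuous_const
        simpa [hx] using this.tendsto x
    · have h1 : ContinuousAt (fun x : stdSimplex ℝ (Fin 3) => x 2 / (1 - x 0)) x :=
        (hc 2).continuousAt.div (continuous_const.sub (hc 0)).continuousAt hx
      exact (continuous_const.sub (hc 0)).continuousAt.smul
        ((f.continuous.comp continuous_projIcc).continuousAt.comp h1)

theorem stdSimplex_map_apply {m n : ℕ} (g : Fin m → Fin n) (x : stdSimplex ℝ (Fin m)) (j : Fin n) :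
    stdSimplex.map g x j = ∑ i, if g i = j then x i else 0 := by
  rw [stdSimplex.map_coe, FunOnFinite.linearMap_apply_apply]
  rw [Finset.sum_filter]

theorem coneSimplex_face_zero {E : Type*} [NormedAddCommGroup E] [NormedSpace ℝ E]
    (f : C(unitInterval, E)) (x : stdSimplex ℝ (Fin 2)) :
    coneSimplex f (stdSimplex.map (0 : Fin 3).succAbove x) =
      f (stdSimplexHomeomorphUnitInterval x) := by
  have e0 : stdSimplex.map (0 : Fin 3).succAbove x 0 = 0 := by
    rw [stdSimplex_map_apply]; simp [Fin.succAbove]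
  have e2 : stdSimplex.map (0 : Fin 3).succAbove x 2 = x 1 := by
    rw [stdSimplex_map_apply, Fin.sum_univ_two]; simp [Fin.succAbove]
  change (1 - stdSimplex.map (0 : Fin 3).succAbove x 0) • f (projIcc 0 1 zero_le_one
    (stdSimplex.map (0 : Fin 3).succAbove x 2 / (1 - stdSimplex.map (0 : Fin 3).succAbove x 0))) = _
  rw [e0, e2, sub_zero, one_smul, div_one]
  congr 1
  exact projIcc_of_mem zero_le_one (stdSimplexHomeomorphUnitInterval x).2

/-- These two faces are the segments from the apex to `f 1` and to `f 0`. -/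
theorem coneSimplex_face_one_eq_face_two {E : Type*} [NormedAddCommGroup E] [NormedSpace ℝ E]
    {f : C(unitInterval, E)} (hf : f 0 = f 1) (x : stdSimplex ℝ (Fin 2)) :
    coneSimplex f (stdSimplex.map (1 : Fin 3).succAbove x) =
      coneSimplex f (stdSimplex.map (2 : Fin 3).succAbove x) := by
  have e0 : stdSimplex.map (1 : Fin 3).succAbove x 0 = x 0 := by
    rw [stdSimplex_map_apply, Fin.sum_univ_two]; simp [Fin.succAbove]
  have e2 : stdSimplex.map (1 : Fin 3).succAbove x 2 = x 1 := by
    rw [stdSimplex_map_apply, Fin.sum_univ_two]; simp [Fin.succAbove]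
  have e0' : stdSimplex.map (2 : Fin 3).succAbove x 0 = x 0 := by
    rw [stdSimplex_map_apply, Fin.sum_univ_two]; simp [Fin.succAbove]
  have e2' : stdSimplex.map (2 : Fin 3).succAbove x 2 = 0 := by
    rw [stdSimplex_map_apply, Fin.sum_univ_two]; simp [Fin.succAbove]
  change (1 - stdSimplex.map (1 : Fin 3).succAbove x 0) • f (projIcc 0 1 zero_le_one
    (stdSimplex.map (1 : Fin 3).succAbove x 2 / (1 - stdSimplex.map (1 : Fin 3).succAbove x 0))) =
    (1 - stdSimplex.map (2 : Fin 3).succAbove x 0) • f (projIcc 0 1 zero_le_one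
    (stdSimplex.map (2 : Fin 3).succAbove x 2 / (1 - stdSimplex.map (2 : Fin 3).succAbove x 0)))
  rw [e0, e2, e0', e2', zero_div]
  have hx : x 0 + x 1 = 1 := stdSimplex.add_eq_one x
  by_cases h1 : x 1 = 0
  · have : 1 - x 0 = 0 := by linarith
    rw [this, zero_smul, zero_smul]
  · rw [show 1 - x 0 = x 1 by linarith, div_self h1]
    simp only [projIcc_left, projIcc_right]
    congr 1
    exact hf.symm

/-- The universal covering of the cylinder. -/
noncomputable def cylinderCover (m : ℂ) (hm : ‖m‖ = 1) : C(ℝ × ℝ, cylinder) where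
  toFun p := ⟨(m * Complex.exp (p.1 * Complex.I), p.2), by
    refine ⟨?_, mem_univ _⟩
    rw [idealBoundary, mem_sphere_zero_iff_norm, norm_mul, hm, Complex.norm_exp_ofReal_mul_I,
      mul_one]⟩
  continuous_toFun := by
    apply Continuous.subtype_mk
    fun_prop

/-- The boundary of the projected cone is `face 0 - face 1 + face 2`. The first term is the loop,
and the other two cancel because the lift is closed. -/
theorem exists_singularBoundary_eq_of_lift {m : ℂ} (hm : ‖m‖ = 1) {γ : C(unitInterval, cylinder)}
    {f : C(unitInterval, ℝ × ℝ)} (hf : ∀ s, cylinderCover m hm (f s) = γ s) (hf01 : f 0 = f 1) :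
    ∃ c : SingularChain 2 cylinder, singularBoundary c = Finsupp.single (pathSimplex γ) 1 := by
  set σ : C(stdSimplex ℝ (Fin 3), cylinder) := (cylinderCover m hm).comp (coneSimplex f) with hσ
  refine ⟨Finsupp.single σ 1, ?_⟩
  have h0 : face 0 σ = pathSimplex γ := by
    ext1 x
    change cylinderCover m hm (coneSimplex f (stdSimplex.map (0 : Fin 3).succAbove x)) = _
    rw [coneSimplex_face_zero, hf]
    rfl
  have h12 : face 1 σ = face 2 σ := by
    ext1 x
    change cylinderCover m hm (coneSimplex f (stdSimplex.map (1 : Fin 3).succAbove x)) =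
      cylinderCover m hm (coneSimplex f (stdSimplex.map (2 : Fin 3).succAbove x))
    rw [coneSimplex_face_one_eq_face_two hf01]
  rw [singularBoundary, Finsupp.sum_single_index (by simp), Fin.sum_univ_three, h0, h12]
  rw [add_assoc, ← Finsupp.single_add]
  simp

/-- Away from the vertical line over `-m` the principal argument of `z * conj m` is continuous. It
lifts every parametrization, and the lift closes up because it depends only on the point. -/
theorem isHomologousToZero_of_forall_ne {Γ : Set (ℂ × ℝ)} {m : ℂ} (hm : ‖m‖ = 1)
    (hΓ : ∀ p ∈ Γ, p.1 ≠ -m) : IsHomologousToZero Γ := by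
  rintro γ ⟨h01, -, hrange⟩
  have hmm : m * conj m = 1 := by
    rw [Complex.mul_conj, Complex.normSq_eq_norm_sq, hm]; simp
  have hn : ∀ s, ‖(γ s).1.1 * conj m‖ = 1 := by
    intro s
    have := (γ s).2.1
    rw [idealBoundary, mem_sphere_zero_iff_norm] at this
    rw [norm_mul, this, Complex.norm_conj, hm, mul_one]
  have hslit : ∀ s, (γ s).1.1 * conj m ∈ Complex.slitPlane := by
    intro s
    rw [Complex.mem_slitPlane_iff_arg]
    refine ⟨fun harg => ?_, fun h0 => by simpa [h0] using hn s⟩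
    have h1 := Complex.norm_mul_exp_arg_mul_I ((γ s).1.1 * conj m)
    rw [hn s, harg, Complex.exp_pi_mul_I] at h1
    apply hΓ (γ s) (hrange ▸ ⟨s, rfl⟩)
    push_cast at h1
    linear_combination (-m) * h1 - (γ s).1.1 * hmm
  set f : C(unitInterval, ℝ × ℝ) :=
    ⟨fun s => (Complex.arg ((γ s).1.1 * conj m), (γ s).1.2), by
      have hc : Continuous fun s => (γ s).1 := continuous_subtype_val.comp γ.continuous
      refine Continuous.prodMk ?_ (continuous_snd.comp hc)
      rw [continuous_iff_continuousAt]
      intro s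
      exact ContinuousAt.comp (f := fun s => (γ s).1.1 * conj m) (Complex.continuousAt_arg (hslit s))
        ((continuous_fst.comp hc).mul continuous_const).continuousAt⟩ with hf
  refine exists_singularBoundary_eq_of_lift hm (f := f) (fun s => ?_) ?_
  · apply Subtype.ext
    refine Prod.ext ?_ rfl
    change m * Complex.exp (Complex.arg ((γ s).1.1 * conj m) * Complex.I) = (γ s).1.1
    have h1 := Complex.norm_mul_exp_arg_mul_I ((γ s).1.1 * conj m)
    rw [hn s, Complex.ofReal_one, one_mul] at h1
    rw [h1]
    linear_combination (γ s).1.1 * hmm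
  · simp only [hf, ContinuousMap.coe_mk, h01]

end

section

/-! ### Polygonal Jordan curves of the cylinder -/

/-- The piecewise linear function that is `0` up to `k / 4` and `1` from `(k + 1) / 4` on. -/
noncomputable def ramp (k s : ℝ) : ℝ := max 0 (min 1 (4 * s - k))

theorem continuous_ramp (k : ℝ) : Continuous (ramp k) := by unfold ramp; fun_prop

theorem ramp_of_le {k s : ℝ} (h : 4 * s ≤ k) : ramp k s = 0 :=
  max_eq_left ((min_le_right _ _).trans (by linarith))

theorem ramp_of_ge {k s : ℝ} (h : k + 1 ≤ 4 * s) : ramp k s = 1 := by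
  rw [ramp, min_eq_left (by linarith), max_eq_right zero_le_one]

theorem ramp_of_mem {k s : ℝ} (h₁ : k ≤ 4 * s) (h₂ : 4 * s ≤ k + 1) : ramp k s = 4 * s - k := by
  rw [ramp, min_eq_right (by linarith), max_eq_right (by linarith)]

theorem ramp_cases {s : ℝ} (hs : s ∈ Icc (0 : ℝ) 1) :
    ∃ x ∈ Icc (0 : ℝ) 1,
      (4 * s = x ∧ ramp 0 s = x ∧ ramp 1 s = 0 ∧ ramp 2 s = 0 ∧ ramp 3 s = 0) ∨
      (4 * s = 1 + x ∧ ramp 0 s = 1 ∧ ramp 1 s = x ∧ ramp 2 s = 0 ∧ ramp 3 s = 0) ∨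
      (4 * s = 2 + x ∧ ramp 0 s = 1 ∧ ramp 1 s = 1 ∧ ramp 2 s = x ∧ ramp 3 s = 0) ∨
      (4 * s = 3 + x ∧ ramp 0 s = 1 ∧ ramp 1 s = 1 ∧ ramp 2 s = 1 ∧ ramp 3 s = x) := by
  obtain ⟨h0, h1⟩ := hs
  rcases le_total (4 * s) 1 with ha | ha
  · refine ⟨4 * s, ⟨by linarith, ha⟩, Or.inl ⟨rfl, ?_, ?_, ?_, ?_⟩⟩
    · rw [ramp_of_mem (by linarith) (by linarith), sub_zero]
    all_goals exact ramp_of_le (by linarith)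
  rcases le_total (4 * s) 2 with hb | hb
  · refine ⟨4 * s - 1, ⟨by linarith, by linarith⟩, Or.inr (Or.inl ⟨by ring, ?_, ?_, ?_, ?_⟩)⟩
    · exact ramp_of_ge (by linarith)
    · exact ramp_of_mem (by linarith) (by linarith)
    all_goals exact ramp_of_le (by linarith)
  rcases le_total (4 * s) 3 with hc | hc
  · refine ⟨4 * s - 2, ⟨by linarith, by linarith⟩,
      Or.inr (Or.inr (Or.inl ⟨by ring, ?_, ?_, ?_, ?_⟩))⟩
    · exact ramp_of_ge (by linarith)
    · exact ramp_of_ge (by linarith)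
    · exact ramp_of_mem (by linarith) (by linarith)
    · exact ramp_of_le (by linarith)
  · refine ⟨4 * s - 3, ⟨by linarith, by linarith⟩,
      Or.inr (Or.inr (Or.inr ⟨by ring, ?_, ?_, ?_, ?_⟩))⟩
    · exact ramp_of_ge (by linarith)
    · exact ramp_of_ge (by linarith)
    · exact ramp_of_ge (by linarith)
    · exact ramp_of_mem (by linarith) (by linarith)

section Polygon

variable {φ μ K : ℝ}

/-- The angular coordinate of the polygonal curve. -/
noncomputable def polygonAngle (φ μ s : ℝ) : ℝ := φ * ramp 1 s + μ * ramp 3 s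

/-- The height of the polygonal curve. -/
noncomputable def polygonHeight (K s : ℝ) : ℝ := -K + 2 * K * ramp 0 s - 2 * K * ramp 2 s

/-- Four sides: up at angle `0`, across at height `K`, down at angle `φ`, across at height `-K` to
the angle `φ + μ`. With `μ = -φ` the polygon is a closed rectangle; with `μ = 2π - φ` it ends one
full turn from its start. -/
theorem polygon_cases (φ μ K : ℝ) {s : ℝ} (hs : s ∈ Icc (0 : ℝ) 1) :
    ∃ x ∈ Icc (0 : ℝ) 1,
      (4 * s = x ∧ polygonAngle φ μ s = 0 ∧ polygonHeight K s = -K + 2 * K * x) ∨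
      (4 * s = 1 + x ∧ polygonAngle φ μ s = φ * x ∧ polygonHeight K s = K) ∨
      (4 * s = 2 + x ∧ polygonAngle φ μ s = φ ∧ polygonHeight K s = K - 2 * K * x) ∨
      (4 * s = 3 + x ∧ polygonAngle φ μ s = φ + μ * x ∧ polygonHeight K s = -K) := by
  obtain ⟨x, hx, h⟩ := ramp_cases hs
  refine ⟨x, hx, ?_⟩
  unfold polygonAngle polygonHeight
  rcases h with ⟨h, h0, h1, h2, h3⟩ | ⟨h, h0, h1, h2, h3⟩ | ⟨h, h0, h1, h2, h3⟩ |
    ⟨h, h0, h1, h2, h3⟩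
  · exact Or.inl ⟨h, by rw [h1, h3]; ring, by rw [h0, h2]; ring⟩
  · exact Or.inr (Or.inl ⟨h, by rw [h1, h3]; ring, by rw [h0, h2]; ring⟩)
  · exact Or.inr (Or.inr (Or.inl ⟨h, by rw [h1, h3]; ring, by rw [h0, h2]; ring⟩))
  · exact Or.inr (Or.inr (Or.inr ⟨h, by rw [h1, h3]; ring, by rw [h0, h2]; ring⟩))

theorem polygon_injective (hφ : 0 < φ) (hK : 0 < K) (hμ : 0 < μ ∨ μ = -φ) {s s' : ℝ}
    (hs : s ∈ Icc (0 : ℝ) 1) (hs' : s' ∈ Icc (0 : ℝ) 1) (hle : s ≤ s')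
    (ha : polygonAngle φ μ s = polygonAngle φ μ s') (hh : polygonHeight K s = polygonHeight K s') :
    s = s' ∨ (s = 0 ∧ s' = 1) := by
  obtain ⟨x, ⟨hx0, hx1⟩, h⟩ := polygon_cases φ μ K hs
  obtain ⟨y, ⟨hy0, hy1⟩, h'⟩ := polygon_cases φ μ K hs'
  have cancel : ∀ {c u w : ℝ}, 0 < c → c * u = c * w → u = w := fun hc h =>
    mul_left_cancel₀ hc.ne' h
  have hμ0 : μ ≠ 0 := by
    rcases hμ with h | h
    · exact h.ne'
    · rw [h]; linarith
  rcases h with ⟨h, h1, h2⟩ | ⟨h, h1, h2⟩ | ⟨h, h1, h2⟩ | ⟨h, h1, h2⟩ <;>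
  rcases h' with ⟨h', h1', h2'⟩ | ⟨h', h1', h2'⟩ | ⟨h', h1', h2'⟩ | ⟨h', h1', h2'⟩ <;>
  rw [h1, h1'] at ha <;> rw [h2, h2'] at hh
  · left; linarith [cancel hK (u := x) (w := y) (by linarith)]
  · left; linarith [cancel hK (u := x) (w := 1) (by linarith),
      cancel hφ (u := y) (w := 0) (by linarith)]
  · linarith
  · have hx := cancel hK (u := x) (w := 0) (by linarith)
    rcases hμ with hμ | hμ
    · nlinarith
    · rw [hμ] at ha
      have hy := cancel hφ (u := y) (w := 1) (by linarith)
      right; constructor <;> linarith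
  · left; linarith
  · left; linarith [cancel hφ ha]
  · left; linarith [cancel hK (u := y) (w := 0) (by linarith),
      cancel hφ (u := x) (w := 1) (by linarith)]
  · linarith
  · linarith
  · left; linarith
  · left; linarith [cancel hK (u := x) (w := y) (by linarith)]
  · have hx := cancel hK (u := x) (w := 1) (by linarith)
    have hy : y = 0 := by
      rcases mul_eq_zero.mp (by linarith : μ * y = 0) with h0 | h0
      · exact absurd h0 hμ0
      · exact h0
    left; linarith
  · left; linarith
  · left; linarith
  · left; linarith
  · left; linarith [mul_left_cancel₀ hμ0 (by linarith : μ * x = μ * y)]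

/-- The polygonal curve on the cylinder. -/
noncomputable def polygonCurve (q : ℂ) (hq : ‖q‖ = 1) (φ μ K : ℝ) : C(unitInterval, cylinder) :=
  (cylinderCover q hq).comp ⟨fun s => (polygonAngle φ μ s, polygonHeight K s), by
    unfold polygonAngle polygonHeight
    have h := fun k => (continuous_ramp k).comp (continuous_subtype_val (p := (· ∈ Icc (0 : ℝ) 1)))
    have h0 := h 0
    have h1 := h 1
    have h2 := h 2
    have h3 := h 3
    simp only [Function.comp_def] at h0 h1 h2 h3
    fun_prop⟩

theorem polygonCurve_coe (q : ℂ) (hq : ‖q‖ = 1) (φ μ K : ℝ) (s : unitInterval) :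
    (polygonCurve q hq φ μ K s : ℂ × ℝ) =
      (q * Complex.exp (polygonAngle φ μ s * Complex.I), polygonHeight K s) := rfl

theorem polygon_zero (φ μ K : ℝ) : polygonAngle φ μ 0 = 0 ∧ polygonHeight K 0 = -K := by
  unfold polygonAngle polygonHeight
  rw [ramp_of_le (by norm_num), ramp_of_le (by norm_num), ramp_of_le (by norm_num),
    ramp_of_le (by norm_num)]
  constructor <;> ring

theorem polygon_one (φ μ K : ℝ) : polygonAngle φ μ 1 = φ + μ ∧ polygonHeight K 1 = -K := by
  unfold polygonAngle polygonHeight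
  rw [ramp_of_ge (by norm_num), ramp_of_ge (by norm_num), ramp_of_ge (by norm_num),
    ramp_of_ge (by norm_num)]
  constructor <;> ring

theorem range_polygonCurve (q : ℂ) (hq : ‖q‖ = 1) (φ μ : ℝ) (hφ : 0 < φ) (hμ0 : μ ≠ 0) (hK : 0 < K) :
    range (fun s => (polygonCurve q hq φ μ K s : ℂ × ℝ)) =
      {q} ×ˢ Icc (-K) K ∪ ((fun x : ℝ => q * Complex.exp (x * Complex.I)) '' Icc 0 φ) ×ˢ {K} ∪
        {q * Complex.exp (φ * Complex.I)} ×ˢ Icc (-K) K ∪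
        ((fun x : ℝ => q * Complex.exp (x * Complex.I)) '' uIcc φ (φ + μ)) ×ˢ {-K} := by
  have hval : ∀ {s : ℝ} (hs : s ∈ Icc (0 : ℝ) 1) {θ t : ℝ}, polygonAngle φ μ s = θ →
      polygonHeight K s = t → (q * Complex.exp (θ * Complex.I), t) ∈
        range (fun s => (polygonCurve q hq φ μ K s : ℂ × ℝ)) := by
    rintro s hs _ _ rfl rfl
    exact ⟨⟨s, hs⟩, rfl⟩
  ext p
  constructor
  · rintro ⟨⟨s, hs⟩, rfl⟩
    simp only [polygonCurve_coe]
    obtain ⟨x, ⟨hx0, hx1⟩, ⟨h, h1, h2⟩ | ⟨h, h1, h2⟩ | ⟨h, h1, h2⟩ | ⟨h, h1, h2⟩⟩ :=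
      polygon_cases φ μ K hs
    · refine Or.inl (Or.inl (Or.inl ⟨?_, ?_⟩))
      · simp [h1]
      · rw [h2]; constructor <;> nlinarith
    · refine Or.inl (Or.inl (Or.inr ⟨⟨φ * x, ⟨by positivity, by nlinarith⟩, ?_⟩, ?_⟩))
      · simp [h1]
      · simp [h2]
    · refine Or.inl (Or.inr ⟨?_, ?_⟩)
      · simp [h1]
      · rw [h2]; constructor <;> nlinarith
    · refine Or.inr ⟨⟨φ + μ * x, ?_, ?_⟩, ?_⟩
      · rw [mem_uIcc]
        rcases lt_or_gt_of_ne hμ0 with hm | hm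
        · right; constructor <;> nlinarith
        · left; constructor <;> nlinarith
      · simp [h1]
      · simp [h2]
  · obtain ⟨z, t⟩ := p
    rintro (((⟨hz, ht⟩ | ⟨⟨x, hx, hz⟩, ht⟩) | ⟨hz, ht⟩) | ⟨⟨x, hx, hz⟩, ht⟩)
    · simp only [mem_singleton_iff] at hz ht
      have h := hval (s := (t + K) / (8 * K)) ⟨div_nonneg (by linarith [ht.1]) (by linarith),
        by rw [div_le_one (by linarith)]; linarith [ht.2]⟩ (θ := 0) (t := t) ?_ ?_
      · simpa [hz] using h
      all_goals
        have h4 : 4 * ((t + K) / (8 * K)) = (t + K) / (2 * K) := by field_simp; ring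
        have h5 : (t + K) / (2 * K) ≤ 1 := by
          rw [div_le_one (by linarith)]; linarith [ht.2]
        have h6 : 0 ≤ (t + K) / (2 * K) := div_nonneg (by linarith [ht.1]) (by linarith)
      · unfold polygonAngle
        rw [ramp_of_le (by linarith), ramp_of_le (by linarith)]; ring
      · unfold polygonHeight
        rw [ramp_of_mem (by linarith) (by linarith), ramp_of_le (by linarith), h4]
        field_simp; ring
    · simp only [mem_singleton_iff] at hz ht
      have h5 : x / φ ≤ 1 := by rw [div_le_one hφ]; exact hx.2
      have h6 : 0 ≤ x / φ := div_nonneg hx.1 hφ.le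
      have h := hval (s := (1 + x / φ) / 4) ⟨by linarith, by linarith⟩ (θ := x) (t := K) ?_ ?_
      · simpa [← hz, ht] using h
      · unfold polygonAngle
        rw [ramp_of_mem (by linarith) (by linarith), ramp_of_le (by linarith)]; field_simp; ring
      · unfold polygonHeight
        rw [ramp_of_ge (by linarith), ramp_of_le (by linarith)]; ring
    · simp only [mem_singleton_iff] at hz ht
      have h5 : (K - t) / (2 * K) ≤ 1 := by
        rw [div_le_one (by linarith)]; linarith [ht.1]
      have h6 : 0 ≤ (K - t) / (2 * K) := div_nonneg (by linarith [ht.2]) (by linarith)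
      have h := hval (s := (2 + (K - t) / (2 * K)) / 4) ⟨by linarith, by linarith⟩ (θ := φ)
        (t := t) ?_ ?_
      · simpa [hz] using h
      · unfold polygonAngle
        rw [ramp_of_ge (by linarith), ramp_of_le (by linarith)]; ring
      · unfold polygonHeight
        rw [ramp_of_ge (by linarith), ramp_of_mem (by linarith) (by linarith)]; field_simp; ring
    · simp only [mem_singleton_iff] at hz ht
      have h56 : (x - φ) / μ ≤ 1 ∧ 0 ≤ (x - φ) / μ := by
        rcases lt_or_gt_of_ne hμ0 with hm | hm
        · rw [uIcc_of_ge (by linarith)] at hx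
          exact ⟨by rw [div_le_one_of_neg hm]; linarith [hx.1],
            div_nonneg_of_nonpos (by linarith [hx.2]) hm.le⟩
        · rw [uIcc_of_le (by linarith)] at hx
          exact ⟨by rw [div_le_one hm]; linarith [hx.2], div_nonneg (by linarith [hx.1]) hm.le⟩
      obtain ⟨h5, h6⟩ := h56
      have h := hval (s := (3 + (x - φ) / μ) / 4) ⟨by linarith, by linarith⟩ (θ := x)
        (t := -K) ?_ ?_
      · simpa [← hz, ht] using h
      · unfold polygonAngle
        rw [ramp_of_ge (by linarith), ramp_of_mem (by linarith) (by linarith)]; field_simp; ring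
      · unfold polygonHeight
        rw [ramp_of_ge (by linarith), ramp_of_ge (by linarith)]; ring

/-- All angles lie in `[0, 2π]`, so coincident points have angles differing by `2πn` with `|n| ≤ 1`.
The case `n = 0` is injectivity in the plane; `n = ±1` requires the angle `2π`, attained at most at
parameter `1`. -/
theorem polygonCurve_injective (q : ℂ) (hq : ‖q‖ = 1) (hφ : φ ∈ Ioo 0 (2 * Real.pi)) (hK : 0 < K)
    (hμ : μ = 2 * Real.pi - φ ∨ μ = -φ) {s s' : unitInterval} (hle : s ≤ s')
    (he : polygonCurve q hq φ μ K s = polygonCurve q hq φ μ K s') :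
    s = s' ∨ (s = 0 ∧ s' = 1) := by
  have hμ' : 0 < μ ∨ μ = -φ := hμ.imp_left fun h => by rw [h]; linarith [hφ.2]
  have hpair := congrArg (Subtype.val : cylinder → ℂ × ℝ) he
  rw [polygonCurve_coe, polygonCurve_coe, Prod.mk.injEq] at hpair
  obtain ⟨hang, hh⟩ := hpair
  have hq0 : q ≠ 0 := by rintro rfl; simp at hq
  have hexp := mul_left_cancel₀ hq0 hang
  have hsub : ∀ {u u' : unitInterval}, (u : ℝ) = u' ∨ ((u : ℝ) = 0 ∧ (u' : ℝ) = 1) →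
      u = u' ∨ (u = 0 ∧ u' = 1) := fun h =>
    h.imp Subtype.ext fun h => ⟨Subtype.ext h.1, Subtype.ext h.2⟩
  rw [Complex.exp_eq_exp_iff_exists_int] at hexp
  obtain ⟨n, hn⟩ := hexp
  have hn' : polygonAngle φ μ s = polygonAngle φ μ s' + n * (2 * Real.pi) := by
    have : (polygonAngle φ μ s : ℂ) = polygonAngle φ μ s' + n * (2 * Real.pi) := by
      apply mul_right_cancel₀ Complex.I_ne_zero
      rw [hn]; ring
    exact_mod_cast this
  have hpi := Real.pi_pos
  have hbd : ∀ u : unitInterval, 0 ≤ polygonAngle φ μ u ∧ polygonAngle φ μ u ≤ 2 * Real.pi ∧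
      (polygonAngle φ μ u = 2 * Real.pi → u = 1) ∧
      (polygonAngle φ μ u = 0 → polygonHeight K u = -K → μ = 2 * Real.pi - φ → u = 0) := by
    intro u
    obtain ⟨x, ⟨hx0, hx1⟩, ⟨h, h1, h2⟩ | ⟨h, h1, h2⟩ | ⟨h, h1, h2⟩ | ⟨h, h1, h2⟩⟩ :=
      polygon_cases φ μ K u.2
    · rw [h1, h2]
      refine ⟨le_rfl, by linarith, fun h0 => by linarith, fun _ h0 _ => Subtype.ext ?_⟩
      have : x = 0 := mul_left_cancel₀ hK.ne' (by linarith)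
      change (u : ℝ) = 0
      linarith
    · rw [h1, h2]
      refine ⟨mul_nonneg hφ.1.le hx0, ?_, fun h0 => ?_, fun _ h0 _ => by linarith⟩
      · nlinarith [hφ.1, hφ.2]
      · nlinarith [hφ.1, hφ.2]
    · rw [h1, h2]
      exact ⟨hφ.1.le, hφ.2.le, fun h0 => by linarith [hφ.2], fun h0 _ _ => by linarith [hφ.1]⟩
    · rw [h1, h2]
      rcases hμ with rfl | rfl
      · refine ⟨by nlinarith [hφ.1, hφ.2], by nlinarith [hφ.1, hφ.2], fun h0 => Subtype.ext ?_,
          fun h0 _ _ => by nlinarith [hφ.1, hφ.2]⟩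
        have : x = 1 := mul_left_cancel₀ (by linarith [hφ.2] : 2 * Real.pi - φ ≠ 0) (by linarith)
        change (u : ℝ) = 1
        linarith
      · exact ⟨by nlinarith [hφ.1], by nlinarith [hφ.1, hφ.2], fun h0 => by nlinarith [hφ.1, hφ.2],
          fun _ _ h0 => by linarith⟩
  obtain ⟨b1, b2, b3, b4⟩ := hbd s
  obtain ⟨b1', b2', b3', b4'⟩ := hbd s'
  have hn1 : (n : ℝ) ≤ 1 := by nlinarith
  have hn2 : (-1 : ℝ) ≤ n := by nlinarith
  have hn1' : n ≤ 1 := by exact_mod_cast hn1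
  have hn2' : -1 ≤ n := by exact_mod_cast hn2
  obtain rfl | rfl | rfl : n = -1 ∨ n = 0 ∨ n = 1 := by omega
  · push_cast at hn'
    have hs' := b3' (by linarith)
    subst hs'
    have h1 := polygon_one φ μ K
    have hs1 : polygonHeight K ((1 : unitInterval) : ℝ) = -K := h1.2
    have ha1 : polygonAngle φ μ ((1 : unitInterval) : ℝ) = φ + μ := h1.1
    right
    refine ⟨b4 (by linarith) (by rw [hh, hs1]) ?_, rfl⟩
    rw [ha1] at hn' b2'
    rcases hμ with h | h
    · exact h
    · linarith
  · push_cast at hn'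
    exact hsub (polygon_injective hφ.1 hK hμ' s.2 s'.2 hle (by linarith) hh)
  · push_cast at hn'
    have hs := b3 (by linarith)
    subst hs
    left
    exact le_antisymm hle s'.2.2

theorem isJordanParam_polygonCurve (q : ℂ) (hq : ‖q‖ = 1) (hφ : φ ∈ Ioo 0 (2 * Real.pi))
    (hK : 0 < K) (hμ : μ = 2 * Real.pi - φ ∨ μ = -φ) :
    IsJordanParam (polygonCurve q hq φ μ K)
      (range (fun s => (polygonCurve q hq φ μ K s : ℂ × ℝ))) := by
  refine ⟨?_, fun s s' he => ?_, rfl⟩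
  · apply Subtype.ext
    rw [polygonCurve_coe, polygonCurve_coe]
    obtain ⟨h0, h0'⟩ := polygon_zero φ μ K
    obtain ⟨h1, h1'⟩ := polygon_one φ μ K
    rw [Icc.coe_zero, Icc.coe_one, h0, h0', h1, h1']
    rcases hμ with rfl | rfl
    · congr 2
      rw [add_sub_cancel]
      push_cast
      rw [Complex.exp_two_pi_mul_I, zero_mul, Complex.exp_zero]
    · rw [add_neg_cancel]
  · rcases le_total s s' with hle | hle
    · rcases polygonCurve_injective q hq hφ hK hμ hle he with h | h
      · exact Or.inl h
      · exact Or.inr (Or.inl h)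
    · rcases polygonCurve_injective q hq hφ hK hμ hle he.symm with h | h
      · exact Or.inl h.symm
      · exact Or.inr (Or.inr ⟨h.2, h.1⟩)

end Polygon

end

section

/-! ### Geodesics, equidistant lines and the regions they bound -/

/-- The point of the upper unit half-circle that makes the (clockwise) angle `g` with the imaginary
axis. -/
noncomputable def dirOf (g : ℝ) : ℂ := ⟨Real.sin g, Real.cos g⟩

@[simp] theorem dirOf_re (g : ℝ) : (dirOf g).re = Real.sin g := rfl

@[simp] theorem dirOf_im (g : ℝ) : (dirOf g).im = Real.cos g := rfl

theorem norm_dirOf (g : ℝ) : ‖dirOf g‖ = 1 := by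
  have h : ‖dirOf g‖ ^ 2 = 1 := by
    rw [← Complex.normSq_eq_norm_sq, Complex.normSq_apply, dirOf_re, dirOf_im]
    nlinarith [Real.sin_sq_add_cos_sq g]
  nlinarith [norm_nonneg (dirOf g)]

theorem dirOf_eq (g : ℝ) : dirOf g = Real.sin g + Real.cos g * Complex.I := by
  rw [← Complex.mk_eq_add_mul_I]
  rfl

theorem contDiff_dirOf : ContDiff ℝ ∞ dirOf := by
  have : dirOf = fun g : ℝ => Complex.ofRealCLM (Real.sin g) +
      Complex.ofRealCLM (Real.cos g) * Complex.I := by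
    funext g
    simpa using dirOf_eq g
  rw [this]
  exact (Complex.ofRealCLM.contDiff.comp Real.contDiff_sin).add
    ((Complex.ofRealCLM.contDiff.comp Real.contDiff_cos).mul contDiff_const)

theorem dirOf_pi_div_two : dirOf (Real.pi / 2) = 1 := by
  apply Complex.ext <;> simp

theorem dirOf_neg_pi_div_two : dirOf (-(Real.pi / 2)) = -1 := by
  apply Complex.ext <;> simp

/-- The angle `g` for which `z` lies on the equidistant line of the points `r * dirOf g`. -/
noncomputable def diskAngle (q₁ q₂ a z : ℂ) : ℝ :=
  Real.arcsin ((diskToHalfPlane q₁ q₂ a z).re / ‖diskToHalfPlane q₁ q₂ a z‖)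

theorem abs_re_div_norm_lt_one {w : ℂ} (hw : 0 < w.im) :
    -1 < w.re / ‖w‖ ∧ w.re / ‖w‖ < 1 := by
  have hw0 : w ≠ 0 := by rintro rfl; simp at hw
  have hn := norm_pos_iff.mpr hw0
  have h := Complex.abs_re_lt_norm.mpr hw.ne'
  rw [abs_lt] at h
  rw [lt_div_iff₀ hn, div_lt_one hn]
  constructor <;> linarith [h.1, h.2]

namespace IsFrame

variable {q₁ q₂ a : ℂ}

theorem diskAngle_mem (h : IsFrame q₁ q₂ a) {z : ℂ} (hz : z ∈ hypPlane) :
    diskAngle q₁ q₂ a z ∈ Ioo (-(Real.pi / 2)) (Real.pi / 2) := by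
  obtain ⟨h1, h2⟩ := abs_re_div_norm_lt_one (h.diskToHalfPlane_im_pos hz)
  exact ⟨Real.neg_pi_div_two_lt_arcsin.mpr h1, Real.arcsin_lt_pi_div_two.mpr h2⟩

theorem contDiffOn_diskAngle (h : IsFrame q₁ q₂ a) :
    ContDiffOn ℝ ∞ (diskAngle q₁ q₂ a) hypPlane := by
  have hre : ContDiffOn ℝ ∞ (fun z => (diskToHalfPlane q₁ q₂ a z).re) hypPlane :=
    Complex.reCLM.contDiff.comp_contDiffOn h.contDiffOn_diskToHalfPlane
  have hn : ContDiffOn ℝ ∞ (fun z => ‖diskToHalfPlane q₁ q₂ a z‖) hypPlane :=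
    h.contDiffOn_diskToHalfPlane.norm ℝ fun z hz => h.diskToHalfPlane_ne_zero hz
  have hq := hre.div hn fun z hz => norm_ne_zero_iff.mpr (h.diskToHalfPlane_ne_zero hz)
  intro z hz
  obtain ⟨h1, h2⟩ := abs_re_div_norm_lt_one (h.diskToHalfPlane_im_pos hz)
  exact (Real.contDiffAt_arcsin (ne_of_gt h1) h2.ne).comp_contDiffWithinAt z (hq z hz)

theorem norm_mul_dirOf_diskAngle (h : IsFrame q₁ q₂ a) {z : ℂ} (hz : z ∈ hypPlane) :
    (‖diskToHalfPlane q₁ q₂ a z‖ : ℂ) * dirOf (diskAngle q₁ q₂ a z) =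
      diskToHalfPlane q₁ q₂ a z := by
  have him := h.diskToHalfPlane_im_pos hz
  have hn := norm_pos_iff.mpr (h.diskToHalfPlane_ne_zero hz)
  obtain ⟨h1, h2⟩ := abs_re_div_norm_lt_one him
  set w := diskToHalfPlane q₁ q₂ a z with hw
  have hsq : w.re ^ 2 + w.im ^ 2 = ‖w‖ ^ 2 := by
    rw [← Complex.normSq_eq_norm_sq, Complex.normSq_apply]; ring
  apply Complex.ext
  · rw [Complex.re_ofReal_mul, dirOf_re, diskAngle, ← hw, Real.sin_arcsin h1.le h2.le]
    field_simp
  · rw [Complex.im_ofReal_mul, dirOf_im, diskAngle, ← hw, Real.cos_arcsin]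
    have : 1 - (w.re / ‖w‖) ^ 2 = (w.im / ‖w‖) ^ 2 := by
      field_simp; linarith
    rw [this, Real.sqrt_sq (by positivity)]
    field_simp

theorem halfPlaneToDisk_dirOf_diskAngle (h : IsFrame q₁ q₂ a) {z : ℂ} (hz : z ∈ hypPlane) :
    halfPlaneToDisk q₂ a (‖diskToHalfPlane q₁ q₂ a z‖ * dirOf (diskAngle q₁ q₂ a z)) = z := by
  rw [h.norm_mul_dirOf_diskAngle hz, h.halfPlaneToDisk_diskToHalfPlane (h.ne_right_of_mem hz)]

theorem exists_eq_halfPlaneToDisk (h : IsFrame q₁ q₂ a) {z : ℂ} (hz : z ∈ hypPlane) :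
    ∃ r : ℝ, 0 < r ∧ z = halfPlaneToDisk q₂ a (r * dirOf (diskAngle q₁ q₂ a z)) :=
  ⟨_, norm_pos_iff.mpr (h.diskToHalfPlane_ne_zero hz), (h.halfPlaneToDisk_dirOf_diskAngle hz).symm⟩

theorem polar_mem_hypPlane (h : IsFrame q₁ q₂ a) {r : ℝ} (hr : 0 < r) {v : ℂ} (hv : 0 < v.im) :
    halfPlaneToDisk q₂ a (r * v) ∈ hypPlane :=
  h.halfPlaneToDisk_mem (by rw [Complex.im_ofReal_mul]; exact mul_pos hr hv)

theorem diskAngle_polar (h : IsFrame q₁ q₂ a) {r : ℝ} (hr : 0 < r) {v : ℂ} (hv : 0 < v.im)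
    (hn : ‖v‖ = 1) : diskAngle q₁ q₂ a (halfPlaneToDisk q₂ a (r * v)) = Real.arcsin v.re := by
  have him : 0 ≤ ((r : ℂ) * v).im := by rw [Complex.im_ofReal_mul]; exact (mul_pos hr hv).le
  rw [diskAngle, h.diskToHalfPlane_halfPlaneToDisk (h.sub_conj_base_ne_zero him), norm_mul, hn,
    Complex.norm_real, Real.norm_of_nonneg hr.le, Complex.re_ofReal_mul, mul_one,
    mul_div_cancel_left₀ _ hr.ne']

theorem diskAngle_dirOf (h : IsFrame q₁ q₂ a) {r : ℝ} (hr : 0 < r) {g : ℝ}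
    (hg : g ∈ Ioo (-(Real.pi / 2)) (Real.pi / 2)) :
    diskAngle q₁ q₂ a (halfPlaneToDisk q₂ a (r * dirOf g)) = g := by
  rw [h.diskAngle_polar hr (Real.cos_pos_of_mem_Ioo hg) (norm_dirOf g), dirOf_re,
    Real.arcsin_sin hg.1.le hg.2.le]

/-! #### Hyperbolic distance to the geodesic -/

theorem hypDist_halfPlaneToDisk (h : IsFrame q₁ q₂ a) {w w' : ℂ} (hw : 0 < w.im)
    (hw' : 0 < w'.im) :
    hypDist (halfPlaneToDisk q₂ a w) (halfPlaneToDisk q₂ a w') =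
      2 * Real.arsinh (‖w - w'‖ / (2 * √(w.im * w'.im))) := by
  have h0 := h.sub_conj_base_ne_zero hw.le
  have h0' := h.sub_conj_base_ne_zero hw'.le
  have hn := norm_pos_iff.mpr h0
  have hn' := norm_pos_iff.mpr h0'
  have ha := h.im_pos
  rw [hypDist, h.normSq_halfPlaneToDisk h0, h.normSq_halfPlaneToDisk h0']
  have hsub : halfPlaneToDisk q₂ a w - halfPlaneToDisk q₂ a w' =
      q₂ * (2 * a.im * Complex.I) * (w - w') / ((w - conj a) * (w' - conj a)) := by
    rw [← sub_conj, halfPlaneToDisk, halfPlaneToDisk, div_sub_div _ _ h0 h0']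
    congr 1
    ring
  have hsqrt : √(4 * a.im * w.im / ‖w - conj a‖ ^ 2 * (4 * a.im * w'.im / ‖w' - conj a‖ ^ 2)) =
      4 * a.im * √(w.im * w'.im) / (‖w - conj a‖ * ‖w' - conj a‖) := by
    rw [Real.sqrt_eq_iff_mul_self_eq (by positivity) (by positivity)]
    have hs := Real.mul_self_sqrt (mul_pos hw hw').le
    field_simp
    rw [← sq] at hs
    rw [hs]
  rw [hsub, hsqrt, norm_div, norm_mul, norm_mul, norm_mul, norm_mul, norm_mul, h.norm_right,
    Complex.norm_I, Complex.norm_real, Complex.norm_two, Real.norm_of_nonneg ha.le]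
  have := Real.sqrt_pos.mpr (mul_pos hw hw')
  congr 2
  field_simp
  ring

/-- This is the half-argument formula `cosh x = 1 + 2 sinh² (x / 2)`. -/
theorem two_mul_arsinh_sqrt {C : ℝ} (hC : 1 ≤ C) :
    2 * Real.arsinh (√((C - 1) / 2)) = Real.arcosh C := by
  have h0 := Real.arcosh_nonneg hC
  have h1 := Real.cosh_arcosh hC
  have h2 : Real.cosh (Real.arcosh C) = 1 + 2 * Real.sinh (Real.arcosh C / 2) ^ 2 := by
    have h3 := Real.cosh_two_mul (Real.arcosh C / 2)
    have h4 := Real.cosh_sq (Real.arcosh C / 2)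
    rw [mul_div_cancel₀ _ two_ne_zero] at h3
    linarith
  have h5 : (C - 1) / 2 = Real.sinh (Real.arcosh C / 2) ^ 2 := by linarith
  rw [h5, Real.sqrt_sq (Real.sinh_nonneg_iff.mpr (by linarith)), Real.arsinh_sinh]
  ring

/-! #### The geodesic -/

/-- In the half-plane the image of the point `x` of the diameter is `ρ * (x + 1) / (x - 1)`, where
`ρ = conj a * (conj α + conj β) / (conj α - conj β)`. The end point conditions make `ρ` purely
imaginary; `‖β‖ < ‖α‖` and `0 < a.im` make `ρ.im` negative. So the diameter maps into the positive
imaginary axis. -/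
theorem geodesicLine_eq (h : IsFrame q₁ q₂ a) :
    geodesicLine q₁ q₂ = {z | ∃ r : ℝ, 0 < r ∧ z = halfPlaneToDisk q₂ a (r * Complex.I)} := by
  have hb := h.base_mul_conj
  have hq := h.right_mul_conj
  have hconj0 : conj a ≠ 0 := right_ne_zero_of_mul_eq_one hb
  have hWT : ∀ α β : ℂ, conj α + conj β ≠ 0 → conj α - conj β ≠ 0 → α * conj α - β * conj β ≠ 0 →
      ∀ x : ℝ, conj β * x + conj α ≠ 0 → (x : ℂ) - 1 ≠ 0 →
      moebius α β (-1) = q₁ → moebius α β 1 = q₂ →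
      diskToHalfPlane q₁ q₂ a (moebius α β x) =
        conj a * ((x + 1) * (conj α + conj β)) / ((x - 1) * (conj α - conj β)) := by
    intro α β hA hB hdet x hx hx1 h1 h2
    rw [diskToHalfPlane, ← h1, ← h2]
    have hA' : conj β * 1 + conj α ≠ 0 := by rwa [mul_one, add_comm]
    have hB' : conj β * (-1) + conj α ≠ 0 := by
      rwa [mul_neg_one, add_comm, ← sub_eq_add_neg]
    have e1 : moebius α β x - moebius α β (-1) = (α * conj α - β * conj β) * (x + 1) /
        ((conj β * x + conj α) * (conj β * (-1) + conj α)) := by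
      rw [moebius, moebius, div_sub_div _ _ hx hB']
      ring
    have e2 : moebius α β x - moebius α β 1 = (α * conj α - β * conj β) * (x - 1) /
        ((conj β * x + conj α) * (conj β * 1 + conj α)) := by
      rw [moebius, moebius, div_sub_div _ _ hx hA']
      ring
    rw [e1, e2]
    have hB'' : -conj β + conj α ≠ 0 := by simpa using hB'
    have hA'' : conj β + conj α ≠ 0 := by simpa using hA'
    rw [mul_one, mul_neg_one]
    field_simp
    ring
  have hden : ∀ α β z : ℂ, ‖β‖ < ‖α‖ → ‖z‖ ≤ 1 → conj β * z + conj α ≠ 0 := by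
    intro α β z hαβ hz h0
    have h1 : ‖conj α‖ = ‖conj β * z‖ := by
      rw [eq_neg_of_add_eq_zero_right h0, norm_neg]
    rw [norm_mul, Complex.norm_conj, Complex.norm_conj] at h1
    nlinarith [norm_nonneg β]
  have hdets : ∀ α β : ℂ, ‖β‖ < ‖α‖ → α * conj α - β * conj β ≠ 0 := by
    intro α β hαβ
    rw [Complex.mul_conj, Complex.mul_conj, Complex.normSq_eq_norm_sq, Complex.normSq_eq_norm_sq]
    have : ‖β‖ ^ 2 < ‖α‖ ^ 2 := by nlinarith [norm_nonneg β]
    norm_cast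
    linarith
  have hne : ∀ α β : ℂ, ‖β‖ < ‖α‖ → moebius α β 1 = q₂ → ∀ x : ℝ, -1 < x → x < 1 →
      moebius α β x ≠ q₂ := by
    intro α β hαβ h2 x hx1 hx2
    have hxn : ‖(x : ℂ)‖ ≤ 1 := by
      rw [Complex.norm_real, Real.norm_eq_abs, abs_le]; exact ⟨hx1.le, hx2.le⟩
    have hd1 := hden α β x hαβ hxn
    have hd2 := hden α β 1 hαβ (by simp)
    rw [← h2, ← sub_ne_zero, moebius, moebius, div_sub_div _ _ hd1 hd2]
    refine div_ne_zero ?_ (mul_ne_zero hd1 hd2)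
    have : (α * x + β) * (conj β * 1 + conj α) - (conj β * x + conj α) * (α * 1 + β) =
        (α * conj α - β * conj β) * (x - 1) := by ring
    rw [this]
    refine mul_ne_zero (hdets α β hαβ) ?_
    norm_cast
    linarith
  ext z
  constructor
  · rintro ⟨α, β, hαβ, h1, h2, x, hx1, hx2, rfl⟩
    have hA : conj α + conj β ≠ 0 := by
      have := hden α β 1 hαβ (by simp)
      rwa [mul_one, add_comm] at this
    have hB : conj α - conj β ≠ 0 := by
      have := hden α β (-1) hαβ (by simp)
      rwa [mul_neg_one, add_comm, ← sub_eq_add_neg] at this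
    have hxn : ‖(x : ℂ)‖ ≤ 1 := by
      rw [Complex.norm_real, Real.norm_eq_abs, abs_le]; exact ⟨hx1.le, hx2.le⟩
    have hxc : (x : ℂ) - 1 ≠ 0 := by
      norm_cast; linarith
    have hW := hWT α β hA hB (hdets α β hαβ) x (hden α β x hαβ hxn) hxc h1 h2
    obtain ⟨A, hAdef⟩ : ∃ A, A = conj α + conj β := ⟨_, rfl⟩
    obtain ⟨B, hBdef⟩ : ∃ B, B = conj α - conj β := ⟨_, rfl⟩
    rw [← hAdef] at hA hW
    rw [← hBdef] at hB hW
    have hcA : conj A = α + β := by simp [hAdef]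
    have hcB : conj B = α - β := by simp [hBdef]
    have e1 : q₁ * B = -conj B := by
      rw [← h1, moebius, hcB]
      have : conj β * (-1) + conj α = B := by rw [hBdef]; ring
      rw [this]
      field_simp
      ring
    have e2 : q₂ * A = conj A := by
      rw [← h2, moebius, hcA]
      have : conj β * 1 + conj α = A := by rw [hAdef]; ring
      rw [this]
      field_simp
    obtain ⟨ρ, hρ⟩ : ∃ ρ, ρ = A * conj a / B := ⟨_, rfl⟩
    have hρsq : ρ / conj ρ = -1 := by
      have hcA0 : conj A ≠ 0 := by rwa [Ne, map_eq_zero]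
      have hcB0 : conj B ≠ 0 := by rwa [Ne, map_eq_zero]
      have ha0 := h.base_ne_zero
      rw [hρ, map_div₀, map_mul, Complex.conj_conj]
      have h3 := h.left_eq
      rw [div_div_div_eq, div_eq_iff (mul_ne_zero hB (mul_ne_zero hcA0 ha0))]
      have h4 : conj B = -(q₂ * a ^ 2 * B) := by rw [← h3]; linear_combination e1
      rw [h4, ← e2]
      linear_combination (-(A * q₂ * a * B)) * hb
    have hρ0 : ρ ≠ 0 := hρ ▸ div_ne_zero (mul_ne_zero hA hconj0) hB
    have hρre : ρ.re = 0 := by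
      have hcρ : conj ρ ≠ 0 := by rwa [Ne, map_eq_zero]
      rw [div_eq_iff hcρ] at hρsq
      have := congrArg Complex.re hρsq
      simp at this
      linarith
    have hρim : ρ.im < 0 := by
      have hpos : 0 < (A * conj B).re := by
        have : (A * conj B).re = ‖α‖ ^ 2 - ‖β‖ ^ 2 := by
          rw [hcB, hAdef, ← Complex.normSq_eq_norm_sq, ← Complex.normSq_eq_norm_sq,
            Complex.normSq_apply, Complex.normSq_apply]
          simp
          ring
        rw [this]
        nlinarith [norm_nonneg β]
      have hAB : A * conj B = ρ * a * (Complex.normSq B : ℂ) := by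
        rw [← Complex.mul_conj, hρ]
        field_simp
        linear_combination (-(conj B)) * hb
      rw [hAB, Complex.re_mul_ofReal] at hpos
      have hBn := Complex.normSq_pos.mpr hB
      have h5 := (mul_pos_iff_of_pos_right hBn).mp hpos
      rw [Complex.mul_re, hρre] at h5
      have := h.im_pos
      nlinarith
    have hρI : ρ = ρ.im * Complex.I := by
      apply Complex.ext <;> simp [hρre]
    refine ⟨-ρ.im * ((1 + x) / (1 - x)), mul_pos (by linarith)
      (div_pos (by linarith) (by linarith)), ?_⟩
    have hW' : diskToHalfPlane q₁ q₂ a (moebius α β x) =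
        ((-ρ.im * ((1 + x) / (1 - x)) : ℝ) : ℂ) * Complex.I := by
      rw [hW]
      have : conj a * (((x : ℂ) + 1) * A) / ((x - 1) * B) = ρ * ((x + 1) / (x - 1)) := by
        rw [hρ]; field_simp
      rw [this]
      nth_rewrite 1 [hρI]
      have hx' : (1 - x : ℂ) ≠ 0 := by
        rw [← neg_sub]; exact neg_ne_zero.mpr hxc
      push_cast
      field_simp
      ring
    rw [← hW', h.halfPlaneToDisk_diskToHalfPlane (hne α β hαβ h2 x hx1 hx2)]
  · rintro ⟨r, hr, rfl⟩
    -- For the converse, one isometry with `ρ = -I` suffices. Taking `b` and `I * conj a * b` as the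
    -- sum and difference of `conj α` and `conj β` achieves this, fixes the end points as required,
    -- and gives `‖α‖² - ‖β‖² = a.im > 0`. The modulus `r` is then reached at `x = (r - 1) / (r +
    -- 1)`.
    obtain ⟨b, hb2⟩ : ∃ b : ℂ, b ^ 2 = conj q₂ := IsAlgClosed.exists_pow_nat_eq _ two_pos
    have hbn : b * conj b = 1 := by
      have : ‖b‖ ^ 2 = 1 := by
        rw [← norm_pow, hb2, Complex.norm_conj, h.norm_right]
      rw [Complex.mul_conj, Complex.normSq_eq_norm_sq, this]; simp
    have hb0 : b ≠ 0 := left_ne_zero_of_mul_eq_one hbn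
    have hqb : q₂ * b = conj b := by
      linear_combination (-(q₂ * b)) * hbn + q₂ * conj b * hb2 + conj b * hq
    obtain ⟨B, hB⟩ : ∃ B, B = Complex.I * conj a * b := ⟨_, rfl⟩
    have hB0 : B ≠ 0 := hB ▸ mul_ne_zero (mul_ne_zero Complex.I_ne_zero hconj0) hb0
    have hcB : conj B = -Complex.I * a * conj b := by simp [hB]
    obtain ⟨α, hα⟩ : ∃ α, α = (conj b + conj B) / 2 := ⟨_, rfl⟩
    obtain ⟨β, hβ⟩ : ∃ β, β = (conj b - conj B) / 2 := ⟨_, rfl⟩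
    have hcα : conj α = (b + B) / 2 := by
      rw [hα, map_div₀, map_add, Complex.conj_conj, Complex.conj_conj, map_ofNat]
    have hcβ : conj β = (b - B) / 2 := by
      rw [hβ, map_div₀, map_sub, Complex.conj_conj, Complex.conj_conj, map_ofNat]
    have hAB : conj α + conj β = b := by rw [hcα, hcβ]; ring
    have hAB' : conj α - conj β = B := by rw [hcα, hcβ]; ring
    have hlt : ‖β‖ < ‖α‖ := by
      have h1 : ‖α‖ ^ 2 - ‖β‖ ^ 2 = a.im := by
        have : ((‖α‖ ^ 2 - ‖β‖ ^ 2 : ℝ) : ℂ) = a.im := by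
          push_cast
          have hnα : ((‖α‖ : ℂ)) ^ 2 = α * conj α := by
            rw [Complex.mul_conj, Complex.normSq_eq_norm_sq]; push_cast; rfl
          have hnβ : ((‖β‖ : ℂ)) ^ 2 = β * conj β := by
            rw [Complex.mul_conj, Complex.normSq_eq_norm_sq]; push_cast; rfl
          rw [hnα, hnβ, hcα, hcβ, hα, hβ, hcB, hB]
          have hs := sub_conj a
          linear_combination (-Complex.I * (a - conj a) / 2) * hbn - Complex.I / 2 * hs
            - a.im * Complex.I_sq
        exact_mod_cast this
      have := h.im_pos
      nlinarith [norm_nonneg α, norm_nonneg β]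
    have hα1 : α + β = conj b := by rw [hα, hβ]; ring
    have hα2 : α - β = conj B := by rw [hα, hβ]; ring
    have h1 : moebius α β (-1) = q₁ := by
      rw [moebius, h.left_eq]
      have e1 : α * (-1) + β = -conj B := by rw [← hα2]; ring
      have e2 : conj β * (-1) + conj α = B := by rw [← hAB']; ring
      rw [e1, e2, div_eq_iff hB0, hcB, hB]
      linear_combination (-(Complex.I * a)) * hqb - q₂ * a * Complex.I * b * hb
    have h2 : moebius α β 1 = q₂ := by
      rw [moebius]
      have e1 : α * 1 + β = conj b := by rw [← hα1]; ring
      have e2 : conj β * 1 + conj α = b := by rw [← hAB]; ring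
      rw [e1, e2, div_eq_iff hb0, hqb]
    have hx1 : -1 < (r - 1) / (r + 1) := by rw [lt_div_iff₀ (by linarith)]; linarith
    have hx2 : (r - 1) / (r + 1) < 1 := by rw [div_lt_iff₀ (by linarith)]; linarith
    refine ⟨α, β, hlt, h1, h2, (r - 1) / (r + 1), hx1, hx2, ?_⟩
    rw [← h.halfPlaneToDisk_diskToHalfPlane (hne α β hlt h2 _ hx1 hx2)]
    congr 1
    obtain ⟨x, hx⟩ : ∃ x, x = (r - 1) / (r + 1) := ⟨_, rfl⟩
    rw [← hx] at hx1 hx2 ⊢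
    have hxn : ‖(x : ℂ)‖ ≤ 1 := by
      rw [Complex.norm_real, Real.norm_eq_abs, abs_le]; exact ⟨hx1.le, hx2.le⟩
    have hxc : (x : ℂ) - 1 ≠ 0 := by
      norm_cast; linarith
    rw [hWT α β (by rwa [hAB]) (by rwa [hAB']) (hdets α β hlt) x (hden α β x hlt hxn) hxc h1 h2,
      hAB, hAB', hB]
    have hrx : (r : ℂ) * (1 - x) = 1 + x := by
      have : r * (1 - x) = 1 + x := by
        rw [hx]; field_simp; ring
      exact_mod_cast this
    have hI := Complex.I_ne_zero
    field_simp
    linear_combination (r * (x - 1)) * Complex.I_sq + hrx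

end IsFrame

end

/-! ### The angular coordinate: distance to the geodesic, ideal points, sectors, equidistant lines
-/

section

theorem dirOf_zero : dirOf 0 = Complex.I := by
  apply Complex.ext <;> simp

theorem arccos_inv_mem {d : ℝ} (hd : 1 < d) : Real.arccos d⁻¹ ∈ Ioo 0 (Real.pi / 2) :=
  ⟨Real.arccos_pos.mpr (inv_lt_one_of_one_lt₀ hd),
    Real.arccos_lt_pi_div_two.mpr (inv_pos.mpr (by linarith))⟩

namespace IsFrame

variable {q₁ q₂ a : ℂ}

theorem geodesicLine_eq_diskAngle (h : IsFrame q₁ q₂ a) :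
    geodesicLine q₁ q₂ = {z ∈ hypPlane | diskAngle q₁ q₂ a z = 0} := by
  have hpi := Real.pi_pos
  rw [h.geodesicLine_eq, ← dirOf_zero]
  ext z
  constructor
  · rintro ⟨r, hr, rfl⟩
    exact ⟨h.polar_mem_hypPlane hr (by simp), h.diskAngle_dirOf hr ⟨by linarith, by linarith⟩⟩
  · rintro ⟨hz, h0⟩
    obtain ⟨r, hr, hzr⟩ := h.exists_eq_halfPlaneToDisk hz
    exact ⟨r, hr, by rwa [h0] at hzr⟩

/-- Among the points `r' * I` of the geodesic, the nearest to `r * dirOf g` is the one with `r' =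
r`: after clearing denominators the comparison is `(r - r')² ≥ 0`. -/
theorem hypDistTo_geodesicLine (h : IsFrame q₁ q₂ a) {z : ℂ} (hz : z ∈ hypPlane) :
    hypDistTo (geodesicLine q₁ q₂) z = Real.arcosh (Real.cos (diskAngle q₁ q₂ a z))⁻¹ := by
  obtain ⟨r, hr, hzr⟩ := h.exists_eq_halfPlaneToDisk hz
  have hc := Real.cos_pos_of_mem_Ioo (h.diskAngle_mem hz)
  have hc1 := Real.cos_le_one (diskAngle q₁ q₂ a z)
  obtain ⟨g, hg⟩ : ∃ g, g = diskAngle q₁ q₂ a z := ⟨_, rfl⟩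
  rw [← hg] at hzr hc hc1 ⊢
  have hC : 1 ≤ (Real.cos g)⁻¹ := (one_le_inv₀ hc).mpr hc1
  have him : 0 < ((r : ℂ) * dirOf g).im := by
    rw [Complex.im_ofReal_mul]; exact mul_pos hr hc
  have himI : ∀ {r' : ℝ}, 0 < r' → 0 < ((r' : ℂ) * Complex.I).im := by
    intro r' hr'
    rw [Complex.im_ofReal_mul]; simpa using hr'
  have hdist : ∀ {r' : ℝ}, 0 < r' → hypDist z (halfPlaneToDisk q₂ a (r' * Complex.I)) =
      2 * Real.arsinh √((r ^ 2 + r' ^ 2 - 2 * r * r' * Real.cos g) /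
        (4 * (r * r' * Real.cos g))) := by
    intro r' hr'
    rw [hzr, h.hypDist_halfPlaneToDisk him (himI hr'), Real.sqrt_div']
    · congr 3
      · symm
        rw [Real.sqrt_eq_iff_mul_self_eq _ (norm_nonneg _), ← sq, ← Complex.normSq_eq_norm_sq,
          Complex.normSq_apply]
        · simp
          linear_combination -r ^ 2 * Real.sin_sq_add_cos_sq g
        · nlinarith [sq_nonneg (r - r'), mul_pos hr hr']
      · have h4 : √(4 : ℝ) = 2 := by
          rw [show (4 : ℝ) = 2 ^ 2 by norm_num, Real.sqrt_sq two_pos.le]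
        rw [Real.sqrt_mul (x := 4) (by norm_num), h4, Complex.im_ofReal_mul, Complex.im_ofReal_mul]
        congr 2
        simp
        ring
    · positivity
  rw [hypDistTo, h.geodesicLine_eq, ← two_mul_arsinh_sqrt hC]
  have heq : ((Real.cos g)⁻¹ - 1) / 2 =
      (r ^ 2 + r ^ 2 - 2 * r * r * Real.cos g) / (4 * (r * r * Real.cos g)) := by
    field_simp
    ring
  refine IsLeast.csInf_eq ⟨⟨_, ⟨r, hr, rfl⟩, by simp only; rw [hdist hr, heq]⟩, ?_⟩
  rintro _ ⟨_, ⟨r', hr', rfl⟩, rfl⟩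
  simp only
  rw [hdist hr']
  have hle : ((Real.cos g)⁻¹ - 1) / 2 ≤
      (r ^ 2 + r' ^ 2 - 2 * r * r' * Real.cos g) / (4 * (r * r' * Real.cos g)) := by
    rw [le_div_iff₀ (by positivity)]
    have : ((Real.cos g)⁻¹ - 1) / 2 * (4 * (r * r' * Real.cos g)) =
        2 * r * r' - 2 * r * r' * Real.cos g := by
      field_simp
      ring
    rw [this]
    nlinarith [sq_nonneg (r - r')]
  have := Real.arsinh_le_arsinh.mpr (Real.sqrt_le_sqrt hle)
  linarith

/-! #### Ideal points of swept sets -/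

theorem closedPolar_mem_idealBoundary_of_or (h : IsFrame q₁ q₂ a) {x : ℝ} {v : ℂ} (hn : ‖v‖ = 1)
    (hv : x = -1 ∨ x = 1 ∨ x < 1 ∧ v.im = 0) : closedPolar q₂ a x v ∈ idealBoundary := by
  rcases hv with rfl | rfl | ⟨hx, hv⟩
  · rw [h.closedPolar_neg_one]; exact h.left_mem
  · rw [closedPolar_one hn]; exact h.right_mem
  · exact h.closedPolar_mem_idealBoundary hx hv

theorem closedPolar_cases (h : IsFrame q₁ q₂ a) {x : ℝ} (hx : x ∈ Icc (-1 : ℝ) 1) {v : ℂ}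
    (hi : 0 ≤ v.im) :
    x = -1 ∨ x = 1 ∨ x < 1 ∧ v.im = 0 ∨
      x ∈ Ioo (-1 : ℝ) 1 ∧ 0 < v.im ∧ closedPolar q₂ a x v ∈ hypPlane := by
  rcases hx.1.eq_or_lt with h1 | h1
  · exact Or.inl h1.symm
  rcases hx.2.eq_or_lt with h2 | h2
  · exact Or.inr (Or.inl h2)
  rcases hi.eq_or_lt with h3 | h3
  · exact Or.inr (Or.inr (Or.inl ⟨h2, h3.symm⟩))
  · exact Or.inr (Or.inr (Or.inr ⟨⟨h1, h2⟩, h3, h.closedPolar_mem_hypPlane ⟨h1, h2⟩ h3⟩))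

variable {v : ℝ → ℂ} {t : ℝ → ℝ} {I : Set ℝ}

theorem sweptClosed_inter_cylinder (h : IsFrame q₁ q₂ a) (hn : ∀ s ∈ I, ‖v s‖ = 1)
    (hi : ∀ s ∈ I, 0 ≤ (v s).im) :
    sweptClosed q₂ a v t I ∩ cylinder =
      {q₁} ×ˢ (t '' I) ∪ {q₂} ×ˢ (t '' I) ∪ sweptClosed q₂ a v t {s ∈ I | (v s).im = 0} := by
  ext p
  constructor
  · rintro ⟨⟨x, hx, s, hs, rfl⟩, hp, -⟩
    rcases h.closedPolar_cases hx (hi s hs) with rfl | rfl | ⟨-, h0⟩ | ⟨-, -, h0⟩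
    · exact Or.inl (Or.inl ⟨h.closedPolar_neg_one _, s, hs, rfl⟩)
    · exact Or.inl (Or.inr ⟨closedPolar_one (hn s hs), s, hs, rfl⟩)
    · exact Or.inr ⟨x, hx, s, ⟨hs, h0⟩, rfl⟩
    · exact absurd h0 (not_mem_hypPlane_of_mem_idealBoundary hp)
  · rintro ((⟨hp, s, hs, hps⟩ | ⟨hp, s, hs, hps⟩) | ⟨x, hx, s, ⟨hs, h0⟩, rfl⟩)
    · refine ⟨⟨-1, by simp, s, hs, ?_⟩, ?_, mem_univ _⟩
      · rw [h.closedPolar_neg_one]; exact Prod.ext hp hps.symm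
      · rw [mem_singleton_iff.mp hp]; exact h.left_mem
    · refine ⟨⟨1, by simp, s, hs, ?_⟩, ?_, mem_univ _⟩
      · rw [closedPolar_one (hn s hs)]; exact Prod.ext hp hps.symm
      · rw [mem_singleton_iff.mp hp]; exact h.right_mem
    · refine ⟨⟨x, hx, s, hs, rfl⟩, h.closedPolar_mem_idealBoundary_of_or (hn s hs) ?_, mem_univ _⟩
      rcases hx.2.eq_or_lt with h1 | h1
      · exact Or.inr (Or.inl h1)
      · exact Or.inr (Or.inr ⟨h1, h0⟩)

theorem sweptClosed_inter_space_subset (h : IsFrame q₁ q₂ a) (hn : ∀ s ∈ I, ‖v s‖ = 1)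
    (hi : ∀ s ∈ I, 0 ≤ (v s).im) :
    sweptClosed q₂ a v t I ∩ space ⊆ swept q₂ a v t {s ∈ I | 0 < (v s).im} := by
  rintro _ ⟨⟨x, hx, s, hs, rfl⟩, hp, -⟩
  have hno : ∀ hor : x = -1 ∨ x = 1 ∨ x < 1 ∧ (v s).im = 0, False := fun hor =>
    not_mem_hypPlane_of_mem_idealBoundary (h.closedPolar_mem_idealBoundary_of_or (hn s hs) hor) hp
  rcases h.closedPolar_cases hx (hi s hs) with h0 | h0 | h0 | ⟨hx', h0, -⟩
  · exact (hno (Or.inl h0)).elim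
  · exact (hno (Or.inr (Or.inl h0))).elim
  · exact (hno (Or.inr (Or.inr h0))).elim
  · rw [swept_eq_image]
    exact ⟨(x, s), ⟨hx', hs, h0⟩, rfl⟩

/-! #### Sectors -/

/-- A sector is the projection of a swept set of height zero, so connectedness and closure come from
the results on swept sets. -/
theorem sector_eq (h : IsFrame q₁ q₂ a) {α β : ℝ} (hα : -(Real.pi / 2) ≤ α)
    (hβ : β ≤ Real.pi / 2) :
    {z ∈ hypPlane | diskAngle q₁ q₂ a z ∈ Ioo α β} =
      Prod.fst '' swept q₂ a dirOf (fun _ => 0) (Ioo α β) := by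
  ext z
  constructor
  · rintro ⟨hz, hg⟩
    obtain ⟨r, hr, hzr⟩ := h.exists_eq_halfPlaneToDisk hz
    exact ⟨(z, 0), ⟨r, hr, _, hg, by rw [← hzr]⟩, rfl⟩
  · rintro ⟨_, ⟨r, hr, s, hs, rfl⟩, rfl⟩
    have hs' : s ∈ Ioo (-(Real.pi / 2)) (Real.pi / 2) := ⟨by linarith [hs.1], by linarith [hs.2]⟩
    refine ⟨h.polar_mem_hypPlane hr (Real.cos_pos_of_mem_Ioo hs'), ?_⟩
    simp only
    rwa [h.diskAngle_dirOf hr hs']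

theorem isOpen_sector (h : IsFrame q₁ q₂ a) (α β : ℝ) :
    IsOpen {z ∈ hypPlane | diskAngle q₁ q₂ a z ∈ Ioo α β} :=
  h.contDiffOn_diskAngle.continuousOn.isOpen_inter_preimage Metric.isOpen_ball isOpen_Ioo

theorem isConnected_sector (h : IsFrame q₁ q₂ a) {α β : ℝ} (hα : -(Real.pi / 2) ≤ α)
    (hβ : β ≤ Real.pi / 2) (hαβ : α < β) :
    IsConnected {z ∈ hypPlane | diskAngle q₁ q₂ a z ∈ Ioo α β} := by
  rw [h.sector_eq hα hβ]
  refine (h.isConnected_swept (isConnected_Ioo hαβ) contDiff_dirOf.continuous.continuousOn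
    continuousOn_const (fun s _ => norm_dirOf s) fun s hs => ?_).image _
    continuous_fst.continuousOn
  exact Real.cos_nonneg_of_mem_Icc ⟨by linarith [hs.1], by linarith [hs.2]⟩

theorem planeAsympBoundary_sector (h : IsFrame q₁ q₂ a) {α β : ℝ} (hα : -(Real.pi / 2) ≤ α)
    (hβ : β ≤ Real.pi / 2) (hαβ : α < β) :
    planeAsympBoundary {z ∈ hypPlane | diskAngle q₁ q₂ a z ∈ Ioo α β} =
      {q₁, q₂} ∪ {z | ∃ x ∈ Icc (-1 : ℝ) 1, ∃ s ∈ Icc α β, Real.cos s = 0 ∧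
        z = closedPolar q₂ a x (dirOf s)} := by
  have hi : ∀ s ∈ Icc α β, 0 ≤ (dirOf s).im := fun s hs =>
    Real.cos_nonneg_of_mem_Icc ⟨by linarith [hs.1], by linarith [hs.2]⟩
  have hcl := h.closure_swept (t := fun _ => 0) hαβ contDiff_dirOf.continuous.continuousOn
    continuousOn_const (fun s _ => norm_dirOf s) hi
  have hcyl := h.sweptClosed_inter_cylinder (t := fun _ => 0) (fun s _ => norm_dirOf s) hi
  have hcomp : IsCompact (closure (swept q₂ a dirOf (fun _ => 0) (Ioo α β))) := by
    refine Metric.isCompact_of_isClosed_isBounded isClosed_closure ?_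
    refine Bornology.IsBounded.closure ?_
    refine ((Metric.isBounded_ball (x := (0 : ℂ)) (r := 1)).prod
      (Metric.isBounded_closedBall (x := (0 : ℝ)) (r := 1))).subset ?_
    rintro _ ⟨r, hr, s, hs, rfl⟩
    refine ⟨h.polar_mem_hypPlane hr (Real.cos_pos_of_mem_Ioo
      ⟨by linarith [hs.1], by linarith [hs.2]⟩), by simp⟩
  have : planeAsympBoundary {z ∈ hypPlane | diskAngle q₁ q₂ a z ∈ Ioo α β} =
      Prod.fst '' (sweptClosed q₂ a dirOf (fun _ => 0) (Icc α β) ∩ cylinder) := by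
    rw [planeAsympBoundary, h.sector_eq hα hβ,
      ← image_closure_of_isCompact hcomp continuous_fst.continuousOn, hcl, cylinder]
    ext z
    constructor
    · rintro ⟨⟨p, hp, rfl⟩, hz⟩
      exact ⟨p, ⟨hp, hz, mem_univ _⟩, rfl⟩
    · rintro ⟨p, ⟨hp, hz, -⟩, rfl⟩
      exact ⟨⟨p, hp, rfl⟩, hz⟩
  rw [this, hcyl, image_union, image_union]
  have hne : (Icc α β).Nonempty := nonempty_Icc.mpr hαβ.le
  rw [hne.image_const, Set.fst_image_prod _ (singleton_nonempty _),
    Set.fst_image_prod _ (singleton_nonempty _), singleton_union]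
  congr 1
  ext z
  constructor
  · rintro ⟨_, ⟨x, hx, s, ⟨hs, h0⟩, rfl⟩, rfl⟩
    exact ⟨x, hx, s, hs, h0, rfl⟩
  · rintro ⟨x, hx, s, hs, h0, rfl⟩
    exact ⟨_, ⟨x, hx, s, ⟨hs, h0⟩, rfl⟩, rfl⟩

theorem planeAsympBoundary_sector_right (h : IsFrame q₁ q₂ a) {g : ℝ}
    (hg : g ∈ Ioo (-(Real.pi / 2)) (Real.pi / 2)) :
    planeAsympBoundary {z ∈ hypPlane | diskAngle q₁ q₂ a z ∈ Ioo g (Real.pi / 2)} =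
      ccwArc q₁ q₂ := by
  rw [h.planeAsympBoundary_sector hg.1.le le_rfl hg.2, h.ccwArc_left_right]
  ext z
  constructor
  · rintro ((rfl | rfl) | ⟨x, hx, s, hs, h0, rfl⟩)
    · exact ⟨-1, by simp, h.closedPolar_neg_one 1⟩
    · exact ⟨1, by simp, closedPolar_one (by simp)⟩
    · rcases hs.2.eq_or_lt with rfl | h1
      · exact ⟨x, hx, by rw [dirOf_pi_div_two]⟩
      · exact absurd h0 (Real.cos_pos_of_mem_Ioo ⟨by linarith [hs.1, hg.1], h1⟩).ne'
  · rintro ⟨x, hx, rfl⟩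
    exact Or.inr ⟨x, hx, Real.pi / 2, ⟨hg.2.le, le_rfl⟩, by simp, by rw [dirOf_pi_div_two]⟩

theorem planeAsympBoundary_sector_left (h : IsFrame q₁ q₂ a) {g : ℝ}
    (hg : g ∈ Ioo (-(Real.pi / 2)) (Real.pi / 2)) :
    planeAsympBoundary {z ∈ hypPlane | diskAngle q₁ q₂ a z ∈ Ioo (-(Real.pi / 2)) g} ≠
      ccwArc q₁ q₂ := by
  intro hcon
  apply h.closedPolar_zero_neg_one_notMem
  rw [← hcon, h.planeAsympBoundary_sector le_rfl hg.2.le hg.1]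
  exact Or.inr ⟨0, by simp, -(Real.pi / 2), ⟨le_rfl, hg.1.le⟩, by simp,
    by rw [dirOf_neg_pi_div_two]⟩

/-- The two sectors cut out by the level line are open, connected and disjoint, so they are the
components of its complement. The left one has the ideal point `closedPolar q₂ a 0 (-1)` in its
closure, which is not on the arc. -/
theorem componentWith_eq (h : IsFrame q₁ q₂ a) {g : ℝ}
    (hg : g ∈ Ioo (-(Real.pi / 2)) (Real.pi / 2)) :
    componentWith {z ∈ hypPlane | diskAngle q₁ q₂ a z = g} (ccwArc q₁ q₂) =
      {z ∈ hypPlane | g < diskAngle q₁ q₂ a z} := by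
  set S := {z ∈ hypPlane | diskAngle q₁ q₂ a z = g} with hS
  set U := {z ∈ hypPlane | diskAngle q₁ q₂ a z ∈ Ioo g (Real.pi / 2)} with hU
  set V := {z ∈ hypPlane | diskAngle q₁ q₂ a z ∈ Ioo (-(Real.pi / 2)) g} with hV
  have hUV : Disjoint U V := by
    rw [Set.disjoint_left]
    rintro z ⟨-, h1⟩ ⟨-, h2⟩
    linarith [h1.1, h2.2]
  have hcov : hypPlane \ S ⊆ U ∪ V := by
    rintro z ⟨hz, hzS⟩
    have hm := h.diskAngle_mem hz
    rcases lt_trichotomy (diskAngle q₁ q₂ a z) g with h1 | h1 | h1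
    · exact Or.inr ⟨hz, hm.1, h1⟩
    · exact absurd ⟨hz, h1⟩ hzS
    · exact Or.inl ⟨hz, h1, hm.2⟩
  have hUS : U ⊆ hypPlane \ S := fun z hz => ⟨hz.1, fun h0 => (h0.2 ▸ hz.2.1).false⟩
  have hVS : V ⊆ hypPlane \ S := fun z hz => ⟨hz.1, fun h0 => (h0.2 ▸ hz.2.2).false⟩
  have hUo := h.isOpen_sector g (Real.pi / 2)
  have hVo := h.isOpen_sector (-(Real.pi / 2)) g
  have hcompU : ∀ z ∈ U, connectedComponentIn (hypPlane \ S) z = U := fun z hz =>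
    Subset.antisymm
      (isPreconnected_connectedComponentIn.subset_left_of_subset_union hUo hVo hUV
        ((connectedComponentIn_subset _ _).trans hcov)
        ⟨z, mem_connectedComponentIn (hUS hz), hz⟩)
      ((h.isConnected_sector hg.1.le le_rfl hg.2).isPreconnected.subset_connectedComponentIn hz hUS)
  have hcompV : ∀ z ∈ V, connectedComponentIn (hypPlane \ S) z = V := fun z hz =>
    Subset.antisymm
      (isPreconnected_connectedComponentIn.subset_right_of_subset_union hUo hVo hUV
        ((connectedComponentIn_subset _ _).trans hcov)
        ⟨z, mem_connectedComponentIn (hVS hz), hz⟩)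
      ((h.isConnected_sector le_rfl hg.2.le hg.1).isPreconnected.subset_connectedComponentIn hz hVS)
  ext z
  constructor
  · rintro ⟨hz, hA⟩
    rcases hcov hz with h1 | h1
    · exact ⟨h1.1, h1.2.1⟩
    · rw [hcompV z h1] at hA
      exact absurd hA (h.planeAsympBoundary_sector_left hg)
  · rintro ⟨hz, h1⟩
    have hzU : z ∈ U := ⟨hz, h1, (h.diskAngle_mem hz).2⟩
    exact ⟨hUS hzU, by rw [hcompU z hzU, h.planeAsympBoundary_sector_right hg]⟩

theorem equidistantLine_eq (h : IsFrame q₁ q₂ a) {d : ℝ} (hd : 1 < d) :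
    equidistantLine q₁ q₂ d = {z ∈ hypPlane | diskAngle q₁ q₂ a z = Real.arccos d⁻¹} := by
  have hpi := Real.pi_pos
  have hd0 : 0 < d := by linarith
  have hd1 := inv_lt_one_of_one_lt₀ hd
  have hcos : Real.cos (Real.arccos d⁻¹) = d⁻¹ :=
    Real.cos_arccos (by linarith [inv_pos.mpr hd0]) hd1.le
  have harc := arccos_inv_mem hd
  have hcw := h.componentWith_eq (g := 0) ⟨by linarith, by linarith⟩
  rw [← h.geodesicLine_eq_diskAngle] at hcw
  rw [equidistantLine, hcw]
  ext z
  constructor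
  · rintro ⟨⟨hz, h0⟩, hdist⟩
    refine ⟨hz, ?_⟩
    have hm := h.diskAngle_mem hz
    have hc := Real.cos_pos_of_mem_Ioo hm
    rw [h.hypDistTo_geodesicLine hz] at hdist
    have := Real.arcosh_injOn
      (show _ ∈ {x : ℝ | 1 ≤ x} from (one_le_inv₀ hc).mpr (Real.cos_le_one _)) hd.le hdist
    rw [← this, inv_inv, Real.arccos_cos h0.le (by linarith [hm.2])]
  · rintro ⟨hz, hg⟩
    refine ⟨⟨hz, by rw [hg]; exact harc.1⟩, ?_⟩
    rw [h.hypDistTo_geodesicLine hz, hg, hcos, inv_inv]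

end IsFrame

end

section

namespace IsFrame

variable {q₁ q₂ a : ℂ}

/-! ### Closures of complete swept sets -/

variable {v : ℝ → ℂ} {t : ℝ → ℝ}

theorem closure_swept_inter_space_subset (h : IsFrame q₁ q₂ a) {α β : ℝ} (hαβ : α < β)
    (hv : ContinuousOn v (Icc α β)) (ht : ContinuousOn t (Icc α β))
    (hn : ∀ s ∈ Icc α β, ‖v s‖ = 1) (hi : ∀ s ∈ Icc α β, 0 ≤ (v s).im)
    (hα : (v α).im = 0) (hβ : (v β).im = 0) :
    closure (swept q₂ a v t (Ioo α β)) ∩ space ⊆ swept q₂ a v t (Ioo α β) := by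
  rw [h.closure_swept hαβ hv ht hn hi]
  refine (h.sweptClosed_inter_space_subset hn hi).trans (swept_mono ?_)
  rintro s ⟨hs, h0⟩
  refine ⟨lt_of_le_of_ne hs.1 ?_, lt_of_le_of_ne hs.2 ?_⟩
  · rintro rfl; exact h0.ne' hα
  · rintro rfl; exact h0.ne' hβ

/-- Of the parameter rectangle, the edges `x = ±1` collapse to `q₁` and `q₂` and keep only the
height. On the edges `s = α` and `s = β` the direction is real, so they trace ideal arcs at constant
height. -/
theorem asympBoundary_swept (h : IsFrame q₁ q₂ a) {α β : ℝ} (hαβ : α < β)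
    (hv : ContinuousOn v (Icc α β)) (ht : ContinuousOn t (Icc α β)) (hmono : MonotoneOn t (Icc α β))
    (hn : ∀ s ∈ Icc α β, ‖v s‖ = 1) (hi : ∀ s ∈ Ioo α β, 0 < (v s).im)
    (hα : (v α).im = 0) (hβ : (v β).im = 0) :
    asympBoundary (swept q₂ a v t (Ioo α β)) =
      {q₁} ×ˢ Icc (t α) (t β) ∪ {q₂} ×ˢ Icc (t α) (t β) ∪
        (((fun x : ℝ => closedPolar q₂ a x (v α)) '' Icc (-1) 1) ×ˢ {t α} ∪
        ((fun x : ℝ => closedPolar q₂ a x (v β)) '' Icc (-1) 1) ×ˢ {t β}) := by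
  have hαm : α ∈ Icc α β := left_mem_Icc.mpr hαβ.le
  have hβm : β ∈ Icc α β := right_mem_Icc.mpr hαβ.le
  have hends : ∀ s ∈ Icc α β, s = α ∨ s = β ∨ s ∈ Ioo α β := by
    intro s hs
    rcases hs.1.eq_or_lt with h1 | h1
    · exact Or.inl h1.symm
    rcases hs.2.eq_or_lt with h2 | h2
    · exact Or.inr (Or.inl h2)
    · exact Or.inr (Or.inr ⟨h1, h2⟩)
  have hi' : ∀ s ∈ Icc α β, 0 ≤ (v s).im := by
    intro s hs
    rcases hends s hs with rfl | rfl | h1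
    · exact hα.ge
    · exact hβ.ge
    · exact (hi s h1).le
  have himage : t '' Icc α β = Icc (t α) (t β) :=
    Subset.antisymm (image_subset_iff.mpr fun s hs => ⟨hmono hαm hs hs.1, hmono hs hβm hs.2⟩)
      (intermediate_value_Icc hαβ.le ht)
  rw [asympBoundary, h.closure_swept hαβ hv ht hn hi', h.sweptClosed_inter_cylinder hn hi', himage]
  congr 1
  ext p
  constructor
  · rintro ⟨x, hx, s, ⟨hs, h0⟩, rfl⟩
    rcases hends s hs with rfl | rfl | h1
    · exact Or.inl ⟨⟨x, hx, rfl⟩, rfl⟩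
    · exact Or.inr ⟨⟨x, hx, rfl⟩, rfl⟩
    · exact absurd h0 (hi s h1).ne'
  · rintro (⟨⟨x, hx, hp⟩, hp2⟩ | ⟨⟨x, hx, hp⟩, hp2⟩)
    · exact ⟨x, hx, α, ⟨hαm, hα⟩, Prod.ext hp.symm hp2⟩
    · exact ⟨x, hx, β, ⟨hβm, hβ⟩, Prod.ext hp.symm hp2⟩

/-! ### The boundary curves -/

theorem exists_angle (h : IsFrame q₁ q₂ a) :
    ∃ φ ∈ Ioo 0 (2 * Real.pi), q₂ = q₁ * Complex.exp (φ * Complex.I) := by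
  obtain ⟨α, ⟨hα0, hα1⟩, ha⟩ := h.exists_arg
  refine ⟨2 * Real.pi - 2 * α, ⟨by linarith, by linarith⟩, ?_⟩
  have h2 : Complex.exp ((2 * Real.pi - 2 * α : ℝ) * Complex.I) =
      1 / Complex.exp (α * Complex.I) ^ 2 := by
    push_cast
    rw [sub_mul, Complex.exp_sub, Complex.exp_two_pi_mul_I, mul_assoc, ← Complex.exp_nat_mul]
    push_cast
    rfl
  have ha0 := h.base_ne_zero
  rw [h2, ← ha, h.left_eq]
  field_simp

theorem ccwArc_eq_image (h : IsFrame q₁ q₂ a) {φ : ℝ} (hφ : φ ∈ Ioo 0 (2 * Real.pi))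
    (hq : q₂ = q₁ * Complex.exp (φ * Complex.I)) :
    ccwArc q₁ q₂ = (fun x : ℝ => q₁ * Complex.exp (x * Complex.I)) '' Icc 0 φ := by
  have hq0 : q₁ ≠ 0 := by intro h0; simpa [h0] using h.norm_left
  ext z
  constructor
  · rintro ⟨θ, ψ, hθ, hθψ, hψ, hqψ, rfl⟩
    have : ψ = φ := by
      apply exp_mul_I_injOn ⟨hθ.trans hθψ, hψ⟩ ⟨hφ.1.le, hφ.2⟩
      rw [hq, mul_comm] at hqψ
      exact (mul_right_cancel₀ hq0 hqψ).symm
    exact ⟨θ, ⟨hθ, this ▸ hθψ⟩, mul_comm _ _⟩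
  · rintro ⟨x, hx, rfl⟩
    exact ⟨x, φ, hx.1, hx.2, hφ.2, by rw [hq, mul_comm], mul_comm _ _⟩

theorem ccwArc_eq_image' (h : IsFrame q₁ q₂ a) {φ : ℝ} (hφ : φ ∈ Ioo 0 (2 * Real.pi))
    (hq : q₂ = q₁ * Complex.exp (φ * Complex.I)) :
    ccwArc q₂ q₁ =
      (fun x : ℝ => q₁ * Complex.exp (x * Complex.I)) '' Icc φ (2 * Real.pi) := by
  have hq0 : q₁ ≠ 0 := by intro h0; simpa [h0] using h.norm_left
  have hfull : Complex.exp ((2 * Real.pi - φ : ℝ) * Complex.I) * Complex.exp (φ * Complex.I) = 1 := by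
    rw [← Complex.exp_add, ← add_mul]
    push_cast
    rw [sub_add_cancel, Complex.exp_two_pi_mul_I]
  ext z
  constructor
  · rintro ⟨θ, ψ, hθ, hθψ, hψ, hqψ, rfl⟩
    have : ψ = 2 * Real.pi - φ := by
      apply exp_mul_I_injOn ⟨hθ.trans hθψ, hψ⟩ ⟨by linarith [hφ.2], by linarith [hφ.1]⟩
      have he := Complex.exp_ne_zero (φ * Complex.I)
      apply mul_right_cancel₀ he
      rw [hfull]
      apply mul_right_cancel₀ hq0
      rw [one_mul]
      nth_rewrite 2 [hqψ]
      rw [hq]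
      ring
    refine ⟨θ + φ, ⟨by linarith, by linarith⟩, ?_⟩
    simp only
    rw [hq]
    push_cast
    rw [add_mul, Complex.exp_add]
    ring
  · rintro ⟨x, hx, rfl⟩
    refine ⟨x - φ, 2 * Real.pi - φ, by linarith [hx.1], by linarith [hx.2], by linarith [hφ.1],
      ?_, ?_⟩
    · rw [hq]; linear_combination (-q₁) * hfull
    · simp only
      rw [hq]
      have : Complex.exp (x * Complex.I) =
          Complex.exp ((x - φ : ℝ) * Complex.I) * Complex.exp (φ * Complex.I) := by
        rw [← Complex.exp_add, ← add_mul]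
        push_cast
        rw [sub_add_cancel]
      rw [this]
      ring

theorem isJordanCurve_contractible (h : IsFrame q₁ q₂ a) {K : ℝ} (hK : 0 < K) :
    IsJordanCurve (ccwArc q₁ q₂ ×ˢ {-K} ∪ ccwArc q₁ q₂ ×ˢ {K} ∪ {q₂} ×ˢ Icc (-K) K ∪
      {q₁} ×ˢ Icc (-K) K) := by
  obtain ⟨φ, hφ, hq⟩ := h.exists_angle
  have hr := range_polygonCurve q₁ h.norm_left φ (-φ) hφ.1 (neg_ne_zero.mpr hφ.1.ne') hK
  have hJ := isJordanParam_polygonCurve q₁ h.norm_left hφ hK (Or.inr (rfl : -φ = -φ))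
  rw [hr, add_neg_cancel, uIcc_of_ge hφ.1.le, ← hq, ← h.ccwArc_eq_image hφ hq] at hJ
  have hΓ : ({q₁} ×ˢ Icc (-K) K ∪ ccwArc q₁ q₂ ×ˢ {K} ∪ {q₂} ×ˢ Icc (-K) K ∪
      ccwArc q₁ q₂ ×ˢ {-K} : Set (ℂ × ℝ)) =
      ccwArc q₁ q₂ ×ˢ {-K} ∪ ccwArc q₁ q₂ ×ˢ {K} ∪ {q₂} ×ˢ Icc (-K) K ∪ {q₁} ×ˢ Icc (-K) K := by
    ext p
    simp only [mem_union]
    tauto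
  exact ⟨_, hΓ ▸ hJ⟩

theorem isHomologousToZero_contractible (h : IsFrame q₁ q₂ a) (K : ℝ) :
    IsHomologousToZero (ccwArc q₁ q₂ ×ˢ {-K} ∪ ccwArc q₁ q₂ ×ˢ {K} ∪ {q₂} ×ˢ Icc (-K) K ∪
      {q₁} ×ˢ Icc (-K) K) := by
  have hm := h.closedPolar_mem_idealBoundary (x := 0) zero_lt_one (v := -1) (by simp)
  rw [idealBoundary, mem_sphere_zero_iff_norm] at hm
  have hnot := h.closedPolar_zero_neg_one_notMem
  have h1 : q₁ ∈ ccwArc q₁ q₂ := by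
    rw [h.ccwArc_left_right]; exact ⟨-1, by simp, h.closedPolar_neg_one 1⟩
  have h2 : q₂ ∈ ccwArc q₁ q₂ := by
    rw [h.ccwArc_left_right]; exact ⟨1, by simp, closedPolar_one (by simp)⟩
  refine isHomologousToZero_of_forall_ne (m := -closedPolar q₂ a 0 (-1)) (by rwa [norm_neg]) ?_
  intro p hp hpe
  rw [neg_neg] at hpe
  apply hnot
  rw [← hpe]
  rcases hp with ((hp | hp) | hp) | hp
  · exact hp.1
  · exact hp.1
  · rw [mem_singleton_iff.mp hp.1]; exact h2
  · rw [mem_singleton_iff.mp hp.1]; exact h1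

/-- One parametrization that bounds no chain suffices. The polygon with `μ = 2π - φ` has an angle
going from `0` to `2π`. -/
theorem isJordanCurve_essential (h : IsFrame q₁ q₂ a) {K : ℝ} (hK : 0 < K) :
    IsJordanCurve (ccwArc q₂ q₁ ×ˢ {-K} ∪ ccwArc q₁ q₂ ×ˢ {K} ∪ {q₁} ×ˢ Icc (-K) K ∪
        {q₂} ×ˢ Icc (-K) K) ∧
      ¬ IsHomologousToZero (ccwArc q₂ q₁ ×ˢ {-K} ∪ ccwArc q₁ q₂ ×ˢ {K} ∪ {q₁} ×ˢ Icc (-K) K ∪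
        {q₂} ×ˢ Icc (-K) K) := by
  obtain ⟨φ, hφ, hq⟩ := h.exists_angle
  have hμ : 2 * Real.pi - φ ≠ 0 := by linarith [hφ.2]
  have hr := range_polygonCurve q₁ h.norm_left φ (2 * Real.pi - φ) hφ.1 hμ hK
  have hJ := isJordanParam_polygonCurve q₁ h.norm_left hφ hK
    (Or.inl (rfl : 2 * Real.pi - φ = 2 * Real.pi - φ))
  rw [hr, add_sub_cancel, uIcc_of_le hφ.2.le, ← hq, ← h.ccwArc_eq_image hφ hq,
    ← h.ccwArc_eq_image' hφ hq] at hJ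
  have hΓ : ({q₁} ×ˢ Icc (-K) K ∪ ccwArc q₁ q₂ ×ˢ {K} ∪ {q₂} ×ˢ Icc (-K) K ∪
      ccwArc q₂ q₁ ×ˢ {-K} : Set (ℂ × ℝ)) =
      ccwArc q₂ q₁ ×ˢ {-K} ∪ ccwArc q₁ q₂ ×ˢ {K} ∪ {q₁} ×ˢ Icc (-K) K ∪ {q₂} ×ˢ Icc (-K) K := by
    ext p
    simp only [mem_union]
    tauto
  rw [hΓ] at hJ
  refine ⟨⟨_, hJ⟩, fun hhom => ?_⟩
  obtain ⟨c, hc⟩ := hhom _ hJ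
  have hcont : Continuous fun s : unitInterval =>
      q₁.arg + polygonAngle φ (2 * Real.pi - φ) s := by
    unfold polygonAngle
    have h1 := (continuous_ramp 1).comp (continuous_subtype_val (p := (· ∈ Icc (0 : ℝ) 1)))
    have h3 := (continuous_ramp 3).comp (continuous_subtype_val (p := (· ∈ Icc (0 : ℝ) 1)))
    simp only [Function.comp_def] at h1 h3
    fun_prop
  refine singularBoundary_ne_of_lift (θ := ⟨_, hcont⟩) (fun s => ?_) ?_ c hc
  · have hs := congrArg Prod.fst
      (polygonCurve_coe q₁ h.norm_left φ (2 * Real.pi - φ) K s)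
    rw [hs, Circle.coe_exp]
    have hpol := Complex.norm_mul_exp_arg_mul_I q₁
    rw [h.norm_left, Complex.ofReal_one, one_mul] at hpol
    simp only [ContinuousMap.coe_mk]
    push_cast
    rw [add_mul, Complex.exp_add, hpol]
  · have h0 := (polygon_zero φ (2 * Real.pi - φ) K).1
    have h1 := (polygon_one φ (2 * Real.pi - φ) K).1
    change q₁.arg + polygonAngle φ (2 * Real.pi - φ) 0 ≠
      q₁.arg + polygonAngle φ (2 * Real.pi - φ) 1
    rw [h0, h1]
    intro hcon
    linarith [Real.pi_pos]

end IsFrame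

end

section

theorem hasDerivAt_dirOf (g : ℝ) : HasDerivAt dirOf (-Complex.I * dirOf g) g := by
  have h1 := (Real.hasDerivAt_sin g).ofReal_comp
  have h2 := (Real.hasDerivAt_cos g).ofReal_comp.mul_const Complex.I
  have h3 := h1.add h2
  have : dirOf = fun g : ℝ => ((Real.sin g : ℂ) + Real.cos g * Complex.I) := funext dirOf_eq
  rw [this]
  refine h3.congr_deriv ?_
  push_cast
  linear_combination (Complex.cos g) * Complex.I_sq

/-! ### The entire graphs -/

/-- The angle `g` itself is the parameter. The slope is the positive root of `h² + cos² g = 1 / d²`,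
nowhere zero since `d < 1`, and the speed of the height is `1 / h`. -/
theorem isMinimalProfile_entire {d : ℝ} (hd : d ∈ Ioo (0 : ℝ) 1) :
    IsMinimalProfile dirOf (fun g => d * ellipticInt d g)
      (fun g => d * (√(1 - d ^ 2 * Real.cos g ^ 2))⁻¹)
      (fun g => √(1 - d ^ 2 * Real.cos g ^ 2) / d) (Ioo (-(Real.pi / 2)) (Real.pi / 2)) where
  isOpen := isOpen_Ioo
  ordConnected := ordConnected_Ioo
  norm_eq g _ := norm_dirOf g
  im_pos _ hg := Real.cos_pos_of_mem_Ioo hg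
  contDiffOn_curve := contDiff_dirOf.contDiffOn
  contDiffOn_speed := (contDiff_const.mul (contDiff_integrand (Ioo_subset_Ico_self hd))).contDiffOn
  hasDerivAt_height g _ := (hasDerivAt_ellipticInt (Ioo_subset_Ico_self hd) g).const_mul d
  speed_pos g _ := mul_pos hd.1
    (inv_pos.mpr (Real.sqrt_pos.mpr (radicand_pos (Ioo_subset_Ico_self hd) g)))
  hasDerivAt_curve g _ := by
    have h0 := (Real.sqrt_pos.mpr (radicand_pos (Ioo_subset_Ico_self hd) g)).ne'
    have hd0 := hd.1.ne'
    have : √(1 - d ^ 2 * Real.cos g ^ 2) / d * (d * (√(1 - d ^ 2 * Real.cos g ^ 2))⁻¹) = 1 := by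
      field_simp
    rw [← Complex.ofReal_mul, this]
    simpa using hasDerivAt_dirOf g
  hasDerivAt_slope g _ := by
    have hr := radicand_pos (Ioo_subset_Ico_self hd) g
    have h0 := (Real.sqrt_pos.mpr hr).ne'
    have hd0 := hd.1.ne'
    have h1 : HasDerivAt (fun g => 1 - d ^ 2 * Real.cos g ^ 2)
        (2 * d ^ 2 * (Real.cos g * Real.sin g)) g := by
      refine ((((Real.hasDerivAt_cos g).pow 2).const_mul (d ^ 2)).const_sub 1).congr_deriv ?_
      simp
      ring
    refine ((h1.sqrt hr.ne').div_const d).congr_deriv ?_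
    rw [dirOf_re, dirOf_im]
    field_simp

namespace IsFrame

variable {q₁ q₂ a : ℂ}

theorem swept_dirOf_eq_graph (h : IsFrame q₁ q₂ a) (f : ℝ → ℝ) :
    swept q₂ a dirOf f (Ioo (-(Real.pi / 2)) (Real.pi / 2)) =
      {p | p.1 ∈ hypPlane ∧ p.2 = f (diskAngle q₁ q₂ a p.1)} := by
  ext p
  constructor
  · rintro ⟨r, hr, s, hs, rfl⟩
    refine ⟨h.polar_mem_hypPlane hr (Real.cos_pos_of_mem_Ioo hs), ?_⟩
    simp only
    rw [h.diskAngle_dirOf hr hs]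
  · rintro ⟨hp, hp2⟩
    obtain ⟨r, hr, hpr⟩ := h.exists_eq_halfPlaneToDisk hp
    exact ⟨r, hr, _, h.diskAngle_mem hp, Prod.ext hpr hp2⟩

theorem contDiffOn_entire (h : IsFrame q₁ q₂ a) {d : ℝ} (hd : d ∈ Ioo (0 : ℝ) 1) :
    ContDiffOn ℝ ∞ (fun z => d * ellipticInt d (diskAngle q₁ q₂ a z)) hypPlane :=
  contDiffOn_const.mul
    ((contDiff_ellipticInt (Ioo_subset_Ico_self hd)).comp_contDiffOn h.contDiffOn_diskAngle)

theorem isMinimal_entire (h : IsFrame q₁ q₂ a) {d : ℝ} (hd : d ∈ Ioo (0 : ℝ) 1) :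
    IsCompleteProperlyEmbeddedMinimal (swept q₂ a dirOf (fun g => d * ellipticInt d g)
      (Ioo (-(Real.pi / 2)) (Real.pi / 2))) := by
  have hpi := Real.pi_pos
  refine (isMinimalProfile_entire hd).isCompleteProperlyEmbeddedMinimal_swept h
    ⟨0, by linarith, by linarith⟩ ?_
  exact h.closure_swept_inter_space_subset (by linarith) contDiff_dirOf.continuous.continuousOn
    (continuous_const.mul
      (contDiff_ellipticInt (Ioo_subset_Ico_self hd)).continuous).continuousOn
    (fun s _ => norm_dirOf s) (fun s hs => Real.cos_nonneg_of_mem_Icc hs) (by simp) (by simp)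

theorem asympBoundary_entire (h : IsFrame q₁ q₂ a) {d : ℝ} (hd : d ∈ Ioo (0 : ℝ) 1) :
    asympBoundary (swept q₂ a dirOf (fun g => d * ellipticInt d g)
      (Ioo (-(Real.pi / 2)) (Real.pi / 2))) =
      ccwArc q₂ q₁ ×ˢ {-G d} ∪ ccwArc q₁ q₂ ×ˢ {G d} ∪ {q₁} ×ˢ Icc (-G d) (G d) ∪
        {q₂} ×ˢ Icc (-G d) (G d) := by
  have hpi := Real.pi_pos
  rw [h.asympBoundary_swept (t := fun g => d * ellipticInt d g) (by linarith) contDiff_dirOf.continuous.continuousOn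
    (continuous_const.mul
      (contDiff_ellipticInt (Ioo_subset_Ico_self hd)).continuous).continuousOn
    (fun x _ y _ hxy => mul_le_mul_of_nonneg_left
      ((strictMono_ellipticInt (Ioo_subset_Ico_self hd)).monotone hxy) hd.1.le)
    (fun s _ => norm_dirOf s) (fun s hs => Real.cos_pos_of_mem_Ioo hs) (by simp) (by simp),
    dirOf_neg_pi_div_two, dirOf_pi_div_two, ← h.ccwArc_left_right, ← h.ccwArc_right_left,
    ellipticInt_neg, mul_neg, ← G_eq hd]
  ext p
  simp only [mem_union]
  tauto

end IsFrame

/-! ### The symmetric surfaces -/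

/-- The profile curve of the symmetric surfaces. -/
noncomputable def bowedCurve (e p : ℝ) : ℂ := ⟨√(1 - e ^ 2 * Real.cos p ^ 2), e * Real.cos p⟩

theorem bowedCurve_eq_dirOf (e p : ℝ) (he : |e| ≤ 1) :
    bowedCurve e p = dirOf (Real.arccos (e * Real.cos p)) := by
  have h := abs_le.mp ((abs_mul e (Real.cos p)).trans_le
    (mul_le_one₀ he (abs_nonneg _) (Real.abs_cos_le_one p)))
  apply Complex.ext
  · rw [dirOf_re, Real.sin_arccos, mul_pow]; rfl
  · rw [dirOf_im, Real.cos_arccos h.1 h.2]; rfl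

theorem bowedCurve_eq (e p : ℝ) : bowedCurve e p =
    (√(1 - e ^ 2 * Real.cos p ^ 2) : ℂ) + (e * Real.cos p : ℝ) * Complex.I := by
  rw [← Complex.mk_eq_add_mul_I]
  rfl

variable {e : ℝ}

theorem norm_bowedCurve (he : e ∈ Ioo (0 : ℝ) 1) (p : ℝ) : ‖bowedCurve e p‖ = 1 := by
  rw [bowedCurve_eq_dirOf e p (by rw [abs_of_pos he.1]; exact he.2.le), norm_dirOf]

theorem contDiff_bowedCurve (he : e ∈ Ioo (0 : ℝ) 1) : ContDiff ℝ ∞ (bowedCurve e) := by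
  have : bowedCurve e = fun p : ℝ => Complex.ofRealCLM (√(1 - e ^ 2 * Real.cos p ^ 2)) +
      Complex.ofRealCLM (e * Real.cos p) * Complex.I := funext (bowedCurve_eq e)
  rw [this]
  exact (Complex.ofRealCLM.contDiff.comp (contDiff_sqrt_radicand (Ioo_subset_Ico_self he))).add
    ((Complex.ofRealCLM.contDiff.comp (contDiff_const.mul Real.contDiff_cos)).mul contDiff_const)

theorem bowedCurve_neg (e p : ℝ) : bowedCurve e (-p) = bowedCurve e p := by
  simp [bowedCurve]

/-- With `e = 1 / d`, the first integral `h² + cos² g = e²` is parametrized by `cos g = e cos p`, `h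
= e sin p`. The slope changes sign at `p = 0`, the turning point, where `g` is no longer a parameter
while `p` and the height still are. -/
theorem isMinimalProfile_bowed (he : e ∈ Ioo (0 : ℝ) 1) :
    IsMinimalProfile (bowedCurve e) (ellipticInt e)
      (fun p => (√(1 - e ^ 2 * Real.cos p ^ 2))⁻¹)
      (fun p => e * Real.sin p) (Ioo (-(Real.pi / 2)) (Real.pi / 2)) where
  isOpen := isOpen_Ioo
  ordConnected := ordConnected_Ioo
  norm_eq p _ := norm_bowedCurve he p
  im_pos _ hp := mul_pos he.1 (Real.cos_pos_of_mem_Ioo hp)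
  contDiffOn_curve := (contDiff_bowedCurve he).contDiffOn
  contDiffOn_speed := (contDiff_integrand (Ioo_subset_Ico_self he)).contDiffOn
  hasDerivAt_height p _ := hasDerivAt_ellipticInt (Ioo_subset_Ico_self he) p
  speed_pos p _ := inv_pos.mpr (Real.sqrt_pos.mpr (radicand_pos (Ioo_subset_Ico_self he) p))
  hasDerivAt_curve p _ := by
    have hr := radicand_pos (Ioo_subset_Ico_self he) p
    have h0 := (Real.sqrt_pos.mpr hr).ne'
    have h0' : (√(1 - e ^ 2 * Real.cos p ^ 2) : ℂ) ≠ 0 := by exact_mod_cast h0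
    have h1 : HasDerivAt (fun p => √(1 - e ^ 2 * Real.cos p ^ 2))
        (e ^ 2 * (Real.cos p * Real.sin p) / √(1 - e ^ 2 * Real.cos p ^ 2)) p := by
      refine HasDerivAt.congr_deriv (HasDerivAt.sqrt
        ((((Real.hasDerivAt_cos p).pow 2).const_mul (e ^ 2)).const_sub 1) hr.ne') ?_
      simp
      field_simp
    have h2 := h1.ofReal_comp.add
      (((Real.hasDerivAt_cos p).const_mul e).ofReal_comp.mul_const Complex.I)
    have : bowedCurve e = fun p : ℝ => (√(1 - e ^ 2 * Real.cos p ^ 2) : ℂ) +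
      (e * Real.cos p : ℝ) * Complex.I := funext (bowedCurve_eq e)
    rw [this]
    refine h2.congr_deriv ?_
    push_cast
    field_simp
    linear_combination (e ^ 2 * Complex.sin p * Complex.cos p) * Complex.I_sq
  hasDerivAt_slope p _ := by
    refine ((Real.hasDerivAt_sin p).const_mul e).congr_deriv ?_
    have h0 := (Real.sqrt_pos.mpr (radicand_pos (Ioo_subset_Ico_self he) p)).ne'
    simp only [bowedCurve]
    field_simp

theorem bowedCurve_pi_div_two (e : ℝ) : bowedCurve e (Real.pi / 2) = 1 := by
  apply Complex.ext <;> simp [bowedCurve]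

theorem bowedCurve_neg_pi_div_two (e : ℝ) : bowedCurve e (-(Real.pi / 2)) = 1 := by
  rw [bowedCurve_neg, bowedCurve_pi_div_two]

namespace IsFrame

variable {q₁ q₂ a : ℂ}

theorem isMinimal_bowed (h : IsFrame q₁ q₂ a) (he : e ∈ Ioo (0 : ℝ) 1) :
    IsCompleteProperlyEmbeddedMinimal (swept q₂ a (bowedCurve e) (ellipticInt e)
      (Ioo (-(Real.pi / 2)) (Real.pi / 2))) := by
  have hpi := Real.pi_pos
  refine (isMinimalProfile_bowed he).isCompleteProperlyEmbeddedMinimal_swept h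
    ⟨0, by linarith, by linarith⟩ ?_
  exact h.closure_swept_inter_space_subset (by linarith)
    (contDiff_bowedCurve he).continuous.continuousOn
    (contDiff_ellipticInt (Ioo_subset_Ico_self he)).continuous.continuousOn
    (fun s _ => norm_bowedCurve he s)
    (fun s hs => mul_nonneg he.1.le (Real.cos_nonneg_of_mem_Icc hs))
    (by rw [bowedCurve_neg_pi_div_two]; simp) (by rw [bowedCurve_pi_div_two]; simp)

theorem asympBoundary_bowed (h : IsFrame q₁ q₂ a) {d : ℝ} (hd : 1 < d) :
    asympBoundary (swept q₂ a (bowedCurve d⁻¹) (ellipticInt d⁻¹)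
      (Ioo (-(Real.pi / 2)) (Real.pi / 2))) =
      ccwArc q₁ q₂ ×ˢ {-H d} ∪ ccwArc q₁ q₂ ×ˢ {H d} ∪ {q₂} ×ˢ Icc (-H d) (H d) ∪
        {q₁} ×ˢ Icc (-H d) (H d) := by
  have hpi := Real.pi_pos
  have he : d⁻¹ ∈ Ioo (0 : ℝ) 1 := ⟨inv_pos.mpr (by linarith), (inv_mem_Ico hd).2⟩
  rw [h.asympBoundary_swept (by linarith) (contDiff_bowedCurve he).continuous.continuousOn
    (contDiff_ellipticInt (inv_mem_Ico hd)).continuous.continuousOn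
    ((strictMono_ellipticInt (inv_mem_Ico hd)).monotone.monotoneOn _)
    (fun s _ => norm_bowedCurve he s)
    (fun s hs => mul_pos he.1 (Real.cos_pos_of_mem_Ioo hs))
    (by rw [bowedCurve_neg_pi_div_two]; simp) (by rw [bowedCurve_pi_div_two]; simp),
    bowedCurve_neg_pi_div_two, bowedCurve_pi_div_two, ← h.ccwArc_left_right, ellipticInt_neg,
    ← H_eq hd]
  ext p
  simp only [mem_union]
  tauto

theorem equidistantLine_subset_bowed (h : IsFrame q₁ q₂ a) {d : ℝ} (hd : 1 < d) :
    equidistantLine q₁ q₂ d ×ˢ {0} ⊆ swept q₂ a (bowedCurve d⁻¹) (ellipticInt d⁻¹)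
      (Ioo (-(Real.pi / 2)) (Real.pi / 2)) := by
  have hpi := Real.pi_pos
  rw [h.equidistantLine_eq hd]
  rintro ⟨z, s⟩ ⟨⟨hz, hg⟩, hs⟩
  obtain ⟨r, hr, hzr⟩ := h.exists_eq_halfPlaneToDisk hz
  refine ⟨r, hr, 0, ⟨by linarith, by linarith⟩, Prod.ext ?_ ?_⟩
  · simp only at hg
    rw [bowedCurve_eq_dirOf _ _ (by rw [abs_of_nonneg (inv_mem_Ico hd).1]; exact (inv_mem_Ico hd).2.le),
      Real.cos_zero, mul_one, ← hg]
    exact hzr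
  · rw [ellipticInt_zero]; exact hs

/-- The reflection is `p ↦ -p`: the curve is even and the height is odd. -/
theorem mem_bowed_neg {z : ℂ} {t : ℝ} (hm : (z, t) ∈ swept q₂ a (bowedCurve e) (ellipticInt e)
      (Ioo (-(Real.pi / 2)) (Real.pi / 2))) :
    (z, -t) ∈ swept q₂ a (bowedCurve e) (ellipticInt e) (Ioo (-(Real.pi / 2)) (Real.pi / 2)) := by
  obtain ⟨r, hr, s, hs, he⟩ := hm
  obtain ⟨rfl, rfl⟩ := Prod.mk.inj he
  exact ⟨r, hr, -s, ⟨by linarith [hs.2], by linarith [hs.1]⟩,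
    by rw [bowedCurve_neg, ellipticInt_neg]⟩

/-- The upper half of a symmetric surface as a vertical graph. -/
theorem bowed_inter_eq_graph (h : IsFrame q₁ q₂ a) {d : ℝ} (hd : 1 < d) :
    swept q₂ a (bowedCurve d⁻¹) (ellipticInt d⁻¹) (Ioo (-(Real.pi / 2)) (Real.pi / 2)) ∩
        {p | p.2 ∈ Icc 0 (H d)} =
      {p | p.1 ∈ {z ∈ hypPlane | Real.arccos d⁻¹ ≤ diskAngle q₁ q₂ a z} ∧
        p.2 = ellipticInt d⁻¹ (Real.arccos (d * Real.cos (diskAngle q₁ q₂ a p.1)))} := by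
  have hpi := Real.pi_pos
  have hd0 : 0 < d := by linarith
  have hI := inv_mem_Ico hd
  have he : d⁻¹ ∈ Ioo (0 : ℝ) 1 := ⟨inv_pos.mpr hd0, hI.2⟩
  have habs : |d⁻¹| ≤ 1 := by rw [abs_of_pos he.1]; exact he.2.le
  have hmono := strictMono_ellipticInt hI
  have harc := arccos_inv_mem hd
  ext p
  constructor
  · rintro ⟨⟨r, hr, s, hs, rfl⟩, hp0, -⟩
    have hs0 : 0 ≤ s := by
      simp only at hp0
      rwa [← ellipticInt_zero d⁻¹, hmono.le_iff_le] at hp0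
    have hc := Real.cos_pos_of_mem_Ioo hs
    have hc1 := Real.cos_le_one s
    have hec : 0 < d⁻¹ * Real.cos s := mul_pos he.1 hc
    have hec1 : d⁻¹ * Real.cos s ≤ d⁻¹ := mul_le_of_le_one_right he.1.le hc1
    have hang : diskAngle q₁ q₂ a (halfPlaneToDisk q₂ a (r * bowedCurve d⁻¹ s)) =
        Real.arccos (d⁻¹ * Real.cos s) := by
      rw [bowedCurve_eq_dirOf _ _ habs, h.diskAngle_dirOf hr]
      exact ⟨by linarith [Real.arccos_nonneg (d⁻¹ * Real.cos s)],
        Real.arccos_lt_pi_div_two.mpr hec⟩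
    refine ⟨⟨h.polar_mem_hypPlane hr hec, ?_⟩, ?_⟩
    · simp only
      rw [hang]
      exact Real.antitone_arccos hec1
    · simp only
      rw [hang, Real.cos_arccos (by linarith) (by linarith [he.2]), ← mul_assoc,
        mul_inv_cancel₀ hd0.ne', one_mul, Real.arccos_cos hs0 (by linarith [hs.2])]
  · rintro ⟨⟨hz, hg⟩, hp2⟩
    obtain ⟨r, hr, hzr⟩ := h.exists_eq_halfPlaneToDisk hz
    obtain ⟨z, t⟩ := p
    simp only at hz hg hp2 hzr
    have hm := h.diskAngle_mem hz
    obtain ⟨g, hgdef⟩ : ∃ g, g = diskAngle q₁ q₂ a z := ⟨_, rfl⟩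
    rw [← hgdef] at hzr hp2 hg hm
    have hc := Real.cos_pos_of_mem_Ioo hm
    have hle : Real.cos g ≤ d⁻¹ := by
      have := Real.cos_le_cos_of_nonneg_of_le_pi harc.1.le (by linarith [hm.2]) hg
      rwa [Real.cos_arccos (by linarith [he.1]) he.2.le] at this
    have hdc : d * Real.cos g ≤ 1 := by
      calc d * Real.cos g ≤ d * d⁻¹ := mul_le_mul_of_nonneg_left hle hd0.le
        _ = 1 := mul_inv_cancel₀ hd0.ne'
    have hdc0 : 0 < d * Real.cos g := mul_pos hd0 hc
    have hs1 := Real.arccos_lt_pi_div_two.mpr hdc0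
    have hs0 := Real.arccos_nonneg (d * Real.cos g)
    refine ⟨⟨r, hr, Real.arccos (d * Real.cos g), ⟨by linarith, hs1⟩, Prod.ext ?_ hp2⟩, ?_, ?_⟩
    · simp only
      rw [bowedCurve_eq_dirOf _ _ habs, Real.cos_arccos (by linarith) hdc, ← mul_assoc,
        inv_mul_cancel₀ hd0.ne', one_mul,
        Real.arccos_cos (by linarith [harc.1]) (by linarith [hm.2])]
      exact hzr
    · simp only
      rw [hp2, ← ellipticInt_zero d⁻¹]
      exact hmono.monotone hs0
    · simp only
      rw [hp2, H_eq hd]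
      exact hmono.monotone hs1.le

theorem continuousOn_bowed (h : IsFrame q₁ q₂ a) {d : ℝ} (hd : 1 < d) :
    ContinuousOn (fun z => ellipticInt d⁻¹ (Real.arccos (d * Real.cos (diskAngle q₁ q₂ a z))))
      hypPlane :=
  ((contDiff_ellipticInt (inv_mem_Ico hd)).continuous.comp (Real.continuous_arccos.comp
    (continuous_const.mul Real.continuous_cos))).comp_continuousOn
    h.contDiffOn_diskAngle.continuousOn

/-- Smoothness of `arccos` needs an argument below `1`, and `d * cos g < 1` holds strictly inside
the region. On the equidistant line `d * cos g = 1`, and only continuity is claimed there. -/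
theorem contDiffOn_bowed (h : IsFrame q₁ q₂ a) {d : ℝ} (hd : 1 < d) :
    ContDiffOn ℝ ∞ (fun z => ellipticInt d⁻¹ (Real.arccos (d * Real.cos (diskAngle q₁ q₂ a z))))
      {z ∈ hypPlane | Real.arccos d⁻¹ < diskAngle q₁ q₂ a z} := by
  have hpi := Real.pi_pos
  have hd0 : 0 < d := by linarith
  have hI := inv_mem_Ico hd
  have harc := arccos_inv_mem hd
  refine (contDiff_ellipticInt hI).comp_contDiffOn ?_
  have hcos : ContDiffOn ℝ ∞ (fun z => d * Real.cos (diskAngle q₁ q₂ a z))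
      {z ∈ hypPlane | Real.arccos d⁻¹ < diskAngle q₁ q₂ a z} :=
    (contDiff_const.mul Real.contDiff_cos).comp_contDiffOn
      (h.contDiffOn_diskAngle.mono (sep_subset _ _))
  intro z hz
  have hm := h.diskAngle_mem hz.1
  have hc := Real.cos_pos_of_mem_Ioo hm
  have hlt : Real.cos (diskAngle q₁ q₂ a z) < d⁻¹ := by
    have := Real.cos_lt_cos_of_nonneg_of_le_pi harc.1.le (by linarith [hm.2]) hz.2
    rwa [Real.cos_arccos (by linarith [hI.1]) hI.2.le] at this
  have hdc : d * Real.cos (diskAngle q₁ q₂ a z) < 1 := by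
    calc d * Real.cos (diskAngle q₁ q₂ a z) < d * d⁻¹ := mul_lt_mul_of_pos_left hlt hd0
      _ = 1 := mul_inv_cancel₀ hd0.ne'
  have hdc0 : 0 < d * Real.cos (diskAngle q₁ q₂ a z) := mul_pos hd0 hc
  have hacos : ContDiffAt ℝ ∞ Real.arccos (d * Real.cos (diskAngle q₁ q₂ a z)) :=
    Real.contDiffAt_arccos (by linarith) hdc.ne
  exact ContDiffAt.comp_contDiffWithinAt (g := Real.arccos) z hacos (hcos z hz)

end IsFrame

end

section

/-! ### The surface over a half-plane -/

/-- The height, over the direction `dirOf g`, of the minimal graph over a half-plane. -/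
noncomputable def halfHeight (g : ℝ) : ℝ := -Real.log ((1 + Real.cos g) / Real.sin g)

theorem halfHeight_pi_div_two : halfHeight (Real.pi / 2) = 0 := by simp [halfHeight]

theorem hasDerivAt_halfHeight {g : ℝ} (hg : g ∈ Ioo 0 Real.pi) :
    HasDerivAt halfHeight (Real.sin g)⁻¹ g := by
  have hs := Real.sin_pos_of_mem_Ioo hg
  have hc : 0 < 1 + Real.cos g := by nlinarith [Real.sin_sq_add_cos_sq g, Real.neg_one_le_cos g]
  have h1 := ((Real.hasDerivAt_cos g).const_add 1).div (Real.hasDerivAt_sin g) hs.ne'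
  refine (h1.log (div_pos hc hs).ne').neg.congr_deriv ?_
  simp only [Pi.div_apply]
  field_simp
  linear_combination Real.sin_sq_add_cos_sq g

theorem Ioc_subset_Ioo_pi : Ioc 0 (Real.pi / 2) ⊆ Ioo 0 Real.pi := fun g hg =>
  ⟨hg.1, by linarith [hg.2, hg.1]⟩

theorem continuousOn_halfHeight : ContinuousOn halfHeight (Ioc 0 (Real.pi / 2)) := fun _ hg =>
  (hasDerivAt_halfHeight (Ioc_subset_Ioo_pi hg)).continuousAt.continuousWithinAt

theorem strictMonoOn_halfHeight : StrictMonoOn halfHeight (Ioc 0 (Real.pi / 2)) := by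
  refine strictMonoOn_of_deriv_pos (convex_Ioc _ _) continuousOn_halfHeight fun g hg => ?_
  rw [interior_Ioc] at hg
  have hg' := Ioc_subset_Ioo_pi (Ioo_subset_Ioc_self hg)
  rw [(hasDerivAt_halfHeight hg').deriv]
  exact inv_pos.mpr (Real.sin_pos_of_mem_Ioo hg')

theorem image_halfHeight : halfHeight '' Ioc 0 (Real.pi / 2) = Iic 0 := by
  have hpi := Real.pi_pos
  apply Subset.antisymm
  · rintro _ ⟨g, hg, rfl⟩
    rw [mem_Iic, ← halfHeight_pi_div_two]
    exact strictMonoOn_halfHeight.monotoneOn hg ⟨by linarith, le_rfl⟩ hg.2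
  · intro T hT
    have hE := Real.exp_pos T
    have h1 : Real.exp T ≤ 1 := Real.exp_le_one_iff.mpr hT
    -- Since `halfHeight g = log (tan (g / 2))`, the preimage of `T` is `2 * arctan (exp T)`; the
    -- condition `T ≤ 0` keeps it at most `π/2`.
    have h2 : Real.arctan (Real.exp T) ≤ Real.pi / 4 := by
      rw [← Real.arctan_one]; exact Real.arctan_mono h1
    refine ⟨2 * Real.arctan (Real.exp T), ⟨by linarith [Real.arctan_pos.mpr hE], by linarith⟩, ?_⟩
    have hc := Real.cos_arctan_pos (Real.exp T)
    have htan := Real.tan_arctan (Real.exp T)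
    rw [Real.tan_eq_sin_div_cos, div_eq_iff hc.ne'] at htan
    have : (1 + Real.cos (2 * Real.arctan (Real.exp T))) /
        Real.sin (2 * Real.arctan (Real.exp T)) = (Real.exp T)⁻¹ := by
      rw [Real.cos_two_mul, Real.sin_two_mul, htan]
      field_simp
      ring
    rw [halfHeight, this, Real.log_inv, Real.log_exp, neg_neg]

/-- The case `d = 1` of the first integral, `h² + cos² g = 1`, with the root `h = sin g`. -/
theorem isMinimalProfile_half :
    IsMinimalProfile dirOf halfHeight (fun g => (Real.sin g)⁻¹) Real.sin (Ioo 0 (Real.pi / 2)) where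
  isOpen := isOpen_Ioo
  ordConnected := ordConnected_Ioo
  norm_eq g _ := norm_dirOf g
  im_pos _ hg := Real.cos_pos_of_mem_Ioo ⟨by linarith [hg.1, hg.2], hg.2⟩
  contDiffOn_curve := contDiff_dirOf.contDiffOn
  contDiffOn_speed := Real.contDiff_sin.contDiffOn.inv fun g hg =>
    (Real.sin_pos_of_mem_Ioo (Ioc_subset_Ioo_pi (Ioo_subset_Ioc_self hg))).ne'
  hasDerivAt_height g hg := hasDerivAt_halfHeight (Ioc_subset_Ioo_pi (Ioo_subset_Ioc_self hg))
  speed_pos g hg :=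
    inv_pos.mpr (Real.sin_pos_of_mem_Ioo (Ioc_subset_Ioo_pi (Ioo_subset_Ioc_self hg)))
  hasDerivAt_curve g hg := by
    have h0 := (Real.sin_pos_of_mem_Ioo (Ioc_subset_Ioo_pi (Ioo_subset_Ioc_self hg))).ne'
    rw [← Complex.ofReal_mul, mul_inv_cancel₀ h0]
    simpa using hasDerivAt_dirOf g
  hasDerivAt_slope g hg := by
    have h0 := (Real.sin_pos_of_mem_Ioo (Ioc_subset_Ioo_pi (Ioo_subset_Ioc_self hg))).ne'
    refine (Real.hasDerivAt_sin g).congr_deriv ?_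
    rw [dirOf_re, dirOf_im]
    field_simp

namespace IsFrame

variable {q₁ q₂ a : ℂ}

/-- The height tends to `-∞` as the angle tends to `0`, so no compact rectangle covers the whole
surface. Closure is local: above any fixed height only the angles in some `(α, π/2)` with `α > 0`
occur, and `closure_swept` applies to them. -/
theorem closure_half (h : IsFrame q₁ q₂ a) :
    closure (swept q₂ a dirOf halfHeight (Ioo 0 (Real.pi / 2))) =
      sweptClosed q₂ a dirOf halfHeight (Ioc 0 (Real.pi / 2)) := by
  have hpi := Real.pi_pos
  have hcl : ∀ {α : ℝ}, α ∈ Ioo 0 (Real.pi / 2) →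
      closure (swept q₂ a dirOf halfHeight (Ioo α (Real.pi / 2))) =
        sweptClosed q₂ a dirOf halfHeight (Icc α (Real.pi / 2)) := fun hα =>
    h.closure_swept hα.2 contDiff_dirOf.continuous.continuousOn
      (continuousOn_halfHeight.mono fun s hs => ⟨hα.1.trans_le hs.1, hs.2⟩)
      (fun s _ => norm_dirOf s)
      fun s hs => Real.cos_nonneg_of_mem_Icc ⟨by linarith [hs.1, hα.1], hs.2⟩
  apply Subset.antisymm
  · intro p hp
    -- This height is strictly below `p.2`, so that a neighbourhood of `p` lies above it, and
    -- strictly below `0`, so that it is attained at an angle other than `π/2`.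
    have hT : min p.2 0 - 1 ∈ Iic (0 : ℝ) := by
      rw [mem_Iic]; linarith [min_le_right p.2 0]
    rw [← image_halfHeight] at hT
    obtain ⟨α, hα, hαT⟩ := hT
    have hα' : α ∈ Ioo 0 (Real.pi / 2) := by
      refine ⟨hα.1, lt_of_le_of_ne hα.2 ?_⟩
      rintro rfl
      rw [halfHeight_pi_div_two] at hαT
      linarith [min_le_right p.2 0]
    have hopen : IsOpen {p : ℂ × ℝ | halfHeight α < p.2} := isOpen_lt continuous_const continuous_snd
    have hpo : p ∈ {p : ℂ × ℝ | halfHeight α < p.2} := by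
      rw [mem_ofPred_eq, hαT]; linarith [min_le_left p.2 0]
    have hmem := hopen.inter_closure ⟨hpo, hp⟩
    have hsub : {p : ℂ × ℝ | halfHeight α < p.2} ∩
        swept q₂ a dirOf halfHeight (Ioo 0 (Real.pi / 2)) ⊆
        swept q₂ a dirOf halfHeight (Ioo α (Real.pi / 2)) := by
      rintro _ ⟨hlt, r, hr, s, hs, rfl⟩
      refine ⟨r, hr, s, ⟨?_, hs.2⟩, rfl⟩
      exact (strictMonoOn_halfHeight.lt_iff_lt hα (Ioo_subset_Ioc_self hs)).mp hlt
    have := closure_mono hsub hmem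
    rw [hcl hα'] at this
    obtain ⟨x, hx, s, hs, rfl⟩ := this
    exact ⟨x, hx, s, ⟨hα.1.trans_le hs.1, hs.2⟩, rfl⟩
  · rintro _ ⟨x, hx, s, hs, rfl⟩
    have hα : s / 2 ∈ Ioo 0 (Real.pi / 2) := ⟨by linarith [hs.1], by linarith [hs.1, hs.2]⟩
    refine closure_mono (swept_mono (Ioo_subset_Ioo_left hα.1.le)) ?_
    rw [hcl hα]
    exact ⟨x, hx, s, ⟨by linarith [hs.1], hs.2⟩, rfl⟩

theorem cos_nonneg_of_mem_Ioc {s : ℝ} (hs : s ∈ Ioc 0 (Real.pi / 2)) : 0 ≤ Real.cos s :=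
  Real.cos_nonneg_of_mem_Icc ⟨by linarith [hs.1, hs.2], hs.2⟩

theorem isMinimal_half (h : IsFrame q₁ q₂ a) :
    IsCompleteProperlyEmbeddedMinimal
      (swept q₂ a dirOf halfHeight (Ioo 0 (Real.pi / 2))) := by
  have hpi := Real.pi_pos
  refine isMinimalProfile_half.isCompleteProperlyEmbeddedMinimal_swept h
    ⟨1, one_pos, by linarith [Real.pi_gt_three]⟩ ?_
  rw [h.closure_half]
  refine (h.sweptClosed_inter_space_subset (fun s _ => norm_dirOf s)
    fun s hs => cos_nonneg_of_mem_Ioc hs).trans (swept_mono ?_)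
  rintro s ⟨hs, h0⟩
  refine ⟨hs.1, lt_of_le_of_ne hs.2 ?_⟩
  rintro rfl
  simp at h0

theorem asympBoundary_half (h : IsFrame q₁ q₂ a) :
    asympBoundary (swept q₂ a dirOf halfHeight (Ioo 0 (Real.pi / 2))) =
      {q₁} ×ˢ Iic 0 ∪ ccwArc q₁ q₂ ×ˢ {0} ∪ {q₂} ×ˢ Iic 0 := by
  have hpi := Real.pi_pos
  rw [asympBoundary, h.closure_half, h.sweptClosed_inter_cylinder (fun s _ => norm_dirOf s)
    fun s hs => cos_nonneg_of_mem_Ioc hs, image_halfHeight]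
  have : sweptClosed q₂ a dirOf halfHeight {s ∈ Ioc 0 (Real.pi / 2) | (dirOf s).im = 0} =
      ccwArc q₁ q₂ ×ˢ {0} := by
    rw [h.ccwArc_left_right]
    ext p
    constructor
    · rintro ⟨x, hx, s, ⟨hs, h0⟩, rfl⟩
      have : s = Real.pi / 2 := by
        by_contra hne
        exact (Real.cos_pos_of_mem_Ioo ⟨by linarith [hs.1], lt_of_le_of_ne hs.2 hne⟩).ne' h0
      subst this
      exact ⟨⟨x, hx, by rw [dirOf_pi_div_two]⟩, halfHeight_pi_div_two⟩
    · rintro ⟨⟨x, hx, hp⟩, hp2⟩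
      refine ⟨x, hx, Real.pi / 2, ⟨⟨by linarith, le_rfl⟩, by simp⟩, Prod.ext ?_ ?_⟩
      · simp only
        rw [dirOf_pi_div_two]
        exact hp.symm
      · rw [halfHeight_pi_div_two]; exact hp2
  rw [this]
  ext p
  simp only [mem_union]
  tauto

end IsFrame

theorem swept_half_eq_image (q₂ a : ℂ) : swept q₂ a dirOf halfHeight (Ioo 0 (Real.pi / 2)) =
    (fun p : ℂ × ℝ => (halfPlaneToDisk q₂ a p.1, -p.2)) '' halfPlaneGraph := by
  have hsqrt : ∀ w : ℂ, √(w.re ^ 2 + w.im ^ 2) = ‖w‖ := fun w => by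
    rw [Complex.norm_def, Complex.normSq_apply, sq, sq]
  have hlog : ∀ {r s : ℝ}, 0 < r → -halfHeight s =
      Real.log ((‖(r * dirOf s : ℂ)‖ + ((r : ℂ) * dirOf s).im) / ((r : ℂ) * dirOf s).re) := by
    intro r s hr
    rw [halfHeight, neg_neg, norm_mul, norm_dirOf, Complex.norm_real, Real.norm_of_nonneg hr.le,
      Complex.im_ofReal_mul, Complex.re_ofReal_mul, dirOf_re, dirOf_im, ← mul_add,
      mul_div_mul_left _ _ hr.ne']
  ext p
  constructor
  · rintro ⟨r, hr, s, hs, rfl⟩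
    refine ⟨(r * dirOf s, -halfHeight s), ⟨?_, ?_, ?_⟩, by simp⟩
    · simp only
      rw [Complex.re_ofReal_mul]
      exact mul_pos hr (Real.sin_pos_of_mem_Ioo (Ioc_subset_Ioo_pi (Ioo_subset_Ioc_self hs)))
    · simp only
      rw [Complex.im_ofReal_mul]
      exact mul_pos hr (Real.cos_pos_of_mem_Ioo ⟨by linarith [hs.1, hs.2], hs.2⟩)
    · simp only
      rw [hsqrt, hlog hr]
  · rintro ⟨⟨w, t⟩, ⟨hre, him, ht⟩, rfl⟩
    simp only at hre him ht
    have hw0 : w ≠ 0 := by rintro rfl; simp at hre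
    have hr := norm_pos_iff.mpr hw0
    have harg := (abs_lt.mp (Complex.abs_arg_lt_pi_div_two_iff.mpr (Or.inl hre))).2
    have harg0 : 0 < w.arg := by
      refine lt_of_le_of_ne (Complex.arg_nonneg_iff.mpr him.le) fun h0 => ?_
      exact him.ne' (Complex.arg_eq_zero_iff.mp h0.symm).2
    -- `dirOf` measures angles clockwise from the imaginary axis, hence the complementary argument.
    have hw : w = ‖w‖ * dirOf (Real.pi / 2 - w.arg) := by
      apply Complex.ext
      · rw [Complex.re_ofReal_mul, dirOf_re, Real.sin_pi_div_two_sub, Complex.norm_mul_cos_arg]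
      · rw [Complex.im_ofReal_mul, dirOf_im, Real.cos_pi_div_two_sub, Complex.norm_mul_sin_arg]
    refine ⟨‖w‖, hr, Real.pi / 2 - w.arg, ⟨by linarith, by linarith⟩, Prod.ext ?_ ?_⟩
    · simp only
      rw [← hw]
    · simp only
      have hl := hlog (s := Real.pi / 2 - w.arg) hr
      rw [← hw] at hl
      rw [ht, hsqrt, ← hl, neg_neg]

/-! ### The family -/

/-- The one-parameter family of minimal surfaces, in the frame given by `a`. -/
noncomputable def minimalFamily (q₂ a : ℂ) (d : ℝ) : Set (ℂ × ℝ) :=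
  if d < 1 then
    swept q₂ a dirOf (fun g => d * ellipticInt d g) (Ioo (-(Real.pi / 2)) (Real.pi / 2))
  else if d = 1 then swept q₂ a dirOf halfHeight (Ioo 0 (Real.pi / 2))
  else swept q₂ a (bowedCurve d⁻¹) (ellipticInt d⁻¹) (Ioo (-(Real.pi / 2)) (Real.pi / 2))

theorem minimalFamily_of_lt (q₂ a : ℂ) {d : ℝ} (hd : d < 1) : minimalFamily q₂ a d =
    swept q₂ a dirOf (fun g => d * ellipticInt d g) (Ioo (-(Real.pi / 2)) (Real.pi / 2)) :=
  if_pos hd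

theorem minimalFamily_one (q₂ a : ℂ) : minimalFamily q₂ a 1 =
    swept q₂ a dirOf halfHeight (Ioo 0 (Real.pi / 2)) := by
  rw [minimalFamily, if_neg (lt_irrefl 1), if_pos rfl]

theorem minimalFamily_of_gt (q₂ a : ℂ) {d : ℝ} (hd : 1 < d) : minimalFamily q₂ a d =
    swept q₂ a (bowedCurve d⁻¹) (ellipticInt d⁻¹) (Ioo (-(Real.pi / 2)) (Real.pi / 2)) := by
  rw [minimalFamily, if_neg hd.le.not_gt, if_neg hd.ne']

namespace IsFrame

variable {q₁ q₂ a : ℂ}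

theorem isMinimal_minimalFamily (h : IsFrame q₁ q₂ a) {d : ℝ} (hd : 0 < d) :
    IsCompleteProperlyEmbeddedMinimal (minimalFamily q₂ a d) ∧
      ∀ T : ℂ → ℂ, IsHypTranslation q₁ q₂ T →
        (fun p : ℂ × ℝ => (T p.1, p.2)) '' minimalFamily q₂ a d = minimalFamily q₂ a d := by
  rcases lt_trichotomy d 1 with h1 | rfl | h1
  · rw [minimalFamily_of_lt q₂ a h1]
    exact ⟨h.isMinimal_entire ⟨hd, h1⟩, fun T hT =>
      h.image_swept (fun s hs => Real.cos_pos_of_mem_Ioo hs) hT⟩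
  · rw [minimalFamily_one]
    exact ⟨h.isMinimal_half, fun T hT => h.image_swept isMinimalProfile_half.im_pos hT⟩
  · rw [minimalFamily_of_gt q₂ a h1]
    have he : d⁻¹ ∈ Ioo (0 : ℝ) 1 := ⟨inv_pos.mpr hd, (inv_mem_Ico h1).2⟩
    exact ⟨h.isMinimal_bowed he, fun T hT => h.image_swept (isMinimalProfile_bowed he).im_pos hT⟩

theorem componentWith_equidistantLine (h : IsFrame q₁ q₂ a) {d : ℝ} (hd : 1 < d) :
    componentWith (equidistantLine q₁ q₂ d) (ccwArc q₁ q₂) =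
      {z ∈ hypPlane | Real.arccos d⁻¹ < diskAngle q₁ q₂ a z} := by
  have harc := arccos_inv_mem hd
  rw [h.equidistantLine_eq hd, h.componentWith_eq ⟨by linarith [harc.1, harc.2], harc.2⟩]

theorem componentWith_union_equidistantLine (h : IsFrame q₁ q₂ a) {d : ℝ} (hd : 1 < d) :
    componentWith (equidistantLine q₁ q₂ d) (ccwArc q₁ q₂) ∪ equidistantLine q₁ q₂ d =
      {z ∈ hypPlane | Real.arccos d⁻¹ ≤ diskAngle q₁ q₂ a z} := by
  rw [h.componentWith_equidistantLine hd, h.equidistantLine_eq hd]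
  ext z
  simp only [mem_union, mem_ofPred_eq, le_iff_lt_or_eq, ← and_or_left,
    eq_comm (a := Real.arccos d⁻¹)]

end IsFrame

end

end H2R

/-! ### The family in one frame, with its three regimes collected -/

theorem proposition2p5 (q₁ q₂ : ℂ) (hq₁ : q₁ ∈ idealBoundary) (hq₂ : q₂ ∈ idealBoundary)
    (hne : q₁ ≠ q₂) :
    ∃ M : ℝ → Set (ℂ × ℝ),
      (∀ d : ℝ, 0 < d → IsCompleteProperlyEmbeddedMinimal (M d) ∧
        ∀ T : ℂ → ℂ, IsHypTranslation q₁ q₂ T → (fun p : ℂ × ℝ => (T p.1, p.2)) '' M d = M d) ∧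
      -- the case `d > 1`
      (∀ d : ℝ, 1 < d →
        equidistantLine q₁ q₂ d ×ˢ {0} ⊆ M d ∧
        (∀ (z : ℂ) (t : ℝ), (z, t) ∈ M d ↔ (z, -t) ∈ M d) ∧
        IntegrableOn (heightIntegrand d) (Ioi (Real.arcosh d)) ∧
        asympBoundary (M d) =
          ccwArc q₁ q₂ ×ˢ {-H d} ∪ ccwArc q₁ q₂ ×ˢ {H d} ∪
            {q₂} ×ˢ Icc (-H d) (H d) ∪ {q₁} ×ˢ Icc (-H d) (H d) ∧
        IsJordanCurve (asympBoundary (M d)) ∧ IsHomologousToZero (asympBoundary (M d)) ∧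
        ∃ u : ℂ → ℝ,
          ContDiffOn ℝ ∞ u (componentWith (equidistantLine q₁ q₂ d) (ccwArc q₁ q₂)) ∧
          ContinuousOn u (componentWith (equidistantLine q₁ q₂ d) (ccwArc q₁ q₂) ∪
            equidistantLine q₁ q₂ d) ∧
          M d ∩ {p | p.2 ∈ Icc 0 (H d)} =
            {p | p.1 ∈ componentWith (equidistantLine q₁ q₂ d) (ccwArc q₁ q₂) ∪
              equidistantLine q₁ q₂ d ∧ p.2 = u p.1}) ∧
      AntitoneOn H (Ioi 1) ∧
      Tendsto H (𝓝[>] 1) atTop ∧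
      Tendsto H atTop (𝓝 (Real.pi / 2)) ∧
      -- the case `d = 1`
      ((∃ a : ℂ, 0 < a.im ∧ halfPlaneToDisk q₂ a 0 = q₁ ∧
          M 1 = (fun p : ℂ × ℝ => (halfPlaneToDisk q₂ a p.1, -p.2)) '' halfPlaneGraph) ∧
        asympBoundary (M 1) =
          {q₁} ×ˢ Iic 0 ∪ ccwArc q₁ q₂ ×ˢ {0} ∪ {q₂} ×ˢ Iic 0) ∧
      -- the case `0 < d < 1`
      (∀ d : ℝ, 0 < d → d < 1 →
        (∃ u : ℂ → ℝ, ContDiffOn ℝ ∞ u hypPlane ∧ M d = {p | p.1 ∈ hypPlane ∧ p.2 = u p.1}) ∧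
        geodesicLine q₁ q₂ ×ˢ {0} ⊆ M d ∧
        IntegrableOn (heightIntegrand d) (Ioi 0) ∧
        asympBoundary (M d) =
          ccwArc q₂ q₁ ×ˢ {-G d} ∪ ccwArc q₁ q₂ ×ˢ {G d} ∪
            {q₁} ×ˢ Icc (-G d) (G d) ∪ {q₂} ×ˢ Icc (-G d) (G d) ∧
        IsJordanCurve (asympBoundary (M d)) ∧ ¬ IsHomologousToZero (asympBoundary (M d))) ∧
      MonotoneOn G (Ioo 0 1) ∧
      Tendsto G (𝓝[>] 0) (𝓝 0) ∧
      Tendsto G (𝓝[<] 1) atTop := by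
  obtain ⟨a, h⟩ := exists_isFrame hq₁ hq₂ hne
  refine ⟨minimalFamily q₂ a, fun d hd => h.isMinimal_minimalFamily hd, fun d hd => ?_,
    antitoneOn_H, tendsto_H_nhdsGT_one, tendsto_H_atTop, ⟨⟨a, h.im_pos, h.halfPlaneToDisk_zero, ?_⟩,
      ?_⟩, fun d hd0 hd1 => ?_, monotoneOn_G, tendsto_G_nhdsGT_zero, tendsto_G_nhdsLT_one⟩
  · rw [minimalFamily_of_gt q₂ a hd, h.asympBoundary_bowed hd,
      h.componentWith_union_equidistantLine hd, h.componentWith_equidistantLine hd]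
    exact ⟨h.equidistantLine_subset_bowed hd,
      fun z t => ⟨IsFrame.mem_bowed_neg, fun hm => by simpa using IsFrame.mem_bowed_neg hm⟩,
      integrableOn_heightIntegrand_large hd, rfl, h.isJordanCurve_contractible (H_pos hd),
      h.isHomologousToZero_contractible (H d), _, h.contDiffOn_bowed hd,
      (h.continuousOn_bowed hd).mono (sep_subset _ _), h.bowed_inter_eq_graph hd⟩
  · rw [minimalFamily_one, swept_half_eq_image]
  · rw [minimalFamily_one, h.asympBoundary_half]
  · have hd : d ∈ Ioo (0 : ℝ) 1 := ⟨hd0, hd1⟩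
    have hJ := h.isJordanCurve_essential (G_pos hd)
    rw [minimalFamily_of_lt q₂ a hd1, h.asympBoundary_entire hd]
    refine ⟨⟨_, h.contDiffOn_entire hd, h.swept_dirOf_eq_graph _⟩, ?_,
      integrableOn_heightIntegrand_small hd, rfl, hJ.1, hJ.2⟩
    rw [h.swept_dirOf_eq_graph, h.geodesicLine_eq_diskAngle]
    rintro ⟨z, t⟩ ⟨⟨hz, h0⟩, ht⟩
    refine ⟨hz, ?_⟩
    simp only at h0 ht ⊢
    rw [h0, ellipticInt_zero, mul_zero]
    exact ht
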